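/- **Setting.** Let $\mathbb{H}$ be the hyperbolic upper half plane with boundary $\mathbb{R}\cup\{\infty\}$. An *ideal triangulation* of $\mathbb{H}$ is an infinite collection $T$ of ideal triangles (all vertices in $\mathbb{R}\cup\{\infty\}$) whose closures in $\mathbb{H}$ together cover $\mathbb{H}$ and whose interiors are pairwise disjoint. Let $\Phi$ be a subgroup of finite index in $PSL_2(\mathbb{Z})$, and $\pi:\mathbb{H}\to\Phi\backslash\mathbb{H}$ the projection to the quotient orbifold. Its cusps (marked points) are the $\Phi$-orbits of the points of $\mathbb{R}\cup\{\infty\}$ fixed by parabolic elements of $\Phi$; $E_2$ and $E_3$ denote the sets of its cone points of order $2$ and $3$ (the orbits of the points of $\mathbb{H}$ with stabilizer of order $2$, respectively $3$, in $\Phi$). An *arc* on $\Phi\backslash\mathbb{H}$ is a geodesic path without self-intersections except possibly at its ends, which joins a cusp to a cusp or to a cone point in $E_2\cup E_3$ and contains no other cone point. It is *structural* if one of its ends is in $E_3$. Two arcs are *compatible* if they meet at most in cusps. A *quotient triangulation* is a maximal collection of pairwise compatible arcs. Let $\delta\in T$. We say that $\delta$ projects to * a triangle of type (I) if $\pi$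 is injective on the interior of $\delta$, no point of the closed triangle lies over a cone point, and the three sides of $\delta$ project to three different arcs; * a (self-folded) triangle of type (II) if $\pi$ is injective on the interior, no point of the closed triangle lies over a cone point, two sides are glued to each other by an element of $\Phi$ fixing their common vertex, and the third side projects to a different arc; * a triangle of type (IIIa) if $\pi$ is injective on the interior, and exactly one point $m$ of the closed triangle lies over a cone point; $m$ lies over $E_2$ and on a side, which is folded by the rotation of order $2$ about $m$; the two other sides project to different arcs, or else $\Phi$ has index $3$ in $PSL_2(\mathbb{Z})$ and they are glued to each other by an element of $\Phi$ fixing their common vertex; * a triangle of type (IIIb) if $\pi$ is injective on the interior, and exactly two points of the closed triangle lie over cone points; they lie over two different points of $E_2$, and on two different sides, each of which is folded by the rotation of order $2$ about the point on it; * a monogon containing exactly one cone point, of order $3$, if exactly one point $q$ of the interior of $\delta$ lies over a cone point, $q$ lies over $E_3$, two points of the interior have the same projection exactly if they differ by a rotation in the stabilizer of $q$ in $\Phi$, and this stabilizer permutes the vertices of $\delta$ cyclically; the common projection of the three sides (the boundary of the monogon) contains no cone point, or else $\Phi=PSL_2(\mathbb{Z})$ and it is folded at one point of $E_2$. Finally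 let $$\Gamma_3=\left\langle \begin{pmatrix}0&-1\\1&0\end{pmatrix},\begin{pmatrix}1&-2\\1&-1\end{pmatrix},\begin{pmatrix}1&-1\\2&-1\end{pmatrix}\right\rangle\subset PSL_2(\mathbb{Z}).$$ **Lemma 3.1.** Let $\Phi\neq\Gamma_3$ be a subgroup of finite index in $PSL_2(\mathbb{Z})$, and let $T$ be an ideal triangulation of $\mathbb{H}$ which is invariant under $\Phi$. Then the projection of $T$ decomposes $\Phi\backslash\mathbb{H}$ into triangles of type (I), (II), (IIIa) or (IIIb) or monogons containing exactly one cone point, of order $3$. That is: 1. the edges of $T$ project to non-structural arcs, any two of which are equal or compatible; 2. the projections of the interiors of two triangles of $T$ are equal or disjoint, and together they form the complement in $\Phi\backslash\mathbb{H}$ of the projected edges; 3. every triangle of $T$ projects to a triangle of type (I), (II), (IIIa) or (IIIb), or to a monogon containing exactly one cone point, of order $3$. Hence $T$ induces a unique quotient triangulation: there is exactly one quotient triangulation $T_\Phi$ of $\Phi\backslash\mathbb{H}$ that contains the projections of all edges of $T$, and the non-structural arcs of $T_\Phi$ are exactly these projections. -/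

import Mathlib

open scoped MatrixGroups UpperHalfPlane

namespace QuotientTriangulation

/-! ### The action of `PSL(2, ℤ)` on the upper half plane and on its boundary `ℝ ∪ {∞}` -/

theorem center_eq (g : SL(2, ℤ)) (hg : g ∈ Subgroup.center SL(2, ℤ)) : g = 1 ∨ g = -1 := by
  rw [Matrix.SpecialLinearGroup.mem_center_iff] at hg
  obtain ⟨r, hr, hs⟩ := hg
  have hr' : r * r = 1 := by simpa [sq] using hr
  rcases mul_self_eq_one_iff.mp hr' with rfl | rfl
  · left
    ext i j
    rw [← hs]
    simp
  · right
    ext i j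
    rw [← hs]
    fin_cases i <;> fin_cases j <;> simp

/-- Möbius transformations of the upper half plane, for elements of `PSL(2, ℤ)`. -/
noncomputable def pslToPermUpper : PSL(2, ℤ) →* Equiv.Perm ℍ :=
  QuotientGroup.lift (Subgroup.center SL(2, ℤ)) (MulAction.toPermHom SL(2, ℤ) ℍ) (by
    intro g hg
    rcases center_eq g hg with rfl | rfl
    · exact map_one _
    · ext1 z
      simp [MulAction.toPermHom_apply, MulAction.toPerm_apply])

noncomputable instance : MulAction PSL(2, ℤ) ℍ := MulAction.compHom ℍ pslToPermUpper

theorem mk_smul_upper (g : SL(2, ℤ)) (z : ℍ) : (QuotientGroup.mk g : PSL(2, ℤ)) • z = g • z := rfl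

/-- Möbius transformations of `ℝ ∪ {∞}`, for elements of `PSL(2, ℤ)`. -/
noncomputable def pslToPermBoundary : PSL(2, ℤ) →* Equiv.Perm (OnePoint ℝ) :=
  QuotientGroup.lift (Subgroup.center SL(2, ℤ))
    ((MulAction.toPermHom (GL (Fin 2) ℝ) (OnePoint ℝ)).comp
      (Matrix.SpecialLinearGroup.mapGL (R := ℤ) ℝ)) (by
    intro g hg
    rcases center_eq g hg with rfl | rfl
    · exact map_one _
    · ext1 z
      induction z using OnePoint.rec <;>
        simp [MulAction.toPermHom_apply, MulAction.toPerm_apply, OnePoint.smul_some_eq_ite,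
          OnePoint.smul_infty_eq_ite])

noncomputable instance : MulAction PSL(2, ℤ) (OnePoint ℝ) :=
  MulAction.compHom (OnePoint ℝ) pslToPermBoundary

theorem mk_smul_boundary (g : SL(2, ℤ)) (x : OnePoint ℝ) :
    (QuotientGroup.mk g : PSL(2, ℤ)) • x = Matrix.SpecialLinearGroup.mapGL ℝ g • x := rfl

/-! ### Hyperbolic geometry -/

/-- Homogeneous coordinates `(num a : den a)` of a boundary point `a ∈ ℝ ∪ {∞}`. -/
def num (a : OnePoint ℝ) : ℝ := OnePoint.elim a 1 (fun x : ℝ => x)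

/-- See `num`. -/
def den (a : OnePoint ℝ) : ℝ := OnePoint.elim a 0 (fun _ : ℝ => 1)

/-- For `a ≠ b` this vanishes exactly on the geodesic line from `a` to `b`,
and has constant sign on each of its two sides. For real `a, b` it is
`(re z - a) * (re z - b) + (im z) ^ 2`. -/
noncomputable def sideFun (a b : OnePoint ℝ) (z : ℍ) : ℝ :=
  (((den a : ℂ) * (z : ℂ) - (num a : ℂ)) *
    (starRingEnd ℂ) ((den b : ℂ) * (z : ℂ) - (num b : ℂ))).re

/-- The extension of `sideFun a b` to boundary points `c`. -/
def boundarySideFun (a b c : OnePoint ℝ) : ℝ :=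
  (den a * num c - num a * den c) * (den b * num c - num b * den c)

/-- The (open) geodesic line in `ℍ` with ends `a` and `b`; empty if `a = b`. -/
def geodesicLine (a b : OnePoint ℝ) : Set ℍ := {z | sideFun a b z = 0}

theorem sideFun_coe (x y : ℝ) (z : ℍ) :
    sideFun (x : OnePoint ℝ) (y : OnePoint ℝ) z = (z.re - x) * (z.re - y) + z.im ^ 2 := by
  simp [sideFun, num, den]
  ring

theorem sideFun_infty (x : ℝ) (z : ℍ) :
    sideFun OnePoint.infty (x : OnePoint ℝ) z = x - z.re := by
  simp [sideFun, num, den]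

/-- The height of `z` with respect to the boundary point `a`: its level sets are the horocycles
at `a`, and it increases strictly along a geodesic line towards its end `a`. -/
noncomputable def height (a : OnePoint ℝ) (z : ℍ) : ℝ :=
  z.im / Complex.normSq ((den a : ℂ) * (z : ℂ) - (num a : ℂ))

/-- The geodesic ray from the point `q` of `ℍ` (included) to the boundary point `a`. -/
def geodesicRay (q : ℍ) (a : OnePoint ℝ) : Set ℍ :=
  {z | ∃ b, q ∈ geodesicLine a b ∧ z ∈ geodesicLine a b ∧ height a q ≤ height a z}

/-- An ideal triangle is given by its set `V` of three vertices. The open triangle: all points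
which lie, for each side, strictly on the same side of it as the opposite vertex. -/
def openTriangle (V : Set (OnePoint ℝ)) : Set ℍ :=
  {z | ∀ a ∈ V, ∀ b ∈ V, ∀ c ∈ V, a ≠ b → b ≠ c → a ≠ c →
    0 < sideFun a b z * boundarySideFun a b c}

/-- The closed ideal triangle (closed in `ℍ`) with vertex set `V`. -/
def closedTriangle (V : Set (OnePoint ℝ)) : Set ℍ :=
  {z | ∀ a ∈ V, ∀ b ∈ V, ∀ c ∈ V, a ≠ b → b ≠ c → a ≠ c →
    0 ≤ sideFun a b z * boundarySideFun a b c}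

/-- An ideal triangulation of `ℍ`: an infinite collection of ideal triangles (given by their
vertex sets) whose closures cover `ℍ` and whose interiors are pairwise disjoint. -/
structure IsIdealTriangulation (T : Set (Set (OnePoint ℝ))) : Prop where
  infinite : T.Infinite
  three_vertices : ∀ V ∈ T, V.ncard = 3
  cover : ⋃ V ∈ T, closedTriangle V = Set.univ
  disjoint : T.PairwiseDisjoint openTriangle

/-- Invariance of a collection of ideal triangles under a group. -/
def IsInvariant (Φ : Subgroup PSL(2, ℤ)) (T : Set (Set (OnePoint ℝ))) : Prop :=
  ∀ g ∈ Φ, ∀ V ∈ T, (fun x => g • x) '' V ∈ T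

/-! ### The quotient orbifold `Φ \ ℍ` -/

/-- The underlying space of the orbifold `Φ \ ℍ`. -/
abbrev Orbifold (Φ : Subgroup PSL(2, ℤ)) : Type := MulAction.orbitRel.Quotient Φ ℍ

/-- The projection `ℍ → Φ \ ℍ`. -/
noncomputable def proj (Φ : Subgroup PSL(2, ℤ)) (z : ℍ) : Orbifold Φ := Quotient.mk'' z

/-- `z` is a lift of a cone point of order `n` (that is, of angle `2π / n`) of `Φ \ ℍ`:
`n = 2` gives the set `E₂` and `n = 3` gives the set `E₃`. -/
def IsConePoint (Φ : Subgroup PSL(2, ℤ)) (n : ℕ) (z : ℍ) : Prop :=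
  2 ≤ n ∧ Nat.card (MulAction.stabilizer Φ z) = n

/-- `z` is not a lift of a cone point. -/
def IsRegularPoint (Φ : Subgroup PSL(2, ℤ)) (z : ℍ) : Prop := MulAction.stabilizer Φ z = ⊥

/-- `x` is a lift of a cusp (a marked point) of `Φ \ ℍ`: a fixed point of a parabolic
element of `Φ`. -/
def IsCuspLift (Φ : Subgroup PSL(2, ℤ)) (x : OnePoint ℝ) : Prop :=
  IsCusp x ((Φ.comap (QuotientGroup.mk' (Subgroup.center SL(2, ℤ)))).map
    (Matrix.SpecialLinearGroup.mapGL (R := ℤ) ℝ))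

/-- `γ` is an arc of `Φ \ ℍ` with both ends at cusps: a geodesic path without self-intersections
between two (possibly equal) cusps which avoids the cone points. An arc is represented by its set
of points in `Φ \ ℍ`, hence without the ends that are cusps. (A geodesic loop at a cusp that bounds
a disc automatically encloses a cusp, a cone point of order 3, or two cone points of order 2.) -/
def IsCuspArc (Φ : Subgroup PSL(2, ℤ)) (γ : Set (Orbifold Φ)) : Prop :=
  ∃ a b : OnePoint ℝ, a ≠ b ∧ IsCuspLift Φ a ∧ IsCuspLift Φ b ∧
    (∀ z ∈ geodesicLine a b, IsRegularPoint Φ z) ∧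
    Set.InjOn (proj Φ) (geodesicLine a b) ∧ γ = proj Φ '' geodesicLine a b

/-- `γ` is an arc of `Φ \ ℍ` from a cone point of order `n` (which belongs to `γ`) to a cusp: a
geodesic path without self-intersections which avoids the cone points except for its end. -/
def IsConeArc (Φ : Subgroup PSL(2, ℤ)) (n : ℕ) (γ : Set (Orbifold Φ)) : Prop :=
  ∃ (q : ℍ) (a : OnePoint ℝ), IsConePoint Φ n q ∧ IsCuspLift Φ a ∧
    (∀ z ∈ geodesicRay q a, z ≠ q → IsRegularPoint Φ z) ∧
    Set.InjOn (proj Φ) (geodesicRay q a) ∧ γ = proj Φ '' geodesicRay q a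

/-- A structural arc is an arc with one end in `E₃`. -/
def IsStructuralArc (Φ : Subgroup PSL(2, ℤ)) (γ : Set (Orbifold Φ)) : Prop := IsConeArc Φ 3 γ

/-- The arcs of `Φ \ ℍ`: at least one end is a cusp, the other one is a cusp or a cone point of
order 2 or 3. -/
def IsArc (Φ : Subgroup PSL(2, ℤ)) (γ : Set (Orbifold Φ)) : Prop :=
  IsCuspArc Φ γ ∨ IsConeArc Φ 2 γ ∨ IsStructuralArc Φ γ

/-- A collection of pairwise compatible arcs: two different arcs of the collection
meet at most in cusps, that is, they are disjoint in `Φ \ ℍ`. -/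
def IsCompatible (Φ : Subgroup PSL(2, ℤ)) (C : Set (Set (Orbifold Φ))) : Prop :=
  (∀ γ ∈ C, IsArc Φ γ) ∧ C.PairwiseDisjoint id

/-- A quotient triangulation is a maximal collection of pairwise compatible arcs. -/
def IsQuotientTriangulation (Φ : Subgroup PSL(2, ℤ)) (C : Set (Set (Orbifold Φ))) : Prop :=
  Maximal (IsCompatible Φ) C

/-! ### The projection of an ideal triangulation -/

/-- The projections to `Φ \ ℍ` of the edges of `T`. -/
def projEdges (Φ : Subgroup PSL(2, ℤ)) (T : Set (Set (OnePoint ℝ))) : Set (Set (Orbifold Φ)) :=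
  {γ | ∃ V ∈ T, ∃ a ∈ V, ∃ b ∈ V, a ≠ b ∧ γ = proj Φ '' geodesicLine a b}

/-- The projections to `Φ \ ℍ` of the open triangles of `T`. -/
def projPieces (Φ : Subgroup PSL(2, ℤ)) (T : Set (Set (OnePoint ℝ))) : Set (Set (Orbifold Φ)) :=
  {P | ∃ V ∈ T, P = proj Φ '' openTriangle V}

/-- `a, b, c` are the three vertices of the ideal triangle `V`. -/
def HasVertices (V : Set (OnePoint ℝ)) (a b c : OnePoint ℝ) : Prop :=
  a ≠ b ∧ b ≠ c ∧ a ≠ c ∧ V = {a, b, c}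

/-- `V` projects to a standard triangle, type (I): the interior embeds, there are no cone points
on the triangle, and the three sides project to three different arcs. -/
def IsTypeI (Φ : Subgroup PSL(2, ℤ)) (V : Set (OnePoint ℝ)) : Prop :=
  Set.InjOn (proj Φ) (openTriangle V) ∧ (∀ z ∈ closedTriangle V, IsRegularPoint Φ z) ∧
  ∃ a b c, HasVertices V a b c ∧
    proj Φ '' geodesicLine a b ≠ proj Φ '' geodesicLine b c ∧
    proj Φ '' geodesicLine b c ≠ proj Φ '' geodesicLine a c ∧
    proj Φ '' geodesicLine a b ≠ proj Φ '' geodesicLine a c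

/-- `V` projects to a self-folded triangle, type (II): the interior embeds, there are no cone
points on the triangle, two sides are glued to each other by an element of `Φ` that fixes their
common vertex `c`, and the third side projects to a different arc. -/
def IsTypeII (Φ : Subgroup PSL(2, ℤ)) (V : Set (OnePoint ℝ)) : Prop :=
  Set.InjOn (proj Φ) (openTriangle V) ∧ (∀ z ∈ closedTriangle V, IsRegularPoint Φ z) ∧
  ∃ a b c, HasVertices V a b c ∧
    (∃ g : Φ, g • c = c ∧ g • a = b ∧ (fun z : ℍ => g • z) '' geodesicLine a c = geodesicLine b c) ∧
    proj Φ '' geodesicLine a b ≠ proj Φ '' geodesicLine a c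

/-- `V` projects to a quotient-2 triangle (a), type (IIIa): the interior embeds, there is exactly
one lift `m` of a cone point on the triangle; it has order 2 and lies on one side, which is folded
by the rotation about `m` to an arc that ends in the cone point. The other two sides
project to different arcs; only in an orbifold of index 3 (glued from this one triangle, as
`Γ₀(2) \ ℍ`) they may be glued to each other around their common vertex `c`. -/
def IsTypeIIIa (Φ : Subgroup PSL(2, ℤ)) (V : Set (OnePoint ℝ)) : Prop :=
  Set.InjOn (proj Φ) (openTriangle V) ∧
  ∃ a b c, HasVertices V a b c ∧
    (∃ m ∈ geodesicLine a b, IsConePoint Φ 2 m ∧ (∃ g : Φ, g • m = m ∧ g • a = b ∧ g • b = a) ∧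
      ∀ z ∈ closedTriangle V, z ≠ m → IsRegularPoint Φ z) ∧
    (proj Φ '' geodesicLine a c ≠ proj Φ '' geodesicLine b c ∨
      (Φ.index = 3 ∧ ∃ g : Φ, g • c = c ∧ g • a = b))

/-- `V` projects to a quotient-2 triangle (b), type (IIIb): the interior embeds, there are exactly
two lifts `m, m'` of cone points on the triangle; they project to different cone points of
order 2 and lie on two different sides, each of which is folded by the rotation about it to an
arc that ends in the cone point. -/
def IsTypeIIIb (Φ : Subgroup PSL(2, ℤ)) (V : Set (OnePoint ℝ)) : Prop :=
  Set.InjOn (proj Φ) (openTriangle V) ∧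
  ∃ a b c, HasVertices V a b c ∧
    ∃ m ∈ geodesicLine a c, ∃ m' ∈ geodesicLine b c,
      IsConePoint Φ 2 m ∧ (∃ g : Φ, g • m = m ∧ g • a = c ∧ g • c = a) ∧
      IsConePoint Φ 2 m' ∧ (∃ g : Φ, g • m' = m' ∧ g • b = c ∧ g • c = b) ∧
      proj Φ m ≠ proj Φ m' ∧
      ∀ z ∈ closedTriangle V, z ≠ m → z ≠ m' → IsRegularPoint Φ z

/-- `V` projects to a monogon that contains exactly one cone point, of order 3: the open triangle
contains exactly one lift `q` of a cone point, it has order 3, and the projection identifies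
points of the open triangle exactly under the rotation group of order 3 about `q`,
which permutes the vertices (and the sides) cyclically. The boundary of the monogon, the common
projection of the three sides, contains no cone point; only for the full group `PSL(2, ℤ)`
it is folded in a cone point of order 2. -/
def IsMonogon (Φ : Subgroup PSL(2, ℤ)) (V : Set (OnePoint ℝ)) : Prop :=
  ∃ a b c, HasVertices V a b c ∧
    ∃ q ∈ openTriangle V, IsConePoint Φ 3 q ∧
      (∀ z ∈ openTriangle V, z ≠ q → IsRegularPoint Φ z) ∧
      (∃ g : Φ, g • q = q ∧ g • a = b ∧ g • b = c ∧ g • c = a ∧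
        ∀ z ∈ openTriangle V, ∀ w ∈ openTriangle V,
          (proj Φ z = proj Φ w ↔ ∃ k : ℕ, w = g ^ k • z)) ∧
      ((∀ z ∈ geodesicLine a b, IsRegularPoint Φ z) ∨
        (Φ = ⊤ ∧ ∃ m ∈ geodesicLine a b, IsConePoint Φ 2 m ∧
          ∀ z ∈ geodesicLine a b, z ≠ m → IsRegularPoint Φ z))

/-- A matrix of determinant 1, as an element of `PSL(2, ℤ)`. -/
def toPSL (A : SL(2, ℤ)) : PSL(2, ℤ) := QuotientGroup.mk A

/-- The subgroup `Γ₃` of `PSL(2, ℤ)`, generated by three elements of order 2. -/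
def Gamma3 : Subgroup PSL(2, ℤ) :=
  Subgroup.closure
    {toPSL ⟨!![0, -1; 1, 0], by simp [Matrix.det_fin_two]⟩,
     toPSL ⟨!![1, -2; 1, -1], by simp [Matrix.det_fin_two]⟩,
     toPSL ⟨!![1, -1; 2, -1], by simp [Matrix.det_fin_two]⟩}

end QuotientTriangulation

/-! Boundary points are treated in homogeneous coordinates. A Möbius transformation of positive
determinant changes `bracket` and `sideFun` by scalars (`moebius_package`), and in the combinations
that matter, `tri` and `orient`, every scalar of unknown sign occurs squared. Hence lines, rays and
triangles are carried to each other and orientation is preserved; a triangle of `T` is determined by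
an edge and a side of it.

The definition of an ideal triangulation assumes neither local finiteness nor rational vertices.
Both are extracted from the invariance under a group of finite index. All ideal triangles contain
balls of one common radius, and no nontrivial parabolic element stabilizes a triangle, so the
centres of these balls stay in a bounded part of every cusp; by compactness there are finitely many
triangles modulo `Φ` (`exists_finite_orbit_reps`). High up in a cusp, an edge which passes by
without ending there would cross its own translate, so the triangles form a locally finite fan
(`exists_fan`). Local finiteness spreads along an edge, because at one good point a second triangle
must lie on the other side, and the two triangles then meet along the whole edge.

The set of bad points is therefore a closed invariant union of edges, none of which has a rational
end. By Baire's theorem some edge has an open part that is isolated in this set. Removing the orbit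
of that edge and taking the closure leaves a smaller set of the same kind, and induction reduces to
a single orbit, closed and without accumulation. This is impossible: by Diophantine approximation a
line with an irrational end returns infinitely often to a compact part of the quotient
(`exists_recurrence`, `exists_accumulation`, `eq_empty_of_saturated`). The same recurrence, played
against local finiteness, shows that all vertices are rational (`isRationalEnd_of_mem`), hence cusps
of `Φ`.

The stabilizer of a triangle acts on its vertices by cyclic permutations. If it is nontrivial, the
triangle covers a monogon. If it is trivial, one counts the sides that are folded by an involution
of `Φ`: none gives (I) or (II), one gives (IIIa), two give (IIIb). If all three are folded, the
neighbours of the triangle are its images under three involutions, so these generate `Φ` and `Φ` is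
contained in the normal subgroup `Γ₃`. Their product fixes a vertex, and its translation length is
the coefficient of a generalized Markov equation, hence `±3` by Vieta jumping. Together with the
equivalence of all cusps this forces `Φ = Γ₃` (`eq_Gamma3_of_folded`). The exceptional gluings of a
monogon and of type (IIIa) are recognized by similar trace identities (`eq_top_of_cycle_of_swap`,
`index_eq_three_of_glued`).

Finally, an arc disjoint from the projected edges lifts into one open triangle. A complete line does
not fit there, and a ray from a singular point must run from a centre of order three to a vertex.
The three rays from such a centre have the same projection, so there is exactly one way to complete
the projected edges (`isQuotientTriangulation_iff`). -/

namespace QuotientTriangulation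

open scoped Pointwise Topology
open Filter

/-! ### Homogeneous coordinates -/

/-- The determinant of the homogeneous coordinates of two boundary points. -/
def bracket (a b : OnePoint ℝ) : ℝ := num a * den b - den a * num b

/-- The product that defines the half plane of `c` with respect to the line from `a` to `b`. -/
noncomputable def tri (a b c : OnePoint ℝ) (z : ℍ) : ℝ := sideFun a b z * boundarySideFun a b c

@[simp] theorem num_coe (x : ℝ) : num (x : OnePoint ℝ) = x := rfl
@[simp] theorem den_coe (x : ℝ) : den (x : OnePoint ℝ) = 1 := rfl
@[simp] theorem num_infty : num OnePoint.infty = 1 := rfl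
@[simp] theorem den_infty : den OnePoint.infty = 0 := rfl

theorem sideFun_eq (a b : OnePoint ℝ) (z : ℍ) : sideFun a b z =
    den a * den b * (z.re ^ 2 + z.im ^ 2) - (den a * num b + num a * den b) * z.re
      + num a * num b := by
  simp [sideFun]
  ring

theorem boundarySideFun_eq (a b c : OnePoint ℝ) :
    boundarySideFun a b c = bracket c a * bracket c b := by
  simp only [boundarySideFun, bracket]; ring

theorem bracket_eq_zero {a b : OnePoint ℝ} : bracket a b = 0 ↔ a = b := by
  induction a using OnePoint.rec <;> induction b using OnePoint.rec <;>
    simp [bracket, sub_eq_zero]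

theorem bracket_swap (a b : OnePoint ℝ) : bracket b a = -bracket a b := by
  simp only [bracket]; ring

theorem bracket_ne_zero {a b : OnePoint ℝ} (h : a ≠ b) : bracket a b ≠ 0 :=
  fun h' => h (bracket_eq_zero.mp h')

theorem sideFun_comm (a b : OnePoint ℝ) (z : ℍ) : sideFun b a z = sideFun a b z := by
  simp only [sideFun_eq]; ring

theorem geodesicLine_comm (a b : OnePoint ℝ) : geodesicLine b a = geodesicLine a b := by
  ext z; simp [geodesicLine, sideFun_comm a b]

theorem tri_comm (a b c : OnePoint ℝ) (z : ℍ) : tri b a c z = tri a b c z := by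
  simp only [tri, sideFun_comm a b, boundarySideFun_eq]; ring

theorem normSq_form_pos (a : OnePoint ℝ) (z : ℍ) :
    0 < Complex.normSq ((den a : ℂ) * (z : ℂ) - (num a : ℂ)) := by
  rw [Complex.normSq_pos]
  intro h
  have h1 := congrArg Complex.im h
  have h2 := congrArg Complex.re h
  induction a using OnePoint.rec with
  | infty => simp at h2
  | coe x => simp [z.im_ne_zero] at h1

theorem sideFun_self_ne_zero (a : OnePoint ℝ) (z : ℍ) : sideFun a a z ≠ 0 := by
  have := normSq_form_pos a z
  rw [Complex.normSq_apply] at this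
  simp only [sideFun_eq]
  simp at this
  nlinarith

theorem ne_of_mem_geodesicLine {a b : OnePoint ℝ} {z : ℍ} (h : z ∈ geodesicLine a b) :
    a ≠ b := by
  rintro rfl
  exact sideFun_self_ne_zero a z h

/-- The fundamental relation between two side functions of an ideal triangle. -/
theorem tri_add_tri (a b c : OnePoint ℝ) (z : ℍ) : tri a b c z + tri b c a z =
    bracket c a ^ 2 * Complex.normSq ((den b : ℂ) * (z : ℂ) - (num b : ℂ)) := by
  rw [Complex.normSq_apply]
  simp [tri, boundarySideFun_eq, sideFun_eq, bracket]
  ring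

/-- By `tri_add_tri` the sum of any two of the three numbers that define a triangle is positive, so
at most one of them is nonpositive at a given point. In particular two sides never meet in `ℍ`. -/
theorem tri_pos_of_nonpos {a b c : OnePoint ℝ} (h : a ≠ c) {z : ℍ} (hz : tri a b c z ≤ 0) :
    0 < tri b c a z := by
  have h1 := tri_add_tri a b c z
  have h2 := normSq_form_pos b z
  have h3 : 0 < bracket c a ^ 2 := by have := bracket_ne_zero h.symm; positivity
  have := mul_pos h3 h2
  linarith

/-- The product is minus a square. Geometrically, a boundary point that is not a vertex is separated
from the triangle by an odd number of its sides; this serves to show that a ray inside a triangle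
ends at a vertex. -/
theorem tri_cycle_product_neg {a b c x : OnePoint ℝ} (hab : a ≠ b) (hbc : b ≠ c) (hac : a ≠ c)
    (hxa : x ≠ a) (hxb : x ≠ b) (hxc : x ≠ c) :
    boundarySideFun a b x * boundarySideFun a b c * (boundarySideFun b c x * boundarySideFun b c a)
      * (boundarySideFun c a x * boundarySideFun c a b) < 0 := by
  have h : boundarySideFun a b x * boundarySideFun a b c *
      (boundarySideFun b c x * boundarySideFun b c a)
      * (boundarySideFun c a x * boundarySideFun c a b) =
      - (bracket x a * bracket x b * bracket x c * bracket a b * bracket b c * bracket c a) ^ 2 := by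
    simp only [boundarySideFun_eq, bracket_swap a b, bracket_swap b c, bracket_swap c a]
    ring
  rw [h, neg_lt_zero]
  have := bracket_ne_zero hab
  have := bracket_ne_zero hbc
  have := bracket_ne_zero hac.symm
  have := bracket_ne_zero hxa
  have := bracket_ne_zero hxb
  have := bracket_ne_zero hxc
  positivity

/-! ### Ideal triangles with given vertices -/

theorem HasVertices.rotate {V : Set (OnePoint ℝ)} {a b c : OnePoint ℝ} (h : HasVertices V a b c) :
    HasVertices V b c a := by
  obtain ⟨h1, h2, h3, rfl⟩ := h
  refine ⟨h2, h3.symm, h1.symm, ?_⟩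
  ext x; simp; tauto

theorem HasVertices.swap {V : Set (OnePoint ℝ)} {a b c : OnePoint ℝ} (h : HasVertices V a b c) :
    HasVertices V b a c := by
  obtain ⟨h1, h2, h3, rfl⟩ := h
  refine ⟨h1.symm, h3, h2, ?_⟩
  ext x; simp; tauto

theorem exists_hasVertices {V : Set (OnePoint ℝ)} (h : V.ncard = 3) :
    ∃ a b c, HasVertices V a b c := by
  obtain ⟨a, b, c, h1, h2, h3, rfl⟩ := Set.ncard_eq_three.mp h
  exact ⟨a, b, c, h1, h3, h2, rfl⟩

theorem exists_hasVertices_of_mem {V : Set (OnePoint ℝ)} (h : V.ncard = 3) {a : OnePoint ℝ}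
    (ha : a ∈ V) : ∃ b c, HasVertices V a b c := by
  obtain ⟨x, y, z, hV⟩ := exists_hasVertices h
  have : a = x ∨ a = y ∨ a = z := by rw [hV.2.2.2] at ha; simpa using ha
  rcases this with rfl | rfl | rfl
  · exact ⟨_, _, hV⟩
  · exact ⟨_, _, hV.rotate⟩
  · exact ⟨_, _, hV.rotate.rotate⟩

theorem exists_hasVertices_of_mem_mem {V : Set (OnePoint ℝ)} (h : V.ncard = 3) {a b : OnePoint ℝ}
    (ha : a ∈ V) (hb : b ∈ V) (hab : a ≠ b) : ∃ c, HasVertices V a b c := by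
  obtain ⟨x, y, hV⟩ := exists_hasVertices_of_mem h ha
  have : b = a ∨ b = x ∨ b = y := by rw [hV.2.2.2] at hb; simpa using hb
  rcases this with rfl | rfl | rfl
  · exact absurd rfl hab
  · exact ⟨_, hV⟩
  · exact ⟨_, hV.rotate.rotate.swap⟩

theorem HasVertices.mem {V : Set (OnePoint ℝ)} {a b c : OnePoint ℝ} (h : HasVertices V a b c) :
    a ∈ V ∧ b ∈ V ∧ c ∈ V := by
  rw [h.2.2.2]; simp

theorem HasVertices.mem_openTriangle {V : Set (OnePoint ℝ)} {a b c : OnePoint ℝ}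
    (h : HasVertices V a b c) {z : ℍ} :
    z ∈ openTriangle V ↔ 0 < tri a b c z ∧ 0 < tri b c a z ∧ 0 < tri c a b z := by
  obtain ⟨h1, h2, h3, rfl⟩ := h
  constructor
  · intro hz
    exact ⟨hz a (by simp) b (by simp) c (by simp) h1 h2 h3,
      hz b (by simp) c (by simp) a (by simp) h2 h3.symm h1.symm,
      hz c (by simp) a (by simp) b (by simp) h3.symm h1 h2.symm⟩
  · rintro ⟨t1, t2, t3⟩ x hx y hy w hw hxy hyw hxw
    change 0 < tri x y w z
    simp only [Set.mem_insert_iff, Set.mem_singleton_iff] at hx hy hw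
    rcases hx with rfl | rfl | rfl <;> rcases hy with rfl | rfl | rfl <;>
      rcases hw with rfl | rfl | rfl <;> first | contradiction | assumption |
        (rw [tri_comm]; assumption)

theorem HasVertices.mem_closedTriangle {V : Set (OnePoint ℝ)} {a b c : OnePoint ℝ}
    (h : HasVertices V a b c) {z : ℍ} :
    z ∈ closedTriangle V ↔ 0 ≤ tri a b c z ∧ 0 ≤ tri b c a z ∧ 0 ≤ tri c a b z := by
  obtain ⟨h1, h2, h3, rfl⟩ := h
  constructor
  · intro hz
    exact ⟨hz a (by simp) b (by simp) c (by simp) h1 h2 h3,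
      hz b (by simp) c (by simp) a (by simp) h2 h3.symm h1.symm,
      hz c (by simp) a (by simp) b (by simp) h3.symm h1 h2.symm⟩
  · rintro ⟨t1, t2, t3⟩ x hx y hy w hw hxy hyw hxw
    change 0 ≤ tri x y w z
    simp only [Set.mem_insert_iff, Set.mem_singleton_iff] at hx hy hw
    rcases hx with rfl | rfl | rfl <;> rcases hy with rfl | rfl | rfl <;>
      rcases hw with rfl | rfl | rfl <;> first | contradiction | assumption |
        (rw [tri_comm]; assumption)

theorem openTriangle_subset_closedTriangle (V : Set (OnePoint ℝ)) :
    openTriangle V ⊆ closedTriangle V :=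
  fun _ hz a ha b hb c hc h1 h2 h3 => (hz a ha b hb c hc h1 h2 h3).le

theorem continuous_sideFun (a b : OnePoint ℝ) : Continuous (sideFun a b) := by
  have : sideFun a b = fun z : ℍ => den a * den b * (z.re ^ 2 + z.im ^ 2)
      - (den a * num b + num a * den b) * z.re + num a * num b := funext (sideFun_eq a b)
  rw [this]
  have h1 := UpperHalfPlane.continuous_re
  have h2 := UpperHalfPlane.continuous_im
  fun_prop

theorem continuous_tri (a b c : OnePoint ℝ) : Continuous (tri a b c) :=
  (continuous_sideFun a b).mul continuous_const

theorem HasVertices.isOpen_openTriangle {V : Set (OnePoint ℝ)} {a b c : OnePoint ℝ}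
    (h : HasVertices V a b c) : IsOpen (openTriangle V) := by
  have : openTriangle V = {z | 0 < tri a b c z} ∩ ({z | 0 < tri b c a z} ∩ {z | 0 < tri c a b z}) :=
    Set.ext fun z => h.mem_openTriangle
  rw [this]
  exact (isOpen_lt continuous_const (continuous_tri _ _ _)).inter
    ((isOpen_lt continuous_const (continuous_tri _ _ _)).inter
      (isOpen_lt continuous_const (continuous_tri _ _ _)))

theorem HasVertices.isClosed_closedTriangle {V : Set (OnePoint ℝ)} {a b c : OnePoint ℝ}
    (h : HasVertices V a b c) : IsClosed (closedTriangle V) := by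
  have : closedTriangle V =
      {z | 0 ≤ tri a b c z} ∩ ({z | 0 ≤ tri b c a z} ∩ {z | 0 ≤ tri c a b z}) :=
    Set.ext fun z => h.mem_closedTriangle
  rw [this]
  exact (isClosed_le continuous_const (continuous_tri _ _ _)).inter
    ((isClosed_le continuous_const (continuous_tri _ _ _)).inter
      (isClosed_le continuous_const (continuous_tri _ _ _)))

theorem isClosed_geodesicLine (a b : OnePoint ℝ) : IsClosed (geodesicLine a b) :=
  isClosed_eq (continuous_sideFun a b) continuous_const

theorem tri_eq_zero_of_mem {a b : OnePoint ℝ} (c : OnePoint ℝ) {z : ℍ}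
    (hz : z ∈ geodesicLine a b) : tri a b c z = 0 := by
  rw [tri, show sideFun a b z = 0 from hz, zero_mul]

theorem HasVertices.tri_pos_of_mem_line {V : Set (OnePoint ℝ)} {a b c : OnePoint ℝ}
    (h : HasVertices V a b c) {z : ℍ} (hz : z ∈ geodesicLine a b) :
    0 < tri b c a z ∧ 0 < tri c a b z := by
  have h1 := tri_eq_zero_of_mem c hz
  refine ⟨tri_pos_of_nonpos h.2.2.1 h1.le, ?_⟩
  rw [tri_comm]
  exact tri_pos_of_nonpos h.2.1 (by rw [tri_comm]; exact h1.le)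

theorem HasVertices.line_subset_closedTriangle {V : Set (OnePoint ℝ)} {a b c : OnePoint ℝ}
    (h : HasVertices V a b c) : geodesicLine a b ⊆ closedTriangle V := fun _ hz =>
  h.mem_closedTriangle.mpr ⟨(tri_eq_zero_of_mem c hz).ge, (h.tri_pos_of_mem_line hz).1.le,
    (h.tri_pos_of_mem_line hz).2.le⟩

theorem HasVertices.notMem_openTriangle {V : Set (OnePoint ℝ)} {a b c : OnePoint ℝ}
    (h : HasVertices V a b c) {z : ℍ} (hz : z ∈ geodesicLine a b) : z ∉ openTriangle V := by
  intro hz'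
  have := (h.mem_openTriangle.mp hz').1
  rw [tri_eq_zero_of_mem c hz] at this
  exact lt_irrefl _ this

/-- Near a point of a side, the open triangle is a half plane. -/
theorem HasVertices.eventually_mem_openTriangle {V : Set (OnePoint ℝ)} {a b c : OnePoint ℝ}
    (h : HasVertices V a b c) {p : ℍ} (hp : p ∈ geodesicLine a b) :
    ∀ᶠ z in 𝓝 p, 0 < tri a b c z → z ∈ openTriangle V := by
  have h1 := h.tri_pos_of_mem_line hp
  filter_upwards [(continuous_tri b c a).continuousAt.eventually_const_lt h1.1,
    (continuous_tri c a b).continuousAt.eventually_const_lt h1.2] with z z1 z2 z3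
  exact h.mem_openTriangle.mpr ⟨z3, z1, z2⟩

theorem mem_line_of_mem_closedTriangle {V : Set (OnePoint ℝ)} (hV : V.ncard = 3) {z : ℍ}
    (hz : z ∈ closedTriangle V) (hz' : z ∉ openTriangle V) :
    ∃ a b c, HasVertices V a b c ∧ z ∈ geodesicLine a b := by
  obtain ⟨a, b, c, h⟩ := exists_hasVertices hV
  have key : ∀ {a b c}, HasVertices V a b c → tri a b c z = 0 → z ∈ geodesicLine a b := by
    intro a b c h h0
    have hb : boundarySideFun a b c ≠ 0 := by
      rw [boundarySideFun_eq]
      exact mul_ne_zero (bracket_ne_zero h.2.2.1.symm) (bracket_ne_zero h.2.1.symm)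
    exact (mul_eq_zero.mp h0).resolve_right hb
  have h1 := h.mem_closedTriangle.mp hz
  rw [h.mem_openTriangle] at hz'
  by_cases t1 : tri a b c z = 0
  · exact ⟨a, b, c, h, key h t1⟩
  by_cases t2 : tri b c a z = 0
  · exact ⟨b, c, a, h.rotate, key h.rotate t2⟩
  by_cases t3 : tri c a b z = 0
  · exact ⟨c, a, b, h.rotate.rotate, key h.rotate.rotate t3⟩
  exact absurd ⟨lt_of_le_of_ne h1.1 (Ne.symm t1), lt_of_le_of_ne h1.2.1 (Ne.symm t2),
    lt_of_le_of_ne h1.2.2 (Ne.symm t3)⟩ hz'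

/-! ### Transport by Möbius transformations -/

/-- `s x` is the factor by which the matrix scales the chosen homogeneous coordinates of `x`. Its
sign is not controlled, so the three transformation laws are stated with these factors; in `orient`
and `tri` each of them appears twice. The factor for `sideFun` depends on `z` only, the one for
`height` on `a` only. -/
theorem moebius_package (G : GL (Fin 2) ℝ) (hG : 0 < G.det.val) :
    ∃ s : OnePoint ℝ → ℝ, (∀ x, s x ≠ 0) ∧
      (∀ a b, bracket (G • a) (G • b) * (s a * s b) = G.det.val * bracket a b) ∧
      (∀ z : ℍ, ∃ k > 0, ∀ a b, sideFun (G • a) (G • b) (G • z) * (s a * s b) = k * sideFun a b z) ∧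
      (∀ a, ∃ k > 0, ∀ z : ℍ, height (G • a) (G • z) = k * height a z) := by
  have hs : ∀ x : OnePoint ℝ, ∃ l : ℝ, l ≠ 0 ∧
      G 0 0 * num x + G 0 1 * den x = l * num (G • x) ∧
      G 1 0 * num x + G 1 1 * den x = l * den (G • x) := by
    have hdet : G 0 0 * G 1 1 - G 0 1 * G 1 0 ≠ 0 := by
      have := G.det_ne_zero
      rwa [Matrix.det_fin_two] at this
    intro x
    induction x using OnePoint.rec with
    | infty =>
      by_cases h : G 1 0 = 0
      · refine ⟨G 0 0, ?_, ?_⟩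
        · intro h'; simp [h, h'] at hdet
        · simp [OnePoint.smul_infty_eq_ite, h]
      · exact ⟨G 1 0, h, by simp [OnePoint.smul_infty_eq_ite, h]; field_simp⟩
    | coe x =>
      by_cases h : G 1 0 * x + G 1 1 = 0
      · refine ⟨G 0 0 * x + G 0 1, ?_, ?_⟩
        · intro h'; apply hdet
          by_cases h0 : G 1 0 = 0
          · have : G 1 1 = 0 := by simpa [h0] using h
            simp [h0, this]
          · have hx : x = - G 1 1 / G 1 0 := by field_simp; linarith
            rw [hx] at h'; field_simp at h'; linarith
        · simp [OnePoint.smul_some_eq_ite, h]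
      · refine ⟨_, h, ?_, ?_⟩
        · simp [OnePoint.smul_some_eq_ite, h, mul_div_cancel₀ _ h]
        · simp [OnePoint.smul_some_eq_ite, h]
  choose s hs0 hs1 hs2 using hs
  have hdet : G.det.val = G 0 0 * G 1 1 - G 0 1 * G 1 0 := by
    rw [Matrix.GeneralLinearGroup.val_det_apply, Matrix.det_fin_two]
  -- All laws that involve `z` come from this identity of linear forms: multiplied by a conjugate it
  -- gives the law for `sideFun`, and its norm gives the law for `height`.
  have key : ∀ (x : OnePoint ℝ) (z : ℍ), (s x : ℂ) * UpperHalfPlane.denom G z *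
      ((den (G • x) : ℂ) * ((G • z : ℍ) : ℂ) - (num (G • x) : ℂ)) =
      (G.det.val : ℂ) * ((den x : ℂ) * z - num x) := by
    intro x z
    rw [UpperHalfPlane.coe_smul_of_det_pos hG]
    have h0 := UpperHalfPlane.denom_ne_zero G z
    have h1 := congrArg (fun t : ℝ => (t : ℂ)) (hs1 x)
    have h2 := congrArg (fun t : ℝ => (t : ℂ)) (hs2 x)
    have h3 : UpperHalfPlane.denom G z * (UpperHalfPlane.num G z / UpperHalfPlane.denom G z) =
      UpperHalfPlane.num G z := by field_simp
    push_cast at h1 h2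
    rw [hdet]
    push_cast
    calc _ = (s x * den (G • x) : ℂ) * (UpperHalfPlane.denom G z *
          (UpperHalfPlane.num G z / UpperHalfPlane.denom G z)) -
          (s x * num (G • x) : ℂ) * UpperHalfPlane.denom G z := by ring
      _ = _ := by
        rw [h3, ← h1, ← h2, UpperHalfPlane.num, UpperHalfPlane.denom]
        ring
  refine ⟨s, hs0, ?_, ?_, ?_⟩
  · intro a b
    rw [hdet]
    simp only [bracket]
    calc _ = (s a * num (G • a)) * (s b * den (G • b)) - (s a * den (G • a)) *
        (s b * num (G • b)) := by ring
      _ = _ := by rw [← hs1, ← hs1, ← hs2, ← hs2]; ring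
  · intro z
    have hn := UpperHalfPlane.normSq_denom_pos G z.im_ne_zero
    refine ⟨G.det.val ^ 2 / Complex.normSq (UpperHalfPlane.denom G z), by positivity, ?_⟩
    intro a b
    have h1 := key a z
    have h2 := congrArg (starRingEnd ℂ) (key b z)
    have h3 := congrArg Complex.re (congrArg₂ (· * ·) h1 h2)
    rw [div_mul_eq_mul_div, eq_div_iff hn.ne']
    have h4 : ((s a : ℂ) * UpperHalfPlane.denom G z *
      ((den (G • a) : ℂ) * ((G • z : ℍ) : ℂ) - (num (G • a) : ℂ))) *
      (starRingEnd ℂ) ((s b : ℂ) * UpperHalfPlane.denom G z *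
      ((den (G • b) : ℂ) * ((G • z : ℍ) : ℂ) - (num (G • b) : ℂ))) =
      ((s a * s b * Complex.normSq (UpperHalfPlane.denom G z) : ℝ) : ℂ) *
      (((den (G • a) : ℂ) * ((G • z : ℍ) : ℂ) - (num (G • a) : ℂ)) *
      (starRingEnd ℂ) ((den (G • b) : ℂ) * ((G • z : ℍ) : ℂ) - (num (G • b) : ℂ))) := by
      rw [map_mul, map_mul, Complex.conj_ofReal]
      push_cast
      rw [Complex.normSq_eq_conj_mul_self]
      ring
    have h5 : ((G.det.val : ℂ) * ((den a : ℂ) * z - num a)) *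
        (starRingEnd ℂ) ((G.det.val : ℂ) * ((den b : ℂ) * z - num b)) =
        ((G.det.val ^ 2 : ℝ) : ℂ) * (((den a : ℂ) * z - num a) *
        (starRingEnd ℂ) ((den b : ℂ) * z - num b)) := by
      rw [map_mul, Complex.conj_ofReal]; push_cast; ring
    rw [h4, h5, Complex.re_ofReal_mul, Complex.re_ofReal_mul] at h3
    simp only [sideFun]
    linarith
  · intro a
    refine ⟨s a ^ 2 / G.det.val, by have := hs0 a; positivity, ?_⟩
    intro z
    have hn := UpperHalfPlane.normSq_denom_pos G z.im_ne_zero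
    have h1 := congrArg Complex.normSq (key a z)
    rw [map_mul, map_mul, map_mul, Complex.normSq_ofReal, Complex.normSq_ofReal] at h1
    have h2 := normSq_form_pos a z
    have h3 := normSq_form_pos (G • a) (G • z)
    have h4 := hs0 a
    simp only [height]
    rw [UpperHalfPlane.im_smul_eq_div_normSq, abs_of_pos hG]
    field_simp
    linear_combination (-1 : ℝ) * h1

/-- The cyclic orientation of three boundary points is the sign of this number. -/
def orient (a b c : OnePoint ℝ) : ℝ := bracket a b * bracket b c * bracket c a

theorem orient_rotate (a b c : OnePoint ℝ) : orient b c a = orient a b c := by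
  simp only [orient]; ring

theorem orient_swap (a b c : OnePoint ℝ) : orient b a c = -orient a b c := by
  simp only [orient, bracket]; ring

theorem orient_ne_zero {a b c : OnePoint ℝ} (hab : a ≠ b) (hbc : b ≠ c) (hac : a ≠ c) :
    orient a b c ≠ 0 :=
  mul_ne_zero (mul_ne_zero (bracket_ne_zero hab) (bracket_ne_zero hbc)) (bracket_ne_zero hac.symm)

section Transport

variable {G : GL (Fin 2) ℝ} (hG : 0 < G.det.val)
include hG

theorem orient_smul_pos (a b c : OnePoint ℝ) :
    ∃ k > 0, orient (G • a) (G • b) (G • c) = k * orient a b c := by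
  obtain ⟨s, hs, hb, -, -⟩ := moebius_package G hG
  have ha := hs a
  have hb' := hs b
  have hc := hs c
  refine ⟨G.det.val ^ 3 / (s a * s b * s c) ^ 2, by positivity, ?_⟩
  rw [div_mul_eq_mul_div, eq_div_iff (by positivity)]
  simp only [orient]
  calc _ = (bracket (G • a) (G • b) * (s a * s b)) * (bracket (G • b) (G • c) * (s b * s c)) *
        (bracket (G • c) (G • a) * (s c * s a)) := by ring
    _ = _ := by rw [hb, hb, hb]; ring

theorem tri_smul_pos (a b c : OnePoint ℝ) (z : ℍ) :
    ∃ k > 0, tri (G • a) (G • b) (G • c) (G • z) = k * tri a b c z := by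
  obtain ⟨s, hs, hb, hz, -⟩ := moebius_package G hG
  obtain ⟨k, hk, hz⟩ := hz z
  have ha := hs a
  have hb' := hs b
  have hc := hs c
  refine ⟨k * G.det.val ^ 2 / (s a * s b * s c) ^ 2, by positivity, ?_⟩
  rw [div_mul_eq_mul_div, eq_div_iff (by positivity)]
  simp only [tri, boundarySideFun_eq]
  calc _ = (sideFun (G • a) (G • b) (G • z) * (s a * s b)) *
        ((bracket (G • c) (G • a) * (s c * s a)) * (bracket (G • c) (G • b) * (s c * s b))) := by
        ring
    _ = _ := by rw [hz, hb, hb]; ring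

theorem smul_mem_geodesicLine {a b : OnePoint ℝ} {z : ℍ} :
    G • z ∈ geodesicLine (G • a) (G • b) ↔ z ∈ geodesicLine a b := by
  obtain ⟨s, hs, -, hz, -⟩ := moebius_package G hG
  obtain ⟨k, hk, hz⟩ := hz z
  have h := hz a b
  simp only [geodesicLine, Set.mem_ofPred_eq]
  constructor
  · intro h0
    rw [h0, zero_mul, eq_comm] at h
    exact (mul_eq_zero.mp h).resolve_left hk.ne'
  · intro h0
    rw [h0, mul_zero] at h
    exact (mul_eq_zero.mp h).resolve_right (mul_ne_zero (hs a) (hs b))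

theorem smul_mem_openTriangle {V : Set (OnePoint ℝ)} {z : ℍ} :
    G • z ∈ openTriangle (G • V) ↔ z ∈ openTriangle V := by
  constructor
  · intro h a ha b hb c hc h1 h2 h3
    have := h (G • a) (Set.smul_mem_smul_set ha) (G • b) (Set.smul_mem_smul_set hb) (G • c)
      (Set.smul_mem_smul_set hc) (by simpa using h1) (by simpa using h2) (by simpa using h3)
    obtain ⟨k, hk, h'⟩ := tri_smul_pos hG a b c z
    change 0 < tri _ _ _ _ at this
    rw [h'] at this
    exact pos_of_mul_pos_right this hk.le
  · rintro h _ ⟨a, ha, rfl⟩ _ ⟨b, hb, rfl⟩ _ ⟨c, hc, rfl⟩ h1 h2 h3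
    obtain ⟨k, hk, h'⟩ := tri_smul_pos hG a b c z
    change 0 < tri (G • a) (G • b) (G • c) (G • z)
    rw [h']
    exact mul_pos hk (h a ha b hb c hc (fun h => h1 (by rw [h])) (fun h => h2 (by rw [h]))
      (fun h => h3 (by rw [h])))

theorem smul_mem_closedTriangle {V : Set (OnePoint ℝ)} {z : ℍ} :
    G • z ∈ closedTriangle (G • V) ↔ z ∈ closedTriangle V := by
  constructor
  · intro h a ha b hb c hc h1 h2 h3
    have := h (G • a) (Set.smul_mem_smul_set ha) (G • b) (Set.smul_mem_smul_set hb) (G • c)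
      (Set.smul_mem_smul_set hc) (by simpa using h1) (by simpa using h2) (by simpa using h3)
    obtain ⟨k, hk, h'⟩ := tri_smul_pos hG a b c z
    change 0 ≤ tri _ _ _ _ at this
    rw [h'] at this
    exact nonneg_of_mul_nonneg_right this hk
  · rintro h _ ⟨a, ha, rfl⟩ _ ⟨b, hb, rfl⟩ _ ⟨c, hc, rfl⟩ h1 h2 h3
    obtain ⟨k, hk, h'⟩ := tri_smul_pos hG a b c z
    change 0 ≤ tri (G • a) (G • b) (G • c) (G • z)
    rw [h']
    exact mul_nonneg hk.le (h a ha b hb c hc (fun h => h1 (by rw [h])) (fun h => h2 (by rw [h]))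
      (fun h => h3 (by rw [h])))

theorem smul_mem_geodesicRay {a : OnePoint ℝ} {q z : ℍ} :
    G • z ∈ geodesicRay (G • q) (G • a) ↔ z ∈ geodesicRay q a := by
  obtain ⟨s, hs, -, -, hh⟩ := moebius_package G hG
  obtain ⟨k, hk, hh⟩ := hh a
  simp only [geodesicRay, Set.mem_ofPred_eq, hh]
  constructor
  · rintro ⟨b, h1, h2, h3⟩
    rw [← smul_inv_smul G b, smul_mem_geodesicLine hG] at h1 h2
    exact ⟨_, h1, h2, le_of_mul_le_mul_left h3 hk⟩
  · rintro ⟨b, h1, h2, h3⟩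
    exact ⟨G • b, (smul_mem_geodesicLine hG).mpr h1, (smul_mem_geodesicLine hG).mpr h2,
      mul_le_mul_of_nonneg_left h3 hk.le⟩

end Transport

/-! ### Normal forms -/

theorem mem_line_infty_coe {x : ℝ} {z : ℍ} :
    z ∈ geodesicLine OnePoint.infty (x : OnePoint ℝ) ↔ z.re = x := by
  simp only [geodesicLine, Set.mem_ofPred_eq, sideFun_infty]
  constructor <;> intro h <;> linarith

theorem exists_gl (A : Matrix (Fin 2) (Fin 2) ℝ) (hA : 0 < A.det) :
    ∃ G : GL (Fin 2) ℝ, 0 < G.det.val ∧ G.val = A :=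
  ⟨Matrix.GeneralLinearGroup.mkOfDetNeZero A hA.ne', by simpa using hA, rfl⟩

theorem exists_smul_eq_infty_zero {a b : OnePoint ℝ} (hab : a ≠ b) :
    ∃ G : GL (Fin 2) ℝ, 0 < G.det.val ∧ G • a = OnePoint.infty ∧ G • b = ((0 : ℝ) : OnePoint ℝ) := by
  induction a using OnePoint.rec with
  | infty =>
    induction b using OnePoint.rec with
    | infty => exact absurd rfl hab
    | coe b =>
      obtain ⟨G, hG, h⟩ := exists_gl !![1, -b; 0, 1] (by simp [Matrix.det_fin_two])
      exact ⟨G, hG, by simp [OnePoint.smul_infty_eq_ite, h],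
        by simp [OnePoint.smul_some_eq_ite, h]⟩
  | coe a =>
    induction b using OnePoint.rec with
    | infty =>
      obtain ⟨G, hG, h⟩ := exists_gl !![0, -1; 1, -a] (by simp [Matrix.det_fin_two])
      exact ⟨G, hG, by simp [OnePoint.smul_some_eq_ite, h],
        by simp [OnePoint.smul_infty_eq_ite, h]⟩
    | coe b =>
      have hab' : a ≠ b := fun h => hab (by rw [h])
      have hd : b - a ≠ 0 := sub_ne_zero.mpr hab'.symm
      -- The map `z ↦ (b - a)(z - b)/(z - a)`; the extra factor makes the determinant `(b - a) ^ 2`,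
      -- positive for either order of `a` and `b`.
      obtain ⟨G, hG, h⟩ := exists_gl !![b - a, -(b - a) * b; 1, -a] (by
        rw [Matrix.det_fin_two]; simp; nlinarith [sq_pos_of_ne_zero hd])
      refine ⟨G, hG, by simp [OnePoint.smul_some_eq_ite, h], ?_⟩
      have h1 : b + -a ≠ 0 := by rwa [← sub_eq_add_neg]
      have h2 : (b - a) * b + (a - b) * b = 0 := by ring
      simp [OnePoint.smul_some_eq_ite, h, h1, h2]

theorem HasVertices.smul {V : Set (OnePoint ℝ)} {a b c : OnePoint ℝ} (h : HasVertices V a b c)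
    {Γ : Type*} [Group Γ] [MulAction Γ (OnePoint ℝ)] (G : Γ) :
    HasVertices (G • V) (G • a) (G • b) (G • c) := by
  obtain ⟨h1, h2, h3, rfl⟩ := h
  refine ⟨by simpa using h1, by simpa using h2, by simpa using h3, ?_⟩
  ext x
  simp [Set.mem_smul_set, eq_comm]

theorem exists_smul_eq_standard {V : Set (OnePoint ℝ)} (hV : V.ncard = 3) :
    ∃ G : GL (Fin 2) ℝ, 0 < G.det.val ∧
      G • V = {OnePoint.infty, ((0 : ℝ) : OnePoint ℝ), ((1 : ℝ) : OnePoint ℝ)} := by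
  obtain ⟨a, b, c, h⟩ := exists_hasVertices hV
  obtain ⟨G, hG, ha, hb⟩ := exists_smul_eq_infty_zero h.1
  have h' := h.smul G
  rw [ha, hb] at h'
  obtain ⟨x, hx⟩ : ∃ x : ℝ, (x : OnePoint ℝ) = G • c :=
    OnePoint.ne_infty_iff_exists.mp h'.2.2.1.symm
  rw [← hx] at h'
  have hx0 : x ≠ 0 := fun h0 => h'.2.1 (by rw [h0])
  rcases lt_or_gt_of_ne hx0 with hneg | hpos
  -- For negative `x` the orientation preserving map `z ↦ (z - x)/(-x)` sends `0, x` to `1, 0`. The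
  -- order is reversed, but only the set of vertices matters.
  · obtain ⟨H, hH, h1⟩ := exists_gl !![1, -x; 0, -x] (by rw [Matrix.det_fin_two]; simpa using hneg)
    refine ⟨H * G, by rw [map_mul]; exact mul_pos hH hG, ?_⟩
    rw [mul_smul, (h'.smul H).2.2.2]
    have e1 : H • (OnePoint.infty : OnePoint ℝ) = OnePoint.infty := by
      simp [OnePoint.smul_infty_eq_ite, h1]
    have e2 : H • ((0 : ℝ) : OnePoint ℝ) = ((1 : ℝ) : OnePoint ℝ) := by
      simp [OnePoint.smul_some_eq_ite, h1, hx0]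
    have e3 : H • (x : OnePoint ℝ) = ((0 : ℝ) : OnePoint ℝ) := by
      simp [OnePoint.smul_some_eq_ite, h1, hx0]
    rw [e1, e2, e3, Set.pair_comm]
  · obtain ⟨H, hH, h1⟩ := exists_gl !![1, 0; 0, x] (by rw [Matrix.det_fin_two]; simpa using hpos)
    refine ⟨H * G, by rw [map_mul]; exact mul_pos hH hG, ?_⟩
    rw [mul_smul, (h'.smul H).2.2.2]
    have e1 : H • (OnePoint.infty : OnePoint ℝ) = OnePoint.infty := by
      simp [OnePoint.smul_infty_eq_ite, h1]
    have e2 : H • ((0 : ℝ) : OnePoint ℝ) = ((0 : ℝ) : OnePoint ℝ) := by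
      simp [OnePoint.smul_some_eq_ite, h1, hx0]
    have e3 : H • (x : OnePoint ℝ) = ((1 : ℝ) : OnePoint ℝ) := by
      simp [OnePoint.smul_some_eq_ite, h1, hx0]
    rw [e1, e2, e3]

/-! ### Lines -/

/-- Move the first line to the imaginary axis. The equation of the second line then holds at two
different heights, which kills its leading coefficient and then its constant one, so its ends are
`0` and `∞`. -/
theorem eq_of_two_points {a b a' b' : OnePoint ℝ} {z w : ℍ} (hzw : z ≠ w)
    (hz : z ∈ geodesicLine a b) (hw : w ∈ geodesicLine a b) (hz' : z ∈ geodesicLine a' b')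
    (hw' : w ∈ geodesicLine a' b') : (a = a' ∧ b = b') ∨ (a = b' ∧ b = a') := by
  obtain ⟨G, hG, ha, hb⟩ := exists_smul_eq_infty_zero (ne_of_mem_geodesicLine hz)
  have hne := ne_of_mem_geodesicLine hz'
  rw [← smul_mem_geodesicLine hG] at hz hw hz' hw'
  rw [ha, hb, mem_line_infty_coe] at hz hw
  have hyy : (G • z).im ^ 2 ≠ (G • w).im ^ 2 := by
    intro h
    apply hzw
    have h1 := (pow_left_inj₀ (G • z).im_pos.le (G • w).im_pos.le two_ne_zero).mp h
    have : G • z = G • w := by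
      ext1; apply Complex.ext
      · exact hz.trans hw.symm
      · exact h1
    simpa using this
  simp only [geodesicLine, Set.mem_ofPred_eq, sideFun_eq, hz, hw] at hz' hw'
  have h1 : den (G • a') * den (G • b') * ((G • z).im ^ 2 - (G • w).im ^ 2) = 0 := by linarith
  have hd := (mul_eq_zero.mp h1).resolve_right (sub_ne_zero.mpr hyy)
  have hn : num (G • a') * num (G • b') = 0 := by rw [hd] at hz'; linarith
  have hinj : ∀ x y : OnePoint ℝ, G • x = G • y → x = y := fun x y h => by simpa using h
  have hne' : G • a' ≠ G • b' := fun h => hne (hinj _ _ h)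
  have hcases : ∀ x : OnePoint ℝ, (den x = 0 → x = OnePoint.infty) ∧
      (num x = 0 → x = ((0 : ℝ) : OnePoint ℝ)) := by
    intro x
    induction x using OnePoint.rec <;> simp
  rcases mul_eq_zero.mp hd with h2 | h2 <;> rcases mul_eq_zero.mp hn with h3 | h3
  · have e1 := (hcases _).1 h2; rw [e1] at h3; simp at h3
  · left
    exact ⟨hinj _ _ (ha.trans ((hcases _).1 h2).symm), hinj _ _ (hb.trans ((hcases _).2 h3).symm)⟩
  · right
    exact ⟨hinj _ _ (ha.trans ((hcases _).1 h2).symm), hinj _ _ (hb.trans ((hcases _).2 h3).symm)⟩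
  · have e1 := (hcases _).1 h2; rw [e1] at h3; simp at h3

theorem exists_two_points {a b : OnePoint ℝ} (hab : a ≠ b) :
    ∃ z ∈ geodesicLine a b, ∃ w ∈ geodesicLine a b, z ≠ w := by
  obtain ⟨G, hG, ha, hb⟩ := exists_smul_eq_infty_zero hab
  refine ⟨G⁻¹ • ⟨⟨0, 1⟩, one_pos⟩, ?_, G⁻¹ • ⟨⟨0, 2⟩, two_pos⟩, ?_, ?_⟩
  · rw [← smul_mem_geodesicLine hG, ha, hb, smul_inv_smul, mem_line_infty_coe]; rfl
  · rw [← smul_mem_geodesicLine hG, ha, hb, smul_inv_smul, mem_line_infty_coe]; rfl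
  · intro h
    have := congrArg UpperHalfPlane.im (smul_left_cancel _ h)
    simp [UpperHalfPlane.im] at this

theorem ends_eq_of_line_subset {a b a' b' : OnePoint ℝ} (hab : a ≠ b)
    (h : geodesicLine a b ⊆ geodesicLine a' b') : (a = a' ∧ b = b') ∨ (a = b' ∧ b = a') := by
  obtain ⟨z, hz, w, hw, hzw⟩ := exists_two_points hab
  exact eq_of_two_points hzw hz hw (h hz) (h hw)

theorem exists_smul_eq_infty (a : OnePoint ℝ) :
    ∃ G : GL (Fin 2) ℝ, 0 < G.det.val ∧ G • a = OnePoint.infty := by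
  obtain ⟨b, hb⟩ := exists_ne a
  obtain ⟨G, hG, h, -⟩ := exists_smul_eq_infty_zero hb.symm
  exact ⟨G, hG, h⟩

theorem exists_mem_line (q : ℍ) (a : OnePoint ℝ) : ∃ b, q ∈ geodesicLine a b := by
  obtain ⟨G, hG, h⟩ := exists_smul_eq_infty a
  refine ⟨G⁻¹ • ((G • q).re : OnePoint ℝ), ?_⟩
  rw [← smul_mem_geodesicLine hG, h, smul_inv_smul, mem_line_infty_coe]

theorem continuous_vertical (x : ℝ) {t : ℝ} (ht : 0 < t) : Continuous fun u : ℝ =>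
    (⟨⟨x, t * Real.exp u⟩, mul_pos ht (Real.exp_pos u)⟩ : ℍ) := by
  apply Continuous.upperHalfPlaneMk
  have : Continuous fun u : ℝ => (x : ℂ) + ((t * Real.exp u : ℝ) : ℂ) * Complex.I := by fun_prop
  convert this using 2 with u
  apply Complex.ext <;> simp [-Complex.ofReal_exp]

/-- On a line which crosses another one at `p` there are points arbitrarily close to `p` on both
sides of the other line. -/
theorem frequently_crossing {a b a' b' : OnePoint ℝ} {p : ℍ} (hp : p ∈ geodesicLine a b)
    (hp' : p ∈ geodesicLine a' b') (hne : ¬((a = a' ∧ b = b') ∨ (a = b' ∧ b = a'))) {σ : ℝ}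
    (hσ : σ ≠ 0) : ∃ᶠ z in 𝓝 p, z ∈ geodesicLine a' b' ∧ 0 < sideFun a b z * σ := by
  obtain ⟨G, hG, ha, hb⟩ := exists_smul_eq_infty_zero (ne_of_mem_geodesicLine hp')
  obtain ⟨s, hs, -, hz, -⟩ := moebius_package G hG
  set t := (G • p).im with ht
  have ht0 : 0 < t := (G • p).im_pos
  have hp1 := hp'
  rw [← smul_mem_geodesicLine hG, ha, hb, mem_line_infty_coe] at hp1
  have hp0 := hp
  rw [← smul_mem_geodesicLine hG] at hp0
  simp only [geodesicLine, Set.mem_ofPred_eq, sideFun_eq, hp1, ← ht] at hp0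
  set A := den (G • a) * den (G • b) with hA
  -- With `a'`, `b'` moved to `∞`, `0`, a vanishing leading coefficient would make the two lines
  -- coincide.
  have hA0 : A ≠ 0 := by
    intro h0
    rw [h0] at hp0
    have hn : num (G • a) * num (G • b) = 0 := by linarith
    apply hne
    have hq : ∀ q : ℍ, q ∈ geodesicLine a' b' → q ∈ geodesicLine a b := by
      intro q hq
      rw [← smul_mem_geodesicLine hG, ha, hb, mem_line_infty_coe] at hq
      rw [← smul_mem_geodesicLine hG]
      simp only [geodesicLine, Set.mem_ofPred_eq, sideFun_eq, hq, ← hA, h0, hn]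
      ring
    rcases ends_eq_of_line_subset (ne_of_mem_geodesicLine hp') hq with h | h
    · exact Or.inl ⟨h.1.symm, h.2.symm⟩
    · exact Or.inr ⟨h.2.symm, h.1.symm⟩
  have hsσ : s a * s b * A * σ ≠ 0 :=
    mul_ne_zero (mul_ne_zero (mul_ne_zero (hs a) (hs b)) hA0) hσ
  let γ : ℝ → ℍ := fun u => G⁻¹ • ⟨⟨0, t * Real.exp u⟩, mul_pos ht0 (Real.exp_pos u)⟩
  have hγc : Continuous γ := (continuous_const_smul G⁻¹).comp (continuous_vertical 0 ht0)
  have hγ0 : γ 0 = p := by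
    simp only [γ]
    rw [inv_smul_eq_iff]
    ext1; apply Complex.ext
    · exact hp1.symm
    · simp [ht]
  have hγl : ∀ u, γ u ∈ geodesicLine a' b' := by
    intro u
    rw [← smul_mem_geodesicLine hG, ha, hb, smul_inv_smul, mem_line_infty_coe]; rfl
  -- Along the parametrization `u ↦ i t exp u` of the second line the side function is a nonzero
  -- constant times `exp u ^ 2 - 1`, up to a positive factor, so it changes sign at `u = 0`.
  have hγv : ∀ u, ∃ k > 0, k * sideFun a b (γ u) = A * (s a * s b) * t ^ 2 *
      (Real.exp u ^ 2 - 1) := by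
    intro u
    obtain ⟨k, hk, h⟩ := hz (γ u)
    refine ⟨k, hk, ?_⟩
    rw [← h a b]
    have e1 : G • γ u = ⟨⟨0, t * Real.exp u⟩, mul_pos ht0 (Real.exp_pos u)⟩ := by
      simp only [γ, smul_inv_smul]
    have e2 : (G • γ u).re = 0 := by rw [e1]; rfl
    have e3 : (G • γ u).im = t * Real.exp u := by rw [e1]; rfl
    rw [sideFun_eq, e2, e3, ← hA]
    linear_combination (s a * s b) * hp0
  have hγσ : ∀ u, 0 < (s a * s b * A * σ) * u → 0 < sideFun a b (γ u) * σ := by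
    intro u hu
    obtain ⟨k, hk, h⟩ := hγv u
    have h1 : 0 < (s a * s b * A * σ) * (Real.exp u ^ 2 - 1) := by
      rcases lt_trichotomy u 0 with h0 | h0 | h0
      · have : Real.exp u < 1 := by simpa using h0
        have h2 : s a * s b * A * σ < 0 := by nlinarith
        have h3 := Real.exp_pos u
        exact mul_pos_of_neg_of_neg h2 (by nlinarith)
      · simp [h0] at hu
      · have : 1 < Real.exp u := by simpa using h0
        have h2 : 0 < s a * s b * A * σ := by nlinarith
        have h3 : 0 < Real.exp u ^ 2 - 1 := by nlinarith
        exact mul_pos h2 h3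
    have h2 : k * (sideFun a b (γ u) * σ) = t ^ 2 * ((s a * s b * A * σ) * (Real.exp u ^ 2 - 1)) := by
      linear_combination σ * h
    have h3 : 0 < k * (sideFun a b (γ u) * σ) := by rw [h2]; positivity
    exact pos_of_mul_pos_right h3 hk.le
  have hγt : Tendsto γ (𝓝 0) (𝓝 p) := by
    have := hγc.tendsto 0
    rwa [hγ0] at this
  rcases lt_or_gt_of_ne hsσ with h | h
  · refine (hγt.mono_left nhdsWithin_le_nhds : Tendsto γ (𝓝[<] 0) (𝓝 p)).frequently ?_
    refine Eventually.frequently ?_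
    filter_upwards [self_mem_nhdsWithin] with u hu
    exact ⟨hγl u, hγσ u (mul_pos_of_neg_of_neg h hu)⟩
  · refine (hγt.mono_left nhdsWithin_le_nhds : Tendsto γ (𝓝[>] 0) (𝓝 p)).frequently ?_
    refine Eventually.frequently ?_
    filter_upwards [self_mem_nhdsWithin] with u hu
    exact ⟨hγl u, hγσ u (mul_pos h hu)⟩

theorem frequently_side {a b : OnePoint ℝ} {p : ℍ} (hp : p ∈ geodesicLine a b) {σ : ℝ}
    (hσ : σ ≠ 0) : ∃ᶠ z in 𝓝 p, 0 < sideFun a b z * σ := by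
  obtain ⟨x, hx⟩ : ∃ x : OnePoint ℝ, x ∉ ({a, b} : Set (OnePoint ℝ)) :=
    (Set.toFinite ({a, b} : Set (OnePoint ℝ))).exists_notMem
  obtain ⟨y, hy⟩ := exists_mem_line p x
  refine (frequently_crossing hp hy ?_ hσ).mono fun z hz => hz.2
  rintro (⟨h1, -⟩ | ⟨-, h1⟩) <;> simp [h1] at hx

/-! ### Rays -/

theorem line_end_unique {q : ℍ} {a b b' : OnePoint ℝ} (h : q ∈ geodesicLine a b)
    (h' : q ∈ geodesicLine a b') : b = b' := by
  obtain ⟨G, hG, ha⟩ := exists_smul_eq_infty a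
  have key : ∀ x, q ∈ geodesicLine a x → G • x = ((G • q).re : OnePoint ℝ) := by
    intro x hx
    rw [← smul_mem_geodesicLine hG, ha] at hx
    obtain ⟨y, hy⟩ : ∃ y : ℝ, (y : OnePoint ℝ) = G • x :=
      OnePoint.ne_infty_iff_exists.mp (ne_of_mem_geodesicLine hx).symm
    rw [← hy, mem_line_infty_coe] at hx
    rw [← hy, hx]
  have := (key b h).trans (key b' h').symm
  simpa using this

theorem height_infty (z : ℍ) : height OnePoint.infty z = z.im := by
  simp [height]

theorem mem_ray_infty {q z : ℍ} :
    z ∈ geodesicRay q OnePoint.infty ↔ z.re = q.re ∧ q.im ≤ z.im := by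
  simp only [geodesicRay, Set.mem_ofPred_eq, height_infty]
  constructor
  · rintro ⟨b, h1, h2, h3⟩
    obtain ⟨y, rfl⟩ : ∃ y : ℝ, (y : OnePoint ℝ) = b :=
      OnePoint.ne_infty_iff_exists.mp (ne_of_mem_geodesicLine h1).symm
    rw [mem_line_infty_coe] at h1 h2
    exact ⟨h2.trans h1.symm, h3⟩
  · rintro ⟨h1, h2⟩
    exact ⟨(q.re : OnePoint ℝ), mem_line_infty_coe.mpr rfl, mem_line_infty_coe.mpr h1, h2⟩

theorem self_mem_ray (q : ℍ) (a : OnePoint ℝ) : q ∈ geodesicRay q a := by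
  obtain ⟨b, hb⟩ := exists_mem_line q a
  exact ⟨b, hb, hb, le_rfl⟩

theorem ray_subset_line {q : ℍ} {a b : OnePoint ℝ} (h : q ∈ geodesicLine a b) :
    geodesicRay q a ⊆ geodesicLine a b := by
  rintro z ⟨b', h1, h2, -⟩
  rwa [line_end_unique h h1]

theorem mem_ray_iff {q z : ℍ} {a b : OnePoint ℝ} (h : q ∈ geodesicLine a b) :
    z ∈ geodesicRay q a ↔ z ∈ geodesicLine a b ∧ height a q ≤ height a z :=
  ⟨fun hz => ⟨ray_subset_line h hz, hz.choose_spec.2.2⟩, fun hz => ⟨b, h, hz.1, hz.2⟩⟩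

theorem line_eq_union_rays {q : ℍ} {a b : OnePoint ℝ} (h : q ∈ geodesicLine a b) :
    geodesicLine a b = geodesicRay q a ∪ geodesicRay q b ∧
      geodesicRay q a ∩ geodesicRay q b ⊆ {q} := by
  obtain ⟨G, hG, ha, hb⟩ := exists_smul_eq_infty_zero (ne_of_mem_geodesicLine h)
  have hq : (G • q).re = 0 := by
    rwa [← smul_mem_geodesicLine hG, ha, hb, mem_line_infty_coe] at h
  have key1 : ∀ z, z ∈ geodesicLine a b → (G • z).re = 0 := by
    intro z hz
    rwa [← smul_mem_geodesicLine hG, ha, hb, mem_line_infty_coe] at hz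
  have keya : ∀ z, z ∈ geodesicLine a b → (z ∈ geodesicRay q a ↔ (G • q).im ≤ (G • z).im) := by
    intro z hz
    rw [← smul_mem_geodesicRay hG, ha, mem_ray_infty, hq]
    simp [key1 z hz]
  have hh : ∀ w : ℍ, w.re = 0 → height ((0 : ℝ) : OnePoint ℝ) w = 1 / w.im := by
    intro w hw
    have := w.im_pos
    simp [height, Complex.normSq_apply, hw]
  have keyb : ∀ z, z ∈ geodesicLine a b → (z ∈ geodesicRay q b ↔ (G • z).im ≤ (G • q).im) := by
    intro z hz
    have h' : G • q ∈ geodesicLine (G • b) (G • a) := by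
      rw [geodesicLine_comm, smul_mem_geodesicLine hG]; exact h
    rw [← smul_mem_geodesicRay hG, mem_ray_iff h', geodesicLine_comm, smul_mem_geodesicLine hG, hb,
      hh _ hq, hh _ (key1 z hz), one_div_le_one_div (G • q).im_pos (G • z).im_pos]
    simp [hz]
  have hsub : geodesicRay q b ⊆ geodesicLine a b := by
    rw [← geodesicLine_comm]; exact ray_subset_line (by rw [geodesicLine_comm]; exact h)
  refine ⟨Set.Subset.antisymm ?_ (Set.union_subset (ray_subset_line h) hsub), ?_⟩
  · intro z hz
    rcases le_total (G • q).im (G • z).im with h1 | h1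
    · exact Or.inl ((keya z hz).mpr h1)
    · exact Or.inr ((keyb z hz).mpr h1)
  · rintro z ⟨hza, hzb⟩
    have hz := ray_subset_line h hza
    have h1 := le_antisymm ((keya z hz).mp hza) ((keyb z hz).mp hzb)
    have : G • z = G • q := by
      ext1; apply Complex.ext
      · exact (key1 z hz).trans hq.symm
      · exact h1.symm
    simpa using this

theorem isPreconnected_ray (q : ℍ) (a : OnePoint ℝ) : IsPreconnected (geodesicRay q a) := by
  obtain ⟨G, hG, ha⟩ := exists_smul_eq_infty a
  have hq0 := (G • q).im_pos
  let f : ℝ → ℍ := fun u => G⁻¹ • ⟨⟨(G • q).re, (G • q).im * Real.exp u⟩,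
    mul_pos hq0 (Real.exp_pos u)⟩
  have himg : geodesicRay q a = f '' Set.Ici 0 := by
    ext z
    rw [← smul_mem_geodesicRay hG, ha, mem_ray_infty]
    constructor
    · rintro ⟨h1, h2⟩
      have hz0 := (G • z).im_pos
      refine ⟨Real.log ((G • z).im / (G • q).im), Real.log_nonneg ((one_le_div hq0).mpr h2), ?_⟩
      simp only [f]
      rw [inv_smul_eq_iff]
      ext1; apply Complex.ext
      · exact h1.symm
      · change (G • q).im * Real.exp _ = (G • z).im
        rw [Real.exp_log (div_pos hz0 hq0)]
        field_simp
    · rintro ⟨u, hu, rfl⟩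
      simp only [f]
      rw [smul_inv_smul]
      exact ⟨rfl, le_mul_of_one_le_right hq0.le (Real.one_le_exp hu)⟩
  rw [himg]
  exact isPreconnected_Ici.image f
    ((continuous_const_smul G⁻¹).comp (continuous_vertical _ hq0)).continuousOn

theorem isPreconnected_line (a b : OnePoint ℝ) : IsPreconnected (geodesicLine a b) := by
  rcases (geodesicLine a b).eq_empty_or_nonempty with h | ⟨q, hq⟩
  · rw [h]; exact isPreconnected_empty
  · rw [(line_eq_union_rays hq).1]
    exact (isPreconnected_ray q a).union q (self_mem_ray q a) (self_mem_ray q b)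
      (isPreconnected_ray q b)

/-- A ray that stays in an ideal triangle ends in one of its vertices. -/
theorem ray_end_mem {V : Set (OnePoint ℝ)} (hV : V.ncard = 3) {q : ℍ} {x : OnePoint ℝ}
    (h : geodesicRay q x ⊆ openTriangle V) : x ∈ V := by
  by_contra hx
  obtain ⟨G, hG, hGx⟩ := exists_smul_eq_infty x
  -- With the end of the ray at `∞`, the side function of a semicircle is eventually positive on the
  -- vertical ray. If the ray stays in the triangle, `∞` lies on the inner side of all three sides,
  -- against `tri_cycle_product_neg`.
  have key : ∀ a b c, HasVertices V a b c → 0 ≤ boundarySideFun (G • a) (G • b) (G • x) *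
      boundarySideFun (G • a) (G • b) (G • c) := by
    intro a b c hVa
    have hne : ∀ y ∈ V, ∃ r : ℝ, (r : OnePoint ℝ) = G • y := by
      intro y hy
      apply OnePoint.ne_infty_iff_exists.mp
      rw [← hGx]
      intro h'
      exact hx (by rwa [← show y = x by simpa using h'])
    obtain ⟨r, hr⟩ := hne a hVa.mem.1
    obtain ⟨s, hs⟩ := hne b hVa.mem.2.1
    obtain ⟨t, ht⟩ := hne c hVa.mem.2.2
    have hlow : ∀ y : ℝ, (G • q).im ≤ y → 0 < (((G • q).re - r) * ((G • q).re - s) + y ^ 2) *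
        boundarySideFun (G • a) (G • b) (G • c) := by
      intro y hy
      have hy0 : 0 < y := (G • q).im_pos.trans_le hy
      have hmem : G • (G⁻¹ • (⟨⟨(G • q).re, y⟩, hy0⟩ : ℍ)) ∈ geodesicRay (G • q) (G • x) := by
        rw [smul_inv_smul, hGx, mem_ray_infty]; exact ⟨rfl, hy⟩
      rw [smul_mem_geodesicRay hG] at hmem
      have h1 := h hmem
      rw [← smul_mem_openTriangle hG, (hVa.smul G).mem_openTriangle, smul_inv_smul] at h1
      have h2 := h1.1
      rw [tri, ← hr, ← hs, sideFun_coe] at h2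
      rw [← hr, ← hs]
      exact h2
    rw [hGx, ← hr, ← hs, ← ht]
    have h1 : boundarySideFun (r : OnePoint ℝ) (s : OnePoint ℝ) OnePoint.infty = 1 := by
      simp [boundarySideFun]
    rw [h1, one_mul]
    rw [← hr, ← hs, ← ht] at hlow
    -- A height at which the square outweighs the product of the real differences.
    have h2 := hlow (max (G • q).im (1 + |((G • q).re - r) * ((G • q).re - s)|)) (le_max_left _ _)
    set y := max (G • q).im (1 + |((G • q).re - r) * ((G • q).re - s)|)
    have h3 : 1 + |((G • q).re - r) * ((G • q).re - s)| ≤ y := le_max_right _ _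
    have h4 := neg_abs_le (((G • q).re - r) * ((G • q).re - s))
    have h5 := abs_nonneg (((G • q).re - r) * ((G • q).re - s))
    have h6 : 0 < ((G • q).re - r) * ((G • q).re - s) + y ^ 2 := by nlinarith
    exact (pos_of_mul_pos_right h2 h6.le).le
  obtain ⟨a, b, c, hVa⟩ := exists_hasVertices hV
  have hm := hVa.mem
  have hVG := hVa.smul G
  have hxne : ∀ y ∈ V, G • x ≠ G • y := by
    intro y hy h'
    exact hx (by rwa [show x = y by simpa using h'])
  have := tri_cycle_product_neg hVG.1 hVG.2.1 hVG.2.2.1 (hxne a hm.1) (hxne b hm.2.1)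
    (hxne c hm.2.2)
  have h1 := key a b c hVa
  have h2 := key b c a hVa.rotate
  have h3 := key c a b hVa.rotate.rotate
  exact absurd this (not_lt.mpr (mul_nonneg (mul_nonneg h1 h2) h3))

/-- With the vertex `a` at `∞`, two of the conditions depend only on the real part, and the third
one, being above a semicircle, is preserved when the imaginary part grows. -/
theorem ray_subset_openTriangle {V : Set (OnePoint ℝ)} (hV : V.ncard = 3) {q : ℍ} {a : OnePoint ℝ}
    (ha : a ∈ V) (hq : q ∈ openTriangle V) : geodesicRay q a ⊆ openTriangle V := by
  obtain ⟨b, c, h⟩ := exists_hasVertices_of_mem hV ha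
  obtain ⟨G, hG, hGa⟩ := exists_smul_eq_infty a
  have hVG := h.smul G
  intro z hz
  rw [← smul_mem_geodesicRay hG, hGa, mem_ray_infty] at hz
  rw [← smul_mem_openTriangle hG, hVG.mem_openTriangle] at hq ⊢
  rw [hGa] at hVG hq ⊢
  obtain ⟨r, hr⟩ : ∃ r : ℝ, (r : OnePoint ℝ) = G • b :=
    OnePoint.ne_infty_iff_exists.mp hVG.1.symm
  obtain ⟨s, hs⟩ : ∃ s : ℝ, (s : OnePoint ℝ) = G • c :=
    OnePoint.ne_infty_iff_exists.mp hVG.2.2.1.symm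
  rw [← hr, ← hs] at hq ⊢
  have him := (G • q).im_pos
  simp only [tri, sideFun_infty, sideFun_coe, sideFun_comm OnePoint.infty] at hq ⊢
  rw [hz.1]
  refine ⟨hq.1, ?_, hq.2.2⟩
  have h1 : boundarySideFun (r : OnePoint ℝ) (s : OnePoint ℝ) OnePoint.infty = 1 := by
    simp [boundarySideFun]
  rw [h1] at hq ⊢
  nlinarith [hq.2.1, hz.2]

/-! ### Balls in ideal triangles -/

theorem isometry_moebius {G : GL (Fin 2) ℝ} (hG : 0 < G.det.val) :
    Isometry fun z : ℍ => G • z := by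
  set d := Real.sqrt G.det.val with hd
  have hd0 : 0 < d := Real.sqrt_pos.mpr hG
  have hdd : d * d = G.det.val := Real.mul_self_sqrt hG.le
  have hdet : G.det.val = G 0 0 * G 1 1 - G 0 1 * G 1 0 := by
    rw [Matrix.GeneralLinearGroup.val_det_apply, Matrix.det_fin_two]
  let A : SL(2, ℝ) := ⟨!![G 0 0 / d, G 0 1 / d; G 1 0 / d, G 1 1 / d], by
    rw [Matrix.det_fin_two]
    simp
    field_simp
    rw [pow_two, hdd, hdet]⟩
  have hA : (fun z : ℍ => G • z) = fun z : ℍ => A • z := by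
    funext z
    ext1
    rw [UpperHalfPlane.coe_smul_of_det_pos hG, UpperHalfPlane.coe_specialLinearGroup_apply]
    have hdc : (d : ℂ) ≠ 0 := by exact_mod_cast hd0.ne'
    have h0 := UpperHalfPlane.denom_ne_zero G z
    simp only [UpperHalfPlane.num, UpperHalfPlane.denom] at h0 ⊢
    simp [A]
    have e1 : (G 0 0 / d * z + G 0 1 / d : ℂ) = (G 0 0 * z + G 0 1) / d := by ring
    have e2 : (G 1 0 / d * z + G 1 1 / d : ℂ) = (G 1 0 * z + G 1 1) / d := by ring
    rw [e1, e2, div_div_div_cancel_right₀ hdc]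
  rw [hA]
  exact IsIsometricSMul.isometry_smul ℍ A

/-- All ideal triangles contain balls of a common radius. -/
theorem exists_ball_subset : ∃ ρ > 0, ∀ V : Set (OnePoint ℝ), V.ncard = 3 →
    ∃ c : ℍ, Metric.ball c ρ ⊆ openTriangle V := by
  have h0 : HasVertices {OnePoint.infty, ((0 : ℝ) : OnePoint ℝ), ((1 : ℝ) : OnePoint ℝ)}
      OnePoint.infty ((0 : ℝ) : OnePoint ℝ) ((1 : ℝ) : OnePoint ℝ) :=
    ⟨by simp, by simp, by simp, rfl⟩
  have hc : (⟨⟨1 / 2, 1⟩, one_pos⟩ : ℍ) ∈ openTriangle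
      {OnePoint.infty, ((0 : ℝ) : OnePoint ℝ), ((1 : ℝ) : OnePoint ℝ)} := by
    rw [h0.mem_openTriangle]
    have e1 : (⟨⟨1 / 2, 1⟩, one_pos⟩ : ℍ).re = 1 / 2 := rfl
    have e2 : (⟨⟨1 / 2, 1⟩, one_pos⟩ : ℍ).im = 1 := rfl
    simp only [tri, sideFun_infty, sideFun_coe, sideFun_comm OnePoint.infty, boundarySideFun,
      num_coe, den_coe, num_infty, den_infty, e1, e2]
    norm_num
  obtain ⟨ρ, hρ, hball⟩ := Metric.isOpen_iff.mp h0.isOpen_openTriangle _ hc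
  refine ⟨ρ, hρ, fun V hV => ?_⟩
  obtain ⟨G, hG, hGV⟩ := exists_smul_eq_standard hV
  refine ⟨G⁻¹ • ⟨⟨1 / 2, 1⟩, one_pos⟩, fun z hz => ?_⟩
  rw [← smul_mem_openTriangle hG, hGV]
  apply hball
  have := (isometry_moebius hG).dist_eq z (G⁻¹ • ⟨⟨1 / 2, 1⟩, one_pos⟩)
  rw [smul_inv_smul] at this
  rw [Metric.mem_ball, this]
  exact hz

end QuotientTriangulation

namespace QuotientTriangulation

open scoped Pointwise Topology
open Filter Matrix.SpecialLinearGroup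

/-! ### Elements of `PSL(2, ℤ)` -/

theorem exists_mk (g : PSL(2, ℤ)) : ∃ A : SL(2, ℤ), toPSL A = g := QuotientGroup.mk_surjective g

theorem det_mapGL_pos (A : SL(2, ℤ)) : 0 < (mapGL ℝ A : GL (Fin 2) ℝ).det.val := by simp

theorem toPSL_smul_upper (A : SL(2, ℤ)) (z : ℍ) : toPSL A • z = (mapGL ℝ A : GL (Fin 2) ℝ) • z := rfl

theorem toPSL_smul_boundary (A : SL(2, ℤ)) (x : OnePoint ℝ) :
    toPSL A • x = (mapGL ℝ A : GL (Fin 2) ℝ) • x := rfl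

theorem toPSL_mul (A B : SL(2, ℤ)) : toPSL (A * B) = toPSL A * toPSL B := rfl

theorem toPSL_eq_iff {A B : SL(2, ℤ)} : toPSL A = toPSL B ↔ A = B ∨ A = -B := by
  rw [toPSL, toPSL, QuotientGroup.eq]
  constructor
  · intro h
    rcases center_eq _ h with h | h
    · left; exact (inv_mul_eq_one.mp h)
    · right
      rw [inv_mul_eq_iff_eq_mul] at h
      rw [h]; simp
  · rintro (rfl | rfl)
    · simp
    · rw [Matrix.SpecialLinearGroup.mem_center_iff]
      refine ⟨-1, by simp, ?_⟩
      have : (-B)⁻¹ * B = -1 := by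
        rw [inv_mul_eq_iff_eq_mul]; simp
      rw [this]
      ext i j
      fin_cases i <;> fin_cases j <;> simp

theorem toPSL_eq_one_iff {A : SL(2, ℤ)} :
    toPSL A = 1 ↔ A 0 1 = 0 ∧ A 1 0 = 0 ∧ A 0 0 = A 1 1 := by
  rw [show (1 : PSL(2, ℤ)) = toPSL 1 from rfl, toPSL_eq_iff]
  constructor
  · rintro (rfl | rfl) <;> simp
  · rintro ⟨h1, h2, h3⟩
    have hdet := A.det_coe
    rw [Matrix.det_fin_two, h1, h3] at hdet
    have : A 1 1 * A 1 1 = 1 := by linarith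
    rcases mul_self_eq_one_iff.mp this with h | h
    · left; ext i j; fin_cases i <;> fin_cases j <;> simp [h1, h2, h3, h]
    · right; ext i j; fin_cases i <;> fin_cases j <;> simp [h1, h2, h3, h]

theorem mapGL_apply_entry (A : SL(2, ℤ)) (i j : Fin 2) :
    (mapGL ℝ A : GL (Fin 2) ℝ) i j = (A i j : ℝ) := by simp

theorem toPSL_eq_one_of_mem_center {A : SL(2, ℤ)}
    (h : (mapGL ℝ A : GL (Fin 2) ℝ) ∈ Subgroup.center (GL (Fin 2) ℝ)) : toPSL A = 1 := by
  rw [Matrix.GeneralLinearGroup.mem_center_iff_val_mem_range_scalar] at h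
  obtain ⟨r, hr⟩ := h
  have e : ∀ i j, (A i j : ℝ) = (Matrix.scalar (Fin 2) r) i j := by
    intro i j; rw [hr, ← mapGL_apply_entry]
  rw [toPSL_eq_one_iff]
  refine ⟨?_, ?_, ?_⟩
  · have := e 0 1; simp at this; exact_mod_cast this
  · have := e 1 0; simp at this; exact_mod_cast this
  · have h1 := e 0 0; have h2 := e 1 1; simp at h1 h2
    exact_mod_cast h1.trans h2.symm

theorem isElliptic_of_fixes {A : SL(2, ℤ)} (h1 : toPSL A ≠ 1) {z : ℍ} (hz : toPSL A • z = z) :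
    (mapGL ℝ A : GL (Fin 2) ℝ).IsElliptic :=
  UpperHalfPlane.isElliptic_of_exists_smul_eq_self (det_mapGL_pos A)
    (fun h => h1 (toPSL_eq_one_of_mem_center h)) ⟨z, hz⟩

/-- A nontrivial element with a fixed point in `ℍ` is elliptic and has no fixed point on the
boundary. -/
theorem eq_one_of_fixes_point_of_fixes_end {g : PSL(2, ℤ)} {z : ℍ} {a : OnePoint ℝ}
    (hz : g • z = z) (ha : g • a = a) : g = 1 := by
  obtain ⟨A, rfl⟩ := exists_mk g
  by_contra h1
  exact (isElliptic_of_fixes h1 hz).smul_ne_self a ha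

theorem eq_one_of_fixes_two_points {g : PSL(2, ℤ)} {z w : ℍ} (hzw : z ≠ w)
    (hz : g • z = z) (hw : g • w = w) : g = 1 := by
  obtain ⟨A, rfl⟩ := exists_mk g
  by_contra h1
  have h := isElliptic_of_fixes h1 hz
  have hz' := (UpperHalfPlane.gl_smul_eq_self_iff_eq_fixedPt (det_mapGL_pos A) h).mp hz
  have hw' := (UpperHalfPlane.gl_smul_eq_self_iff_eq_fixedPt (det_mapGL_pos A) h).mp hw
  exact hzw (hz'.trans hw'.symm)

/-- Finite fixed points are roots of a polynomial of degree at most two, whose leading coefficient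
vanishes if `∞` is fixed as well. -/
theorem eq_one_of_fixes_three_ends {g : PSL(2, ℤ)} {a b c : OnePoint ℝ} (hab : a ≠ b)
    (hbc : b ≠ c) (hac : a ≠ c) (ha : g • a = a) (hb : g • b = b) (hc : g • c = c) : g = 1 := by
  obtain ⟨A, rfl⟩ := exists_mk g
  apply toPSL_eq_one_of_mem_center
  rw [Matrix.GeneralLinearGroup.mem_center_iff_val_mem_range_scalar]
  rw [toPSL_smul_boundary] at ha hb hc
  set G := (mapGL ℝ A : GL (Fin 2) ℝ)
  have key : G 0 1 = 0 ∧ G 1 0 = 0 ∧ G 0 0 = G 1 1 := by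
    have hreal : ∀ x : ℝ, G • (x : OnePoint ℝ) = x →
        G 1 0 * x ^ 2 + (G 1 1 - G 0 0) * x - G 0 1 = 0 := by
      intro x hx
      have := Matrix.GeneralLinearGroup.fixpointPolynomial_aeval_eq_zero_iff.mpr hx
      simpa [Matrix.GeneralLinearGroup.fixpointPolynomial] using this
    have htwo : ∀ x y : ℝ, x ≠ y → G 1 0 = 0 → G • (x : OnePoint ℝ) = x →
        G • (y : OnePoint ℝ) = y → G 0 1 = 0 ∧ G 1 0 = 0 ∧ G 0 0 = G 1 1 := by
      intro x y hxy h0 hx hy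
      have h1 := hreal x hx
      have h2 := hreal y hy
      rw [h0] at h1 h2
      have h3 : (G 1 1 - G 0 0) * (x - y) = 0 := by linarith
      have h4 := (mul_eq_zero.mp h3).resolve_right (sub_ne_zero.mpr hxy)
      rw [h4] at h1
      exact ⟨by linarith, h0, by linarith⟩
    induction a using OnePoint.rec with
    | infty =>
      have h0 := OnePoint.smul_infty_eq_self_iff.mp ha
      induction b using OnePoint.rec with
      | infty => exact absurd rfl hab
      | coe b =>
        induction c using OnePoint.rec with
        | infty => exact absurd rfl hac
        | coe c => exact htwo b c (fun h => hbc (by rw [h])) h0 hb hc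
    | coe a =>
      induction b using OnePoint.rec with
      | infty =>
        have h0 := OnePoint.smul_infty_eq_self_iff.mp hb
        induction c using OnePoint.rec with
        | infty => exact absurd rfl hbc
        | coe c => exact htwo a c (fun h => hac (by rw [h])) h0 ha hc
      | coe b =>
        have hab' : a - b ≠ 0 := sub_ne_zero.mpr fun h => hab (by rw [h])
        induction c using OnePoint.rec with
        | infty =>
          exact htwo a b (sub_ne_zero.mp hab') (OnePoint.smul_infty_eq_self_iff.mp hc) ha hb
        | coe c =>
          have hbc' : b - c ≠ 0 := sub_ne_zero.mpr fun h => hbc (by rw [h])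
          have hac' : a - c ≠ 0 := sub_ne_zero.mpr fun h => hac (by rw [h])
          have h1 := hreal a ha
          have h2 := hreal b hb
          have h3 := hreal c hc
          have h4 : (a - b) * (G 1 0 * (a + b) + (G 1 1 - G 0 0)) = 0 := by linarith
          have h5 : (b - c) * (G 1 0 * (b + c) + (G 1 1 - G 0 0)) = 0 := by linarith
          have h6 := (mul_eq_zero.mp h4).resolve_left hab'
          have h7 := (mul_eq_zero.mp h5).resolve_left hbc'
          have h8 : (a - c) * G 1 0 = 0 := by linarith
          have h0 := (mul_eq_zero.mp h8).resolve_left hac'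
          exact htwo a b (sub_ne_zero.mp hab') h0 ha hb
  refine ⟨G 0 0, ?_⟩
  ext i j
  fin_cases i <;> fin_cases j <;> simp [key.1, key.2.1, key.2.2]

/-- Cayley–Hamilton: the square of a matrix of trace 0 and determinant 1 is `-1`. -/
theorem toPSL_mul_self_of_trace {A : SL(2, ℤ)} (h : A 0 0 + A 1 1 = 0) :
    toPSL A * toPSL A = 1 := by
  rw [← toPSL_mul, toPSL_eq_one_iff]
  have h' : A 1 1 = - A 0 0 := by linarith
  refine ⟨?_, ?_, ?_⟩ <;> simp [Matrix.mul_apply, Fin.sum_univ_two, h'] <;> ring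

theorem trace_of_swaps {A : SL(2, ℤ)} {a b : OnePoint ℝ} (hab : a ≠ b) (ha : toPSL A • a = b)
    (hb : toPSL A • b = a) : A 0 0 + A 1 1 = 0 := by
  rw [toPSL_smul_boundary] at ha hb
  suffices h : ((A 0 0 : ℝ)) + (A 1 1 : ℝ) = 0 by exact_mod_cast h
  rw [← mapGL_apply_entry, ← mapGL_apply_entry]
  set G := (mapGL ℝ A : GL (Fin 2) ℝ)
  have hinf : ∀ x : ℝ, G • (OnePoint.infty : OnePoint ℝ) = x →
      G • (x : OnePoint ℝ) = OnePoint.infty → G 0 0 + G 1 1 = 0 := by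
    intro x h1 h2
    rw [OnePoint.smul_infty_eq_ite] at h1
    rw [OnePoint.smul_some_eq_ite] at h2
    split_ifs at h1 with h0
    · exact absurd h1 (OnePoint.infty_ne_coe _)
    · split_ifs at h2 with h3
      · have h1' : G 0 0 / G 1 0 = x := by exact_mod_cast h1
        rw [← h1', mul_div_cancel₀ _ h0] at h3
        exact h3
      · exact absurd h2 (OnePoint.coe_ne_infty _)
  induction a using OnePoint.rec with
  | infty =>
    induction b using OnePoint.rec with
    | infty => exact absurd rfl hab
    | coe b => exact hinf b ha hb
  | coe a =>
    induction b using OnePoint.rec with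
    | infty => exact hinf a hb ha
    | coe b =>
      rw [OnePoint.smul_some_eq_ite] at ha hb
      split_ifs at ha with h1
      · exact absurd ha (OnePoint.infty_ne_coe _)
      split_ifs at hb with h2
      · exact absurd hb (OnePoint.infty_ne_coe _)
      have ha' : (G 0 0 * a + G 0 1) / (G 1 0 * a + G 1 1) = b := by exact_mod_cast ha
      have hb' : (G 0 0 * b + G 0 1) / (G 1 0 * b + G 1 1) = a := by exact_mod_cast hb
      rw [div_eq_iff h1] at ha'
      rw [div_eq_iff h2] at hb'
      have h3 : (a - b) * (G 0 0 + G 1 1) = 0 := by linarith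
      exact (mul_eq_zero.mp h3).resolve_left (sub_ne_zero.mpr fun h => hab (by rw [h]))

/-- The swap reverses the sign of `bracket a b`, so the scalars satisfy `s a * s b = -det`. At a
fixed point `m` the law for `sideFun` then equates a negative and a positive multiple of `sideFun a
b m`, which must vanish. -/
theorem mem_line_of_swaps {g : PSL(2, ℤ)} {a b : OnePoint ℝ} (hab : a ≠ b) (ha : g • a = b)
    (hb : g • b = a) {m : ℍ} (hm : g • m = m) : m ∈ geodesicLine a b := by
  obtain ⟨A, rfl⟩ := exists_mk g
  rw [toPSL_smul_boundary] at ha hb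
  rw [toPSL_smul_upper] at hm
  obtain ⟨s, hs, hbr, hz, -⟩ := moebius_package _ (det_mapGL_pos A)
  obtain ⟨k, hk, hz⟩ := hz m
  have h1 := hbr a b
  have h2 := hz a b
  have hd := det_mapGL_pos A
  rw [ha, hb, bracket_swap] at h1
  rw [ha, hb, hm, sideFun_comm] at h2
  have h3 : bracket a b * (s a * s b + (mapGL ℝ A : GL (Fin 2) ℝ).det.val) = 0 := by linarith
  have h4 := (mul_eq_zero.mp h3).resolve_left (bracket_ne_zero hab)
  have h5 : (k + (mapGL ℝ A : GL (Fin 2) ℝ).det.val) * sideFun a b m = 0 := by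
    have : s a * s b = -(mapGL ℝ A : GL (Fin 2) ℝ).det.val := by linarith
    rw [this] at h2
    linarith
  exact (mul_eq_zero.mp h5).resolve_left (by positivity)

/-- An element that swaps the ends of a line is a rotation of order 2 about a point of the line. -/
theorem rotation_of_swaps {g : PSL(2, ℤ)} {a b : OnePoint ℝ} (hab : a ≠ b) (ha : g • a = b)
    (hb : g • b = a) : g * g = 1 ∧ g ≠ 1 ∧ ∃ m ∈ geodesicLine a b, g • m = m := by
  obtain ⟨A, rfl⟩ := exists_mk g
  have ht := trace_of_swaps hab ha hb
  have hell : (mapGL ℝ A : GL (Fin 2) ℝ).IsElliptic := by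
    have h1 : ((A 0 0 : ℝ)) + (A 1 1 : ℝ) = 0 := by exact_mod_cast ht
    have h2 := A.det_coe
    rw [Matrix.det_fin_two] at h2
    have h3 : (A 0 0 : ℝ) * A 1 1 - A 0 1 * A 1 0 = 1 := by exact_mod_cast h2
    change Matrix.discr _ < 0
    rw [Matrix.discr_fin_two, Matrix.trace_fin_two, Matrix.det_fin_two]
    simp only [mapGL_apply_entry, h1, h3]
    norm_num
  have hfix := (UpperHalfPlane.gl_smul_eq_self_iff_eq_fixedPt (det_mapGL_pos A) hell).mpr rfl
  refine ⟨toPSL_mul_self_of_trace ht, ?_, _, mem_line_of_swaps hab ha hb hfix, hfix⟩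
  intro h
  rw [h, one_smul] at ha
  exact hab ha

theorem orient_psl_smul (g : PSL(2, ℤ)) (a b c : OnePoint ℝ) :
    ∃ k > 0, orient (g • a) (g • b) (g • c) = k * orient a b c := by
  obtain ⟨A, rfl⟩ := exists_mk g
  exact orient_smul_pos (det_mapGL_pos A) a b c

theorem psl_smul_mem_geodesicLine (g : PSL(2, ℤ)) {a b : OnePoint ℝ} {z : ℍ} :
    g • z ∈ geodesicLine (g • a) (g • b) ↔ z ∈ geodesicLine a b := by
  obtain ⟨A, rfl⟩ := exists_mk g
  exact smul_mem_geodesicLine (det_mapGL_pos A)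

theorem psl_smul_mem_geodesicRay (g : PSL(2, ℤ)) {a : OnePoint ℝ} {q z : ℍ} :
    g • z ∈ geodesicRay (g • q) (g • a) ↔ z ∈ geodesicRay q a := by
  obtain ⟨A, rfl⟩ := exists_mk g
  exact smul_mem_geodesicRay (det_mapGL_pos A)

theorem psl_smul_mem_openTriangle (g : PSL(2, ℤ)) {V : Set (OnePoint ℝ)} {z : ℍ} :
    g • z ∈ openTriangle (g • V) ↔ z ∈ openTriangle V := by
  obtain ⟨A, rfl⟩ := exists_mk g
  exact smul_mem_openTriangle (det_mapGL_pos A)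

theorem psl_smul_mem_closedTriangle (g : PSL(2, ℤ)) {V : Set (OnePoint ℝ)} {z : ℍ} :
    g • z ∈ closedTriangle (g • V) ↔ z ∈ closedTriangle V := by
  obtain ⟨A, rfl⟩ := exists_mk g
  exact smul_mem_closedTriangle (det_mapGL_pos A)

theorem isometry_psl_smul (g : PSL(2, ℤ)) : Isometry fun z : ℍ => g • z := by
  obtain ⟨A, rfl⟩ := exists_mk g
  exact isometry_moebius (det_mapGL_pos A)

instance : ContinuousConstSMul PSL(2, ℤ) ℍ := ⟨fun g => (isometry_psl_smul g).continuous⟩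

theorem smul_geodesicLine (g : PSL(2, ℤ)) (a b : OnePoint ℝ) :
    g • geodesicLine a b = geodesicLine (g • a) (g • b) := by
  ext z
  rw [Set.mem_smul_set_iff_inv_smul_mem, ← psl_smul_mem_geodesicLine g, smul_inv_smul]

theorem smul_geodesicRay (g : PSL(2, ℤ)) (q : ℍ) (a : OnePoint ℝ) :
    g • geodesicRay q a = geodesicRay (g • q) (g • a) := by
  ext z
  rw [Set.mem_smul_set_iff_inv_smul_mem, ← psl_smul_mem_geodesicRay g, smul_inv_smul]

/-- An element that permutes three boundary points cyclically is a rotation of order 3 about a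
point of the ideal triangle. -/
theorem rotation_of_cycle {g : PSL(2, ℤ)} {V : Set (OnePoint ℝ)} {a b c : OnePoint ℝ}
    (hV : HasVertices V a b c) (ha : g • a = b) (hb : g • b = c) (hc : g • c = a) :
    g ^ 3 = 1 ∧ ∃ q ∈ openTriangle V, g • q = q := by
  have h3 : g ^ 3 = 1 := by
    apply eq_one_of_fixes_three_ends hV.1 hV.2.1 hV.2.2.1 <;>
      simp [pow_succ, mul_smul, ha, hb, hc]
  refine ⟨h3, ?_⟩
  obtain ⟨A, rfl⟩ := exists_mk g
  have hA1 : ¬(A 0 1 = 0 ∧ A 1 0 = 0 ∧ A 0 0 = A 1 1) := by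
    rw [← toPSL_eq_one_iff]
    intro h
    rw [h, one_smul] at ha
    exact hV.1 ha
  have hdet := A.det_coe
  rw [Matrix.det_fin_two] at hdet
  -- With trace `t`, Cayley–Hamilton gives `A ^ 3 = (t ^ 2 - 1) A - t`. If this is scalar and `A` is
  -- not, then `t ^ 2 = 1`.
  have htr : (A 0 0 + A 1 1) ^ 2 = 1 := by
    rw [show toPSL A ^ 3 = toPSL (A * A * A) by rw [toPSL_mul, toPSL_mul, pow_succ, pow_two],
      toPSL_eq_one_iff] at h3
    simp only [Matrix.SpecialLinearGroup.coe_mul, Matrix.mul_apply, Fin.sum_univ_two] at h3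
    by_contra hne
    have hne' : (A 0 0 + A 1 1) ^ 2 - 1 ≠ 0 := sub_ne_zero.mpr hne
    apply hA1
    obtain ⟨e1, e2, e3⟩ := h3
    refine ⟨?_, ?_, ?_⟩
    · refine (mul_eq_zero.mp (?_ : A 0 1 * ((A 0 0 + A 1 1) ^ 2 - 1) = 0)).resolve_right hne'
      linear_combination e1 + A 0 1 * hdet
    · refine (mul_eq_zero.mp (?_ : A 1 0 * ((A 0 0 + A 1 1) ^ 2 - 1) = 0)).resolve_right hne'
      linear_combination e2 + A 1 0 * hdet
    · refine sub_eq_zero.mp ((mul_eq_zero.mp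
        (?_ : (A 0 0 - A 1 1) * ((A 0 0 + A 1 1) ^ 2 - 1) = 0)).resolve_right hne')
      linear_combination e3 + (A 0 0 - A 1 1) * hdet
  have hell : (mapGL ℝ A : GL (Fin 2) ℝ).IsElliptic := by
    have h1 : ((A 0 0 : ℝ) + (A 1 1 : ℝ)) ^ 2 = 1 := by exact_mod_cast htr
    have h3 : (A 0 0 : ℝ) * A 1 1 - A 0 1 * A 1 0 = 1 := by exact_mod_cast hdet
    change Matrix.discr _ < 0
    rw [Matrix.discr_fin_two, Matrix.trace_fin_two, Matrix.det_fin_two]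
    simp only [mapGL_apply_entry, h1, h3]
    norm_num
  have hfix := (UpperHalfPlane.gl_smul_eq_self_iff_eq_fixedPt (det_mapGL_pos A) hell).mpr rfl
  refine ⟨_, ?_, hfix⟩
  set q := UpperHalfPlane.fixedPt _ hell
  rw [toPSL_smul_boundary] at ha hb hc
  obtain ⟨k1, hk1, e1⟩ := tri_smul_pos (det_mapGL_pos A) a b c q
  obtain ⟨k2, hk2, e2⟩ := tri_smul_pos (det_mapGL_pos A) b c a q
  obtain ⟨k3, hk3, e3⟩ := tri_smul_pos (det_mapGL_pos A) c a b q
  rw [ha, hb, hc, hfix] at e1 e2 e3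
  rw [hV.mem_openTriangle]
  -- At the fixed point the three numbers are positive multiples of each other and their pairwise
  -- sums are positive, so all of them are positive.
  have hpos : 0 < tri a b c q := by
    by_contra hneg
    have h1 := tri_pos_of_nonpos hV.2.2.1 (not_lt.mp hneg)
    rw [e1] at h1
    have := pos_of_mul_pos_right h1 hk1.le
    exact hneg this
  rw [e2, e1]
  exact ⟨hpos, by positivity, by positivity⟩

/-! ### Rational boundary points -/

/-- The boundary points that are rational or infinite. -/
def IsRationalEnd (x : OnePoint ℝ) : Prop := ∃ g : PSL(2, ℤ), g • (OnePoint.infty : OnePoint ℝ) = x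

/-- The translation `z ↦ z + 1`. -/
def translation : PSL(2, ℤ) := toPSL ModularGroup.T

theorem translation_zpow (n : ℤ) : translation ^ n = toPSL (ModularGroup.T ^ n) := rfl

theorem translation_zpow_infty (n : ℤ) :
    translation ^ n • (OnePoint.infty : OnePoint ℝ) = OnePoint.infty := by
  rw [translation_zpow, toPSL_smul_boundary, OnePoint.smul_infty_eq_self_iff, mapGL_apply_entry,
    ModularGroup.coe_T_zpow]
  simp

theorem translation_zpow_coe (n : ℤ) (x : ℝ) :
    translation ^ n • (x : OnePoint ℝ) = ((x + n : ℝ) : OnePoint ℝ) := by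
  rw [translation_zpow, toPSL_smul_boundary, OnePoint.smul_some_eq_ite]
  simp only [mapGL_apply_entry, ModularGroup.coe_T_zpow]
  simp

theorem translation_zpow_upper (n : ℤ) (z : ℍ) :
    (translation ^ n • z).re = z.re + n ∧ (translation ^ n • z).im = z.im :=
  ⟨ModularGroup.re_T_zpow_smul z n, ModularGroup.im_T_zpow_smul z n⟩

theorem eq_translation_of_fixes_infty {g : PSL(2, ℤ)}
    (h : g • (OnePoint.infty : OnePoint ℝ) = OnePoint.infty) : ∃ n : ℤ, g = translation ^ n := by
  obtain ⟨A, rfl⟩ := exists_mk g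
  rw [toPSL_smul_boundary, OnePoint.smul_infty_eq_self_iff, mapGL_apply_entry] at h
  obtain ⟨n, hn⟩ := ModularGroup.exists_eq_T_zpow_of_c_eq_zero (by exact_mod_cast h)
  refine ⟨n, ?_⟩
  have key : ∀ z : ℍ, ((translation ^ n)⁻¹ * toPSL A) • z = z := by
    intro z
    rw [mul_smul, inv_smul_eq_iff]
    exact hn z
  rw [← inv_mul_eq_one, ← inv_inj, mul_inv_rev, inv_inv, inv_one]
  have hne : (⟨⟨0, 1⟩, one_pos⟩ : ℍ) ≠ ⟨⟨0, 2⟩, two_pos⟩ := by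
    intro h
    have := congrArg UpperHalfPlane.im h
    simp [UpperHalfPlane.im] at this
  exact eq_one_of_fixes_two_points hne (key _) (key _)

theorem isRationalEnd_of_rat (q : ℚ) : IsRationalEnd ((q : ℝ) : OnePoint ℝ) := by
  have : IsCusp ((q : ℝ) : OnePoint ℝ) 𝒮ℒ := by
    rw [isCusp_SL2Z_iff]
    exact ⟨(q : OnePoint ℚ), rfl⟩
  obtain ⟨A, hA⟩ := isCusp_SL2Z_iff'.mp this
  exact ⟨toPSL A, hA.symm⟩

/-! ### Ideal triangulations -/

/-- `a, b` are the ends of an edge of `T`. -/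
def IsEdge (T : Set (Set (OnePoint ℝ))) (a b : OnePoint ℝ) : Prop :=
  ∃ V ∈ T, ∃ c, HasVertices V a b c

/-- The triangles of `T` are locally finite at `z`. -/
def LocFin (T : Set (Set (OnePoint ℝ))) (z : ℍ) : Prop :=
  ∃ U ∈ 𝓝 z, {V ∈ T | (closedTriangle V ∩ U).Nonempty}.Finite

theorem HasVertices.boundarySideFun_ne_zero {V : Set (OnePoint ℝ)} {a b c : OnePoint ℝ}
    (h : HasVertices V a b c) : boundarySideFun a b c ≠ 0 := by
  rw [boundarySideFun_eq]
  exact mul_ne_zero (bracket_ne_zero h.2.2.1.symm) (bracket_ne_zero h.2.1.symm)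

theorem openTriangle_nonempty {V : Set (OnePoint ℝ)} (hV : V.ncard = 3) :
    (openTriangle V).Nonempty := by
  obtain ⟨ρ, hρ, h⟩ := exists_ball_subset
  obtain ⟨c, hc⟩ := h V hV
  exact ⟨c, hc (Metric.mem_ball_self hρ)⟩

/-- Near a point of a side the open triangle is a half plane, which accumulates at that point. This
upgrades the disjointness of open triangles: a closed triangle misses every other open one. -/
theorem inter_openTriangle_nonempty {V : Set (OnePoint ℝ)} (hV : V.ncard = 3) {U : Set ℍ} {z : ℍ}
    (hU : U ∈ 𝓝 z) (hz : z ∈ closedTriangle V) : (U ∩ openTriangle V).Nonempty := by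
  by_cases hz' : z ∈ openTriangle V
  · exact ⟨z, mem_of_mem_nhds hU, hz'⟩
  · obtain ⟨a, b, c, h, hl⟩ := mem_line_of_mem_closedTriangle hV hz hz'
    obtain ⟨w, h1, h2, h3⟩ := ((frequently_side hl h.boundarySideFun_ne_zero).and_eventually
      ((h.eventually_mem_openTriangle hl).and hU)).exists
    exact ⟨w, h3, h2 h1⟩

theorem IsEdge.symm {T : Set (Set (OnePoint ℝ))} {a b : OnePoint ℝ} (h : IsEdge T a b) :
    IsEdge T b a := by
  obtain ⟨V, hV, c, h⟩ := h
  exact ⟨V, hV, c, h.swap⟩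

theorem IsEdge.ne {T : Set (Set (OnePoint ℝ))} {a b : OnePoint ℝ} (h : IsEdge T a b) : a ≠ b := by
  obtain ⟨V, hV, c, h⟩ := h
  exact h.1

section Triangulation

variable {T : Set (Set (OnePoint ℝ))} (hT : IsIdealTriangulation T)
include hT

theorem eq_of_mem_openTriangle {V W : Set (OnePoint ℝ)} (hV : V ∈ T) (hW : W ∈ T) {z : ℍ}
    (hzV : z ∈ openTriangle V) (hzW : z ∈ openTriangle W) : V = W := by
  by_contra h
  exact Set.disjoint_left.mp (hT.disjoint hV hW h) hzV hzW

theorem isOpen_openTriangle {V : Set (OnePoint ℝ)} (hV : V ∈ T) : IsOpen (openTriangle V) := by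
  obtain ⟨a, b, c, h⟩ := exists_hasVertices (hT.three_vertices V hV)
  exact h.isOpen_openTriangle

theorem isClosed_closedTriangle {V : Set (OnePoint ℝ)} (hV : V ∈ T) :
    IsClosed (closedTriangle V) := by
  obtain ⟨a, b, c, h⟩ := exists_hasVertices (hT.three_vertices V hV)
  exact h.isClosed_closedTriangle

theorem eq_of_mem_closedTriangle {V W : Set (OnePoint ℝ)} (hV : V ∈ T) (hW : W ∈ T) {z : ℍ}
    (hzV : z ∈ closedTriangle V) (hzW : z ∈ openTriangle W) : V = W := by
  obtain ⟨w, h1, h2⟩ := inter_openTriangle_nonempty (hT.three_vertices V hV)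
    ((isOpen_openTriangle hT hW).mem_nhds hzW) hzV
  exact eq_of_mem_openTriangle hT hV hW h2 h1

theorem exists_mem_closedTriangle (z : ℍ) : ∃ V ∈ T, z ∈ closedTriangle V := by
  have : z ∈ ⋃ V ∈ T, closedTriangle V := by rw [hT.cover]; trivial
  simpa using this

theorem IsEdge.notMem_openTriangle {a b : OnePoint ℝ} (h : IsEdge T a b) {z : ℍ}
    (hz : z ∈ geodesicLine a b) {W : Set (OnePoint ℝ)} (hW : W ∈ T) : z ∉ openTriangle W := by
  obtain ⟨V, hV, c, h⟩ := h
  intro hzW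
  have := eq_of_mem_closedTriangle hT hV hW (h.line_subset_closedTriangle hz) hzW
  subst this
  exact h.notMem_openTriangle hz hzW

theorem mem_openTriangle_or_mem_edge (z : ℍ) :
    (∃ V ∈ T, z ∈ openTriangle V) ∨
      ∃ V ∈ T, ∃ a b c, HasVertices V a b c ∧ z ∈ geodesicLine a b := by
  obtain ⟨V, hV, hz⟩ := exists_mem_closedTriangle hT z
  by_cases h : z ∈ openTriangle V
  · exact Or.inl ⟨V, hV, h⟩
  · exact Or.inr ⟨V, hV, mem_line_of_mem_closedTriangle (hT.three_vertices V hV) hz h⟩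

omit hT in
/-- A line outside of the open triangles which meets an edge is that edge. -/
theorem IsEdge.eq_of_line {a b a' b' : OnePoint ℝ} (h : IsEdge T a b)
    (h' : ∀ W ∈ T, ∀ z ∈ geodesicLine a' b', z ∉ openTriangle W) {p : ℍ}
    (hp : p ∈ geodesicLine a b) (hp' : p ∈ geodesicLine a' b') :
    (a = a' ∧ b = b') ∨ (a = b' ∧ b = a') := by
  obtain ⟨V, hV, c, h⟩ := h
  by_contra hne
  obtain ⟨z, ⟨h1, h2⟩, h3⟩ := ((frequently_crossing hp hp' hne
    h.boundarySideFun_ne_zero).and_eventually (h.eventually_mem_openTriangle hp)).exists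
  exact h' V hV z h1 (h3 h2)

/-- Edges do not cross. -/
theorem IsEdge.eq_of_mem {a b a' b' : OnePoint ℝ} (h : IsEdge T a b) (h' : IsEdge T a' b') {p : ℍ}
    (hp : p ∈ geodesicLine a b) (hp' : p ∈ geodesicLine a' b') :
    (a = a' ∧ b = b') ∨ (a = b' ∧ b = a') :=
  h.eq_of_line (fun _ hW _ hz => h'.notMem_openTriangle hT hz hW) hp hp'

theorem IsEdge.line_eq_of_mem {a b a' b' : OnePoint ℝ} (h : IsEdge T a b) (h' : IsEdge T a' b')
    {p : ℍ} (hp : p ∈ geodesicLine a b) (hp' : p ∈ geodesicLine a' b') :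
    geodesicLine a b = geodesicLine a' b' := by
  rcases h.eq_of_mem hT h' hp hp' with ⟨rfl, rfl⟩ | ⟨rfl, rfl⟩
  · rfl
  · exact geodesicLine_comm _ _

/-- Near a point of the common edge both open triangles coincide with the same half plane, hence
they overlap. -/
theorem eq_of_same_side {V W : Set (OnePoint ℝ)} (hV : V ∈ T) (hW : W ∈ T) {a b c c' : OnePoint ℝ}
    (h : HasVertices V a b c) (h' : HasVertices W a b c')
    (hside : 0 < boundarySideFun a b c * boundarySideFun a b c') : V = W := by
  obtain ⟨p, hp, -⟩ := exists_two_points h.1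
  obtain ⟨z, h1, h2, h3⟩ := ((frequently_side hp h.boundarySideFun_ne_zero).and_eventually
    ((h.eventually_mem_openTriangle hp).and (h'.eventually_mem_openTriangle hp))).exists
  refine eq_of_mem_openTriangle hT hV hW (h2 h1) (h3 ?_)
  rw [tri]
  have h4 : 0 < (sideFun a b z * boundarySideFun a b c') * boundarySideFun a b c ^ 2 := by
    have := mul_pos h1 hside
    linarith
  exact pos_of_mul_pos_left h4 (sq_nonneg _)

theorem opposite_side {V W : Set (OnePoint ℝ)} (hV : V ∈ T) (hW : W ∈ T) (hVW : V ≠ W)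
    {a b c c' : OnePoint ℝ} (h : HasVertices V a b c) (h' : HasVertices W a b c') :
    boundarySideFun a b c * boundarySideFun a b c' < 0 := by
  rcases lt_trichotomy (boundarySideFun a b c * boundarySideFun a b c') 0 with h1 | h1 | h1
  · exact h1
  · exact absurd h1 (mul_ne_zero h.boundarySideFun_ne_zero h'.boundarySideFun_ne_zero)
  · exact absurd (eq_of_same_side hT hV hW h h' h1) hVW

/-- An edge belongs to at most two triangles. -/
theorem eq_or_eq_of_common_edge {V W X : Set (OnePoint ℝ)} (hV : V ∈ T) (hW : W ∈ T) (hX : X ∈ T)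
    {a b : OnePoint ℝ} (hab : a ≠ b) (haV : a ∈ V) (hbV : b ∈ V) (haW : a ∈ W) (hbW : b ∈ W)
    (haX : a ∈ X) (hbX : b ∈ X) (hVW : V ≠ W) : X = V ∨ X = W := by
  obtain ⟨c, h⟩ := exists_hasVertices_of_mem_mem (hT.three_vertices V hV) haV hbV hab
  obtain ⟨c', h'⟩ := exists_hasVertices_of_mem_mem (hT.three_vertices W hW) haW hbW hab
  obtain ⟨c'', h''⟩ := exists_hasVertices_of_mem_mem (hT.three_vertices X hX) haX hbX hab
  by_contra hne
  push Not at hne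
  have h1 := opposite_side hT hV hW hVW h h'
  have h2 := opposite_side hT hX hV hne.1 h'' h
  have h3 := opposite_side hT hX hW hne.2 h'' h'
  have h4 := mul_pos_of_neg_of_neg h2 h3
  have h5 : boundarySideFun a b c'' * boundarySideFun a b c *
      (boundarySideFun a b c'' * boundarySideFun a b c') = boundarySideFun a b c'' ^ 2 *
      (boundarySideFun a b c * boundarySideFun a b c') := by ring
  rw [h5] at h4
  exact absurd (pos_of_mul_pos_right h4 (sq_nonneg _)) (not_lt.mpr h1.le)

/-- Two adjacent triangles cover a neighbourhood of their common edge. -/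
theorem eventually_mem_of_adjacent {V W : Set (OnePoint ℝ)} (hV : V ∈ T) (hW : W ∈ T) (hVW : V ≠ W)
    {a b c : OnePoint ℝ} (h : HasVertices V a b c) (haW : a ∈ W) (hbW : b ∈ W) {p : ℍ}
    (hp : p ∈ geodesicLine a b) :
    ∀ᶠ z in 𝓝 p, z ∈ closedTriangle V ∨ z ∈ openTriangle W := by
  obtain ⟨c', h'⟩ := exists_hasVertices_of_mem_mem (hT.three_vertices W hW) haW hbW h.1
  have hs := opposite_side hT hV hW hVW h h'
  filter_upwards [h.eventually_mem_openTriangle hp, h'.eventually_mem_openTriangle hp] with z h1 h2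
  rcases lt_trichotomy (tri a b c z) 0 with h3 | h3 | h3
  · right
    apply h2
    have h4 := mul_pos_of_neg_of_neg h3 hs
    have h5 : tri a b c z * (boundarySideFun a b c * boundarySideFun a b c') =
      tri a b c' z * boundarySideFun a b c ^ 2 := by simp only [tri]; ring
    rw [h5] at h4
    exact pos_of_mul_pos_left h4 (sq_nonneg _)
  · left
    apply h.line_subset_closedTriangle
    exact (mul_eq_zero.mp h3).resolve_right h.boundarySideFun_ne_zero
  · left
    exact openTriangle_subset_closedTriangle V (h1 h3)

theorem locFin_of_mem_openTriangle {V : Set (OnePoint ℝ)} (hV : V ∈ T) {z : ℍ}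
    (hz : z ∈ openTriangle V) : LocFin T z := by
  refine ⟨_, (isOpen_openTriangle hT hV).mem_nhds hz, (Set.finite_singleton V).subset ?_⟩
  rintro W ⟨hW, w, h1, h2⟩
  exact eq_of_mem_closedTriangle hT hW hV h1 h2

/-- The two triangles fill a neighbourhood of the point. A further triangle that meets it would have
interior points there, and these already belong to the first two. -/
theorem locFin_of_adjacent {V W : Set (OnePoint ℝ)} (hV : V ∈ T) (hW : W ∈ T) (hVW : V ≠ W)
    {a b c : OnePoint ℝ} (h : HasVertices V a b c) (haW : a ∈ W) (hbW : b ∈ W) {p : ℍ}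
    (hp : p ∈ geodesicLine a b) : LocFin T p := by
  obtain ⟨U, hU, hUo, hpU⟩ := mem_nhds_iff.mp (eventually_mem_of_adjacent hT hV hW hVW h haW hbW hp)
  refine ⟨U, hUo.mem_nhds hpU, (Set.toFinite {V, W}).subset ?_⟩
  rintro X ⟨hX, w, h1, h2⟩
  obtain ⟨x, hx1, hx2⟩ := inter_openTriangle_nonempty (hT.three_vertices X hX)
    (hUo.mem_nhds h2) h1
  rcases hU hx1 with h3 | h3
  · left; exact (eq_of_mem_closedTriangle hT hV hX h3 hx2).symm
  · right; exact eq_of_mem_openTriangle hT hX hW hx2 h3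

/-- Approach `p` from the outer side of the edge. Only finitely many triangles are available near
`p`, so one of them is met arbitrarily close to `p` and contains `p` by closedness. There `p` lies
on one of its edges, and edges do not cross. Without local finiteness the triangles could shrink
towards the edge and leave it without a neighbour. -/
theorem exists_adjacent_of_locFin {V : Set (OnePoint ℝ)} (hV : V ∈ T)
    {a b c : OnePoint ℝ} (h : HasVertices V a b c) {p : ℍ}
    (hp : p ∈ geodesicLine a b) (hfin : LocFin T p) : ∃ W ∈ T, W ≠ V ∧ a ∈ W ∧ b ∈ W := by
  obtain ⟨U, hU, hfin⟩ := hfin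
  have hfr : ∃ᶠ z in 𝓝 p, tri a b c z < 0 := by
    refine (frequently_side hp (neg_ne_zero.mpr h.boundarySideFun_ne_zero)).mono fun z hz => ?_
    rw [tri]; linarith
  have hfr2 : ∃ᶠ z in 𝓝 p, ∃ W ∈ {V ∈ T | (closedTriangle V ∩ U).Nonempty},
      z ∈ closedTriangle W ∧ tri a b c z < 0 := by
    refine (hfr.and_eventually hU).mono fun z hz => ?_
    obtain ⟨W, hW, hzW⟩ := exists_mem_closedTriangle hT z
    exact ⟨W, ⟨hW, z, hzW, hz.2⟩, hzW, hz.1⟩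
  have hfr3 : ∃ W ∈ {V ∈ T | (closedTriangle V ∩ U).Nonempty},
      ∃ᶠ z in 𝓝 p, z ∈ closedTriangle W ∧ tri a b c z < 0 := by
    by_contra hcon
    push Not at hcon
    apply hfr2
    have := (Filter.eventually_all_finite hfin).mpr hcon
    filter_upwards [this] with z hz ⟨W, hW, h1⟩
    exact absurd h1.2 (not_lt.mpr (hz W hW h1.1))
  obtain ⟨W, ⟨hW, -⟩, hfr4⟩ := hfr3
  have hWV : W ≠ V := by
    rintro rfl
    obtain ⟨z, h1, h2⟩ := hfr4.exists
    exact absurd (h.mem_closedTriangle.mp h1).1 (not_le.mpr h2)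
  have hpW : p ∈ closedTriangle W :=
    (isClosed_closedTriangle hT hW).mem_of_frequently_of_tendsto
      (hfr4.mono fun z hz => hz.1) tendsto_id
  have hpW' : p ∉ openTriangle W := fun h' =>
    hWV (eq_of_mem_closedTriangle hT hV hW (h.line_subset_closedTriangle hp) h').symm
  obtain ⟨a', b', c', h', hp'⟩ := mem_line_of_mem_closedTriangle (hT.three_vertices W hW) hpW hpW'
  refine ⟨W, hW, hWV, ?_⟩
  have hm := h'.mem
  rcases IsEdge.eq_of_mem hT ⟨V, hV, c, h⟩ ⟨W, hW, c', h'⟩ hp hp' with ⟨rfl, rfl⟩ | ⟨rfl, rfl⟩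
  · exact ⟨hm.1, hm.2.1⟩
  · exact ⟨hm.2.1, hm.1⟩

/-- Local finiteness propagates along edges. -/
theorem locFin_of_locFin_edge {a b : OnePoint ℝ} (h : IsEdge T a b) {p p' : ℍ}
    (hp : p ∈ geodesicLine a b) (hp' : p' ∈ geodesicLine a b) (hfin : LocFin T p) :
    LocFin T p' := by
  obtain ⟨V, hV, c, h⟩ := h
  obtain ⟨W, hW, hWV, ha, hb⟩ := exists_adjacent_of_locFin hT hV h hp hfin
  exact locFin_of_adjacent hT hV hW hWV.symm h ha hb hp'

omit hT in
theorem isClosed_not_locFin : IsClosed {z | ¬LocFin T z} := by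
  rw [← isOpen_compl_iff, isOpen_iff_mem_nhds]
  intro z hz
  have hz' : LocFin T z := not_not.mp hz
  obtain ⟨U, hU, hfin⟩ := hz'
  filter_upwards [eventually_mem_nhds_iff.mpr hU] with w hw
  exact not_not.mpr ⟨U, hw, hfin⟩

/-- A set of triangles that is closed under adjacency contains all triangles. -/
theorem eq_of_closed_under_adjacency (hfin : ∀ z, LocFin T z) {S : Set (Set (OnePoint ℝ))}
    (hST : S ⊆ T) (hne : S.Nonempty)
    (hadj : ∀ V ∈ S, ∀ a b c, HasVertices V a b c → ∃ W ∈ S, V ≠ W ∧ a ∈ W ∧ b ∈ W) : S = T := by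
  -- The covered set is closed by local finiteness and open by closure under adjacency; `ℍ` is
  -- connected.
  have hclosed : IsClosed (⋃ V : S, closedTriangle V.1) := by
    refine LocallyFinite.isClosed_iUnion ?_ fun V => isClosed_closedTriangle hT (hST V.2)
    intro z
    obtain ⟨U, hU, hf⟩ := hfin z
    refine ⟨U, hU, ?_⟩
    refine Set.Finite.of_finite_image (hf.subset ?_) (Subtype.val_injective.injOn)
    rintro _ ⟨V, hV, rfl⟩
    exact ⟨hST V.2, hV⟩
  have hopen : IsOpen (⋃ V : S, closedTriangle V.1) := by
    rw [isOpen_iff_mem_nhds]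
    intro z hz
    obtain ⟨⟨V, hV⟩, hzV⟩ := Set.mem_iUnion.mp hz
    dsimp only at hzV
    by_cases hz' : z ∈ openTriangle V
    · filter_upwards [(isOpen_openTriangle hT (hST hV)).mem_nhds hz'] with w hw
      exact Set.mem_iUnion.mpr ⟨⟨V, hV⟩, openTriangle_subset_closedTriangle V hw⟩
    · obtain ⟨a, b, c, h, hl⟩ :=
        mem_line_of_mem_closedTriangle (hT.three_vertices V (hST hV)) hzV hz'
      obtain ⟨W, hW, hVW, ha, hb⟩ := hadj V hV a b c h
      filter_upwards [eventually_mem_of_adjacent hT (hST hV) (hST hW) hVW h ha hb hl] with w hw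
      rcases hw with hw | hw
      · exact Set.mem_iUnion.mpr ⟨⟨V, hV⟩, hw⟩
      · exact Set.mem_iUnion.mpr ⟨⟨W, hW⟩, openTriangle_subset_closedTriangle W hw⟩
  have huniv : (⋃ V : S, closedTriangle V.1) = Set.univ := by
    refine IsClopen.eq_univ ⟨hclosed, hopen⟩ ?_
    obtain ⟨V, hV⟩ := hne
    obtain ⟨z, hz⟩ := openTriangle_nonempty (hT.three_vertices V (hST hV))
    exact ⟨z, Set.mem_iUnion.mpr ⟨⟨V, hV⟩, openTriangle_subset_closedTriangle V hz⟩⟩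
  refine Set.Subset.antisymm hST fun X hX => ?_
  obtain ⟨z, hz⟩ := openTriangle_nonempty (hT.three_vertices X hX)
  have : z ∈ ⋃ V : S, closedTriangle V.1 := by rw [huniv]; trivial
  obtain ⟨⟨V, hV⟩, hzV⟩ := Set.mem_iUnion.mp this
  rw [← eq_of_mem_closedTriangle hT (hST hV) hX hzV hz]
  exact hV

/-- A connected set which avoids the edges lies in one open triangle. -/
theorem exists_subset_openTriangle {S : Set ℍ} (hS : IsPreconnected S) (hne : S.Nonempty)
    (h : ∀ a b, IsEdge T a b → Disjoint S (geodesicLine a b)) : ∃ V ∈ T, S ⊆ openTriangle V := by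
  have hmem : ∀ z ∈ S, ∃ V ∈ T, z ∈ openTriangle V := by
    intro z hz
    rcases mem_openTriangle_or_mem_edge hT z with h1 | ⟨V, hV, a, b, c, h1, h2⟩
    · exact h1
    · exact absurd h2 (Set.disjoint_left.mp (h a b ⟨V, hV, c, h1⟩) hz)
  obtain ⟨z, hz⟩ := hne
  obtain ⟨V, hV, hzV⟩ := hmem z hz
  refine ⟨V, hV, ?_⟩
  refine hS.subset_left_of_subset_union (v := ⋃ W ∈ T \ {V}, openTriangle W)
    (isOpen_openTriangle hT hV) (isOpen_biUnion fun W hW => isOpen_openTriangle hT hW.1) ?_ ?_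
    ⟨z, hz, hzV⟩
  · rw [Set.disjoint_left]
    intro w hw hw'
    simp only [Set.mem_iUnion] at hw'
    obtain ⟨W, hW, hwW⟩ := hw'
    exact hW.2 (eq_of_mem_openTriangle hT hW.1 hV hwW hw)
  · intro w hw
    obtain ⟨W, hW, hwW⟩ := hmem w hw
    by_cases hWV : W = V
    · left; rwa [← hWV]
    · right
      simp only [Set.mem_iUnion]
      exact ⟨W, ⟨hW, hWV⟩, hwW⟩

end Triangulation

/-! ### Groups of finite index -/

theorem exists_pow_mem (Φ : Subgroup PSL(2, ℤ)) (hfin : Φ.FiniteIndex) :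
    ∃ N : ℕ, 0 < N ∧ ∀ g : PSL(2, ℤ), g ^ N ∈ Φ :=
  ⟨Nat.factorial Φ.index, Nat.factorial_pos _, fun g =>
    Subgroup.pow_mem_of_index_ne_zero_of_dvd hfin.index_ne_zero g fun _ h1 h2 =>
      Nat.dvd_factorial h1 h2⟩

theorem exists_finite_reps (Φ : Subgroup PSL(2, ℤ)) (hfin : Φ.FiniteIndex) :
    ∃ S : Set PSL(2, ℤ), S.Finite ∧ ∀ γ, ∃ s ∈ S, ∃ φ ∈ Φ, γ = s * φ := by
  have : Finite (PSL(2, ℤ) ⧸ Φ) := Subgroup.finite_quotient_of_finiteIndex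
  refine ⟨Set.range (Quotient.out : PSL(2, ℤ) ⧸ Φ → PSL(2, ℤ)), Set.finite_range _, fun γ => ?_⟩
  refine ⟨_, ⟨(γ : PSL(2, ℤ) ⧸ Φ), rfl⟩, (Quotient.out (γ : PSL(2, ℤ) ⧸ Φ))⁻¹ * γ, ?_, by group⟩
  exact QuotientGroup.eq.mp (QuotientGroup.out_eq' _)

/-- The stabilizer of an ideal triangle consists of cyclic permutations of the vertices. -/
theorem HasVertices.stabilizer_cases {V : Set (OnePoint ℝ)} {a b c : OnePoint ℝ}
    (h : HasVertices V a b c) {g : PSL(2, ℤ)} (hg : g • V = V) :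
    g = 1 ∨ (g • a = b ∧ g • b = c ∧ g • c = a) ∨ (g • a = c ∧ g • b = a ∧ g • c = b) := by
  have hmem : ∀ x ∈ V, g • x ∈ V := fun x hx => by
    rw [← hg]; exact Set.smul_mem_smul_set hx
  obtain ⟨hab, hbc, hac, hVe⟩ := h
  have ha := hmem a (by simp [hVe])
  have hb := hmem b (by simp [hVe])
  have hc := hmem c (by simp [hVe])
  simp only [hVe, Set.mem_insert_iff, Set.mem_singleton_iff] at ha hb hc
  have iab : g • a ≠ g • b := fun h => hab (MulAction.injective g h)
  have ibc : g • b ≠ g • c := fun h => hbc (MulAction.injective g h)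
  have iac : g • a ≠ g • c := fun h => hac (MulAction.injective g h)
  obtain ⟨k, hk, ho⟩ := orient_psl_smul g a b c
  have hne := orient_ne_zero hab hbc hac
  -- Preservation of orientation excludes the three transpositions of the vertices.
  have hpos : 0 < orient (g • a) (g • b) (g • c) * orient a b c := by
    rw [ho, mul_assoc]; exact mul_pos hk (mul_self_pos.mpr hne)
  have hneg : ¬ 0 < -orient a b c * orient a b c := by nlinarith [sq_nonneg (orient a b c)]
  have e1 := orient_swap a b c
  have e2 : orient a c b = -orient a b c := by simp only [orient, bracket]; ring
  have e3 : orient c b a = -orient a b c := by simp only [orient, bracket]; ring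
  rcases ha with ha | ha | ha <;> rcases hb with hb | hb | hb
  · exact absurd (ha.trans hb.symm) iab
  · exact Or.inl (eq_one_of_fixes_three_ends hab hbc hac ha hb
      ((hc.resolve_left fun h => iac (ha.trans h.symm)).resolve_left fun h => ibc (hb.trans h.symm)))
  · rw [ha, hb, (hc.resolve_left fun h => iac (ha.trans h.symm)).resolve_right
      fun h => ibc (hb.trans h.symm), e2] at hpos
    exact absurd hpos hneg
  · rw [ha, hb, (hc.resolve_left fun h => ibc (hb.trans h.symm)).resolve_left
      fun h => iac (ha.trans h.symm), e1] at hpos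
    exact absurd hpos hneg
  · exact absurd (ha.trans hb.symm) iab
  · exact Or.inr (Or.inl ⟨ha, hb, hc.resolve_right fun h => h.elim (fun h => iac (ha.trans h.symm))
      fun h => ibc (hb.trans h.symm)⟩)
  · exact Or.inr (Or.inr ⟨ha, hb, (hc.resolve_left fun h => ibc (hb.trans h.symm)).resolve_right
      fun h => iac (ha.trans h.symm)⟩)
  · rw [ha, hb, hc.resolve_right fun h => h.elim (fun h => ibc (hb.trans h.symm))
      fun h => iac (ha.trans h.symm), e3] at hpos
    exact absurd hpos hneg
  · exact absurd (ha.trans hb.symm) iab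

/-- An element of the stabilizer of an ideal triangle has order `1` or `3`. -/
theorem pow_three_eq_one {V : Set (OnePoint ℝ)} (hV : V.ncard = 3) {g : PSL(2, ℤ)}
    (hg : g • V = V) : g ^ 3 = 1 := by
  obtain ⟨a, b, c, h⟩ := exists_hasVertices hV
  rcases h.stabilizer_cases hg with rfl | ⟨h1, h2, h3⟩ | ⟨h1, h2, h3⟩
  · simp
  · exact (rotation_of_cycle h h1 h2 h3).1
  · exact (rotation_of_cycle h.rotate.swap.rotate h2 h1 h3).1

theorem translation_zpow_ne_one {n : ℤ} (hn : n ≠ 0) : translation ^ n ≠ 1 := by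
  intro h
  have := translation_zpow_coe n 0
  rw [h, one_smul, OnePoint.coe_eq_coe] at this
  simp at this
  exact hn (by exact_mod_cast this.symm)

theorem translation_smul_ne {V : Set (OnePoint ℝ)} (hV : V.ncard = 3) {n : ℤ} (hn : n ≠ 0) :
    translation ^ n • V ≠ V := by
  intro h
  have := pow_three_eq_one hV h
  rw [← zpow_natCast, ← zpow_mul] at this
  exact translation_zpow_ne_one (by positivity) this

theorem IsInvariant.smul_mem {Φ : Subgroup PSL(2, ℤ)} {T : Set (Set (OnePoint ℝ))}
    (hinv : IsInvariant Φ T) {g : PSL(2, ℤ)} (hg : g ∈ Φ) {V : Set (OnePoint ℝ)} (hV : V ∈ T) :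
    g • V ∈ T := hinv g hg V hV

theorem smul_ball (g : PSL(2, ℤ)) (c : ℍ) (ρ : ℝ) :
    g • Metric.ball c ρ = Metric.ball (g • c) ρ := by
  ext z
  rw [Set.mem_smul_set_iff_inv_smul_mem, Metric.mem_ball, Metric.mem_ball,
    ← (isometry_psl_smul g).dist_eq, smul_inv_smul]

theorem smul_openTriangle (g : PSL(2, ℤ)) (V : Set (OnePoint ℝ)) :
    g • openTriangle V = openTriangle (g • V) := by
  ext z
  rw [Set.mem_smul_set_iff_inv_smul_mem, ← psl_smul_mem_openTriangle g, smul_inv_smul]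

theorem smul_closedTriangle (g : PSL(2, ℤ)) (V : Set (OnePoint ℝ)) :
    g • closedTriangle V = closedTriangle (g • V) := by
  ext z
  rw [Set.mem_smul_set_iff_inv_smul_mem, ← psl_smul_mem_closedTriangle g, smul_inv_smul]

theorem ball_subset_smul {g : PSL(2, ℤ)} {V : Set (OnePoint ℝ)} {c : ℍ} {ρ : ℝ}
    (h : Metric.ball c ρ ⊆ openTriangle V) : Metric.ball (g • c) ρ ⊆ openTriangle (g • V) := by
  rw [← smul_ball, ← smul_openTriangle]
  exact Set.smul_set_mono h

section Cofinite

variable {Φ : Subgroup PSL(2, ℤ)} {T : Set (Set (OnePoint ℝ))} (hT : IsIdealTriangulation T)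
  (hfin : Φ.FiniteIndex) (hinv : IsInvariant Φ T)
include hT hfin hinv

/-- Some power `translation ^ N` is conjugated into `Φ` by every `γ`. It moves the triangle, hence
moves the ball off its own centre, by a distance at least `ρ`. But at height `y` the translation by
`N` moves points by at most `N / y`, so `y ≤ N / ρ`. -/
theorem exists_im_le {ρ : ℝ} (hρ : 0 < ρ) : ∃ H : ℝ, ∀ V ∈ T, ∀ c : ℍ,
    Metric.ball c ρ ⊆ openTriangle V → ∀ γ : PSL(2, ℤ), (γ • c).im ≤ H := by
  obtain ⟨N, hN, hpow⟩ := exists_pow_mem Φ hfin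
  refine ⟨N / ρ, fun V hV c hc γ => ?_⟩
  have hp : γ⁻¹ * translation ^ (N : ℤ) * γ ∈ Φ := by
    have := hpow (γ⁻¹ * translation * γ)
    have h2 : (γ⁻¹ * translation * γ) ^ N = γ⁻¹ * translation ^ N * γ := by
      have := conj_pow (i := N) (a := γ⁻¹) (b := translation)
      simpa using this
    rw [zpow_natCast, ← h2]
    exact this
  set p := γ⁻¹ * translation ^ (N : ℤ) * γ with hpdef
  have hcard : (γ • V).ncard = 3 := by
    rw [Set.ncard_smul_set]; exact hT.three_vertices V hV
  have hne : p • V ≠ V := by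
    intro h
    apply translation_smul_ne hcard (n := N) (by positivity)
    rw [← mul_smul]
    rw [hpdef, mul_assoc, mul_smul, inv_smul_eq_iff] at h
    exact h
  have hd : ρ ≤ dist c (p • c) := by
    by_contra hlt
    push Not at hlt
    apply hne
    exact eq_of_mem_openTriangle hT (hinv.smul_mem hp hV) hV
      (ball_subset_smul hc (Metric.mem_ball.mpr hlt)) (hc (Metric.mem_ball_self hρ))
  have hd2 : dist c (p • c) = dist (γ • c) (translation ^ (N : ℤ) • γ • c) := by
    rw [← (isometry_psl_smul γ).dist_eq, hpdef, mul_assoc, mul_smul, smul_inv_smul, mul_smul]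
  have h3 := UpperHalfPlane.dist_le_dist_coe_div_sqrt (γ • c) (translation ^ (N : ℤ) • γ • c)
  obtain ⟨hre, him⟩ := translation_zpow_upper (N : ℤ) (γ • c)
  have h4 : dist ((γ • c : ℍ) : ℂ) ((translation ^ (N : ℤ) • γ • c : ℍ) : ℂ) = N := by
    rw [Complex.dist_eq]
    have : ((γ • c : ℍ) : ℂ) - ((translation ^ (N : ℤ) • γ • c : ℍ) : ℂ) = -(N : ℂ) := by
      apply Complex.ext
      · simp only [Complex.sub_re, UpperHalfPlane.coe_re, hre]; simp
      · simp only [Complex.sub_im, UpperHalfPlane.coe_im, him]; simp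
    rw [this]; simp
  rw [h4, him, Real.sqrt_mul_self (γ • c).im_pos.le] at h3
  rw [le_div_iff₀ hρ]
  have h5 := hd.trans (hd2.le.trans h3)
  rw [le_div_iff₀ (γ • c).im_pos] at h5
  linarith

/-- Up to the group, there are finitely many triangles. -/
theorem exists_finite_orbit_reps :
    ∃ F : Set (Set (OnePoint ℝ)), F.Finite ∧ F ⊆ T ∧ ∀ V ∈ T, ∃ φ ∈ Φ, φ • V ∈ F := by
  obtain ⟨ρ, hρ, hball⟩ := exists_ball_subset
  obtain ⟨H, hH⟩ := exists_im_le hT hfin hinv hρ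
  obtain ⟨S, hS, hrep⟩ := exists_finite_reps Φ hfin
  -- Finitely many copies of the truncated fundamental domain, one for each coset, suffice to move
  -- every centre into a compact set by elements of `Φ`.
  have hK : IsCompact (⋃ s ∈ S, s⁻¹ • ModularGroup.truncatedFundamentalDomain H) :=
    hS.isCompact_biUnion fun s _ =>
      (ModularGroup.isCompact_truncatedFundamentalDomain H).image (continuous_const_smul s⁻¹)
  set K := ⋃ s ∈ S, s⁻¹ • ModularGroup.truncatedFundamentalDomain H with hKdef
  refine ⟨{V ∈ T | ∃ c ∈ K, Metric.ball c ρ ⊆ openTriangle V}, ?_, fun V hV => hV.1, ?_⟩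
  · obtain ⟨t, -, htf, ht⟩ := hK.finite_cover_balls hρ
    -- Cover the compact set by finitely many balls of radius `ρ`. A triangle with a centre in one
    -- of them contains the middle point of that ball, which belongs to at most one open triangle.
    refine Set.Finite.subset (htf.biUnion (t := fun x => {V ∈ T | x ∈ openTriangle V})
      fun x _ => ?_) ?_
    · refine Set.Subsingleton.finite fun V hV W hW => ?_
      exact eq_of_mem_openTriangle hT hV.1 hW.1 hV.2 hW.2
    · rintro V ⟨hV, c, hc, hcV⟩
      obtain ⟨x, hx, hcx⟩ := Set.mem_iUnion₂.mp (ht hc)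
      refine Set.mem_iUnion₂.mpr ⟨x, hx, hV, hcV ?_⟩
      rw [Metric.mem_ball, dist_comm]; exact hcx
  · intro V hV
    obtain ⟨c, hc⟩ := hball V (hT.three_vertices V hV)
    obtain ⟨A, hA⟩ := ModularGroup.exists_smul_mem_fd c
    obtain ⟨s, hs, φ, hφ, h⟩ := hrep (toPSL A)
    refine ⟨φ, hφ, hinv.smul_mem hφ hV, φ • c, ?_, ball_subset_smul hc⟩
    refine Set.mem_iUnion₂.mpr ⟨s, hs, ?_⟩
    rw [Set.mem_inv_smul_set_iff, ← mul_smul, ← h]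
    exact ⟨hA, hH V hV c hc (toPSL A)⟩

end Cofinite

/-! ### The fan of triangles at a cusp -/

theorem HasVertices.exists_neg {V : Set (OnePoint ℝ)} {a b c : OnePoint ℝ}
    (h : HasVertices V a b c) : ∃ a b c, HasVertices V a b c ∧ boundarySideFun a b c < 0 := by
  have key : boundarySideFun a b c * boundarySideFun b c a * boundarySideFun c a b < 0 := by
    have : boundarySideFun a b c * boundarySideFun b c a * boundarySideFun c a b =
        -orient a b c ^ 2 := by
      simp only [boundarySideFun_eq, orient, bracket]; ring
    rw [this, neg_lt_zero]
    exact sq_pos_of_ne_zero (orient_ne_zero h.1 h.2.1 h.2.2.1)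
  by_contra! hcon
  exact absurd key (not_lt.mpr (mul_nonneg (mul_nonneg (hcon _ _ _ h) (hcon _ _ _ h.rotate))
    (hcon _ _ _ h.rotate.rotate)))

/-- A triangle with vertex `∞` is recorded by its representative in `F` and the vertex there to
which `∞` is moved. There are finitely many records, and two triangles with the same record differ
by an element fixing `∞`, that is, by a translation. -/
theorem exists_finite_cusp_reps {T F : Set (Set (OnePoint ℝ))} (hF : F.Finite)
    (hFc : ∀ W ∈ F, W.ncard = 3) (hFT : ∀ V ∈ T, ∃ g : PSL(2, ℤ), g • V ∈ F) :
    ∃ R ⊆ {V ∈ T | OnePoint.infty ∈ V}, R.Finite ∧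
      ∀ V ∈ T, OnePoint.infty ∈ V → ∃ W ∈ R, ∃ n : ℤ, V = translation ^ n • W := by
  choose! g hg using hFT
  set f : Set (OnePoint ℝ) → Set (OnePoint ℝ) × OnePoint ℝ :=
    fun V => (g V • V, g V • OnePoint.infty) with hf
  have hfin : (f '' {V ∈ T | OnePoint.infty ∈ V}).Finite := by
    refine Set.Finite.subset (hF.biUnion (t := fun W => {W} ×ˢ W) fun W hW =>
      (Set.finite_singleton W).prod (Set.finite_of_ncard_ne_zero (by rw [hFc W hW]; norm_num))) ?_
    rintro _ ⟨V, ⟨hV, hV'⟩, rfl⟩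
    exact Set.mem_iUnion₂.mpr ⟨g V • V, hg V hV, rfl, Set.smul_mem_smul_set hV'⟩
  obtain ⟨R, hR, hbij⟩ := Set.exists_subset_bijOn {V ∈ T | OnePoint.infty ∈ V} f
  refine ⟨R, hR, hbij.finite_iff_finite.mpr hfin, fun V hV hV' => ?_⟩
  obtain ⟨W, hW, hWV⟩ := hbij.surjOn ⟨V, ⟨hV, hV'⟩, rfl⟩
  have h1 : g W • W = g V • V := congrArg Prod.fst hWV
  have h2 : g W • (OnePoint.infty : OnePoint ℝ) = g V • OnePoint.infty := congrArg Prod.snd hWV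
  obtain ⟨n, hn⟩ := eq_translation_of_fixes_infty (g := (g V)⁻¹ * g W)
    (by rw [mul_smul, h2, inv_smul_smul])
  exact ⟨W, hW, n, by rw [← hn, mul_smul, h1, inv_smul_smul]⟩

/-- A triangle with three real vertices lies under the semicircle of its widest side. If it contains
a point of height above `N / 2`, this semicircle has diameter larger than `N`, so it crosses its
translate by `N`, although both are edges. -/
theorem infty_mem_of_high {T : Set (Set (OnePoint ℝ))} (hT : IsIdealTriangulation T) {N : ℕ}
    (hN : 0 < N) (htr : ∀ V ∈ T, translation ^ (N : ℤ) • V ∈ T) {z : ℍ} (hz : (N : ℝ) / 2 < z.im)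
    {V : Set (OnePoint ℝ)} (hV : V ∈ T) (hzV : z ∈ closedTriangle V) : OnePoint.infty ∈ V := by
  by_contra hinf
  obtain ⟨a, b, c, h⟩ := exists_hasVertices (hT.three_vertices V hV)
  obtain ⟨a, b, c, h, hneg⟩ := h.exists_neg
  have h1 := (h.mem_closedTriangle.mp hzV).1
  obtain ⟨x, rfl⟩ := OnePoint.ne_infty_iff_exists.mp fun h' => hinf (h' ▸ h.mem.1)
  obtain ⟨y, rfl⟩ := OnePoint.ne_infty_iff_exists.mp fun h' => hinf (h' ▸ h.mem.2.1)
  have h2 : sideFun (x : OnePoint ℝ) y z ≤ 0 := by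
    rw [tri] at h1
    by_contra hpos
    push Not at hpos
    exact absurd h1 (not_le.mpr (mul_neg_of_pos_of_neg hpos hneg))
  rw [sideFun_coe] at h2
  have h3 : (N : ℝ) ^ 2 < (y - x) ^ 2 := by
    have : z.im ^ 2 ≤ (y - x) ^ 2 / 4 := by nlinarith [sq_nonneg (z.re - x + (z.re - y))]
    have : ((N : ℝ) / 2) ^ 2 < z.im ^ 2 := by
      have : (0 : ℝ) < N := by exact_mod_cast hN
      gcongr
    nlinarith
  have hs : 0 < Real.sqrt (((y - x) ^ 2 - N ^ 2) / 4) := Real.sqrt_pos.mpr (by linarith)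
  -- The crossing point: its real part is the mean of the two centres, and its height follows from
  -- Pythagoras with the radius `|y - x| / 2` and horizontal distance `N / 2`.
  set w : ℍ := ⟨⟨(x + y + N) / 2, Real.sqrt (((y - x) ^ 2 - N ^ 2) / 4)⟩, hs⟩ with hw
  have hwre : w.re = (x + y + N) / 2 := rfl
  have hwim : w.im = Real.sqrt (((y - x) ^ 2 - N ^ 2) / 4) := rfl
  have hwim2 : w.im ^ 2 = ((y - x) ^ 2 - N ^ 2) / 4 := by
    rw [hwim, Real.sq_sqrt (by linarith)]
  have hw1 : w ∈ geodesicLine (x : OnePoint ℝ) y := by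
    change sideFun _ _ _ = 0
    rw [sideFun_coe, hwre, hwim2]; ring
  have hw2 : w ∈ geodesicLine ((x + N : ℝ) : OnePoint ℝ) ((y + N : ℝ) : OnePoint ℝ) := by
    change sideFun _ _ _ = 0
    rw [sideFun_coe, hwre, hwim2]; ring
  have hE := h.smul (translation ^ (N : ℤ))
  rw [translation_zpow_coe, translation_zpow_coe] at hE
  have hN' : (0 : ℝ) < N := by exact_mod_cast hN
  rcases IsEdge.eq_of_mem hT ⟨V, hV, c, h⟩ ⟨_, htr V hV, _, hE⟩ hw1 (by exact_mod_cast hw2) with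
    ⟨h4, h5⟩ | ⟨h4, h5⟩ <;> rw [OnePoint.coe_eq_coe] at h4 h5 <;> push_cast at h4 h5 <;> linarith

theorem abs_re_sub_le {z : ℍ} {n : ℤ} {W : Set (OnePoint ℝ)} {r s : ℝ}
    (h : HasVertices W OnePoint.infty r s) (hz : z ∈ closedTriangle (translation ^ n • W)) :
    |z.re - (r + n)| ≤ |r - s| := by
  have h1 := (h.smul (translation ^ n)).mem_closedTriangle.mp hz
  rw [translation_zpow_infty, translation_zpow_coe, translation_zpow_coe] at h1
  obtain ⟨h1, -, h3⟩ := h1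
  rw [tri, sideFun_infty] at h1
  rw [tri, sideFun_comm, sideFun_infty] at h3
  simp only [boundarySideFun, num_coe, den_coe, num_infty, den_infty] at h1 h3
  have hrs : r ≠ s := fun h' => h.2.1 (by rw [h'])
  rcases lt_or_gt_of_ne hrs with h4 | h4
  · have i1 : 0 ≤ (z.re - (r + n)) * (s - r) := by linarith
    have i2 : 0 ≤ (s + n - z.re) * (s - r) := by linarith
    have j1 := nonneg_of_mul_nonneg_left i1 (by linarith)
    have j2 := nonneg_of_mul_nonneg_left i2 (by linarith)
    rw [abs_of_nonneg j1, abs_of_nonpos (by linarith)]; linarith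
  · have i1 : 0 ≤ -(z.re - (r + n)) * (r - s) := by linarith
    have i2 : 0 ≤ (z.re - (s + n)) * (r - s) := by linarith
    have j1 := nonneg_of_mul_nonneg_left i1 (by linarith)
    have j2 := nonneg_of_mul_nonneg_left i2 (by linarith)
    rw [abs_of_nonpos (by linarith), abs_of_nonneg (by linarith)]; linarith

/-- Near `z` all triangles have the vertex `∞`. They fall into finitely many classes under
translations, and in each class the vertical strips of bounded width meet a given neighbourhood for
finitely many translates only. -/
theorem locFin_of_high {T F : Set (Set (OnePoint ℝ))} (hT : IsIdealTriangulation T)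
    (hF : F.Finite) (hFc : ∀ W ∈ F, W.ncard = 3) (hFT : ∀ V ∈ T, ∃ g : PSL(2, ℤ), g • V ∈ F)
    {N : ℕ} (hN : 0 < N) (htr : ∀ V ∈ T, translation ^ (N : ℤ) • V ∈ T) {z : ℍ}
    (hz : (N : ℝ) / 2 < z.im) : LocFin T z := by
  obtain ⟨R, hR, hRf, hrep⟩ := exists_finite_cusp_reps hF hFc hFT
  refine ⟨{w | (N : ℝ) / 2 < w.im ∧ |w.re - z.re| < 1}, ?_, ?_⟩
  · refine IsOpen.mem_nhds ((isOpen_lt continuous_const UpperHalfPlane.continuous_im).inter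
      (isOpen_lt (UpperHalfPlane.continuous_re.sub continuous_const).abs continuous_const)) ⟨hz, ?_⟩
    simp
  · have hB : ∀ W ∈ R, ∃ B : ℕ, ∀ n : ℤ, ∀ w : ℍ, |w.re - z.re| < 1 →
        w ∈ closedTriangle (translation ^ n • W) → n ∈ Set.Icc (-(B : ℤ)) B := by
      intro W hW
      obtain ⟨a, b, h⟩ := exists_hasVertices_of_mem (hT.three_vertices W (hR hW).1) (hR hW).2
      obtain ⟨r, rfl⟩ := OnePoint.ne_infty_iff_exists.mp h.1.symm
      obtain ⟨s, rfl⟩ := OnePoint.ne_infty_iff_exists.mp h.2.2.1.symm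
      obtain ⟨B, hB⟩ := exists_nat_ge (|z.re| + 1 + |r - s| + |r|)
      refine ⟨B, fun n w hw hwW => ?_⟩
      have h1 := abs_re_sub_le h hwW
      have h2 : |(n : ℝ)| ≤ B := by
        have e : (n : ℝ) = z.re + (w.re - z.re) + -(w.re - (r + n)) + -r := by ring
        rw [e]
        refine (abs_add_le _ _).trans ?_
        have i1 := abs_add_le (z.re + (w.re - z.re)) (-(w.re - (r + n)))
        have i2 := abs_add_le z.re (w.re - z.re)
        rw [abs_neg] at i1 ⊢
        linarith
      rw [abs_le] at h2
      exact ⟨by exact_mod_cast h2.1, by exact_mod_cast h2.2⟩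
    choose! B hB using hB
    refine (hRf.biUnion (t := fun W => (fun n : ℤ => translation ^ n • W) ''
      Set.Icc (-(B W : ℤ)) (B W)) fun W _ => (Set.finite_Icc _ _).image _).subset ?_
    rintro V ⟨hV, w, hwV, hw1, hw2⟩
    obtain ⟨W, hW, n, rfl⟩ := hrep V hV (infty_mem_of_high hT hN htr hw1 hV hwV)
    exact Set.mem_iUnion₂.mpr ⟨W, hW, n, hB W hW n w hw2 hwV, rfl⟩

theorem IsIdealTriangulation.smul {T : Set (Set (OnePoint ℝ))} (hT : IsIdealTriangulation T)
    (γ : PSL(2, ℤ)) : IsIdealTriangulation (γ • T) where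
  infinite := hT.infinite.smul_set
  three_vertices := by
    rintro _ ⟨V, hV, rfl⟩
    exact (Set.ncard_smul_set γ V).trans (hT.three_vertices V hV)
  cover := by
    refine Set.eq_univ_of_forall fun z => ?_
    obtain ⟨V, hV, hz⟩ := exists_mem_closedTriangle hT (γ⁻¹ • z)
    refine Set.mem_iUnion₂.mpr ⟨γ • V, Set.smul_mem_smul_set hV, ?_⟩
    rwa [← smul_closedTriangle, Set.mem_smul_set_iff_inv_smul_mem]
  disjoint := by
    rintro _ ⟨V, hV, rfl⟩ _ ⟨W, hW, rfl⟩ hne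
    change Disjoint (openTriangle (γ • V)) (openTriangle (γ • W))
    rw [← smul_openTriangle, ← smul_openTriangle, Set.disjoint_smul_set]
    exact hT.disjoint hV hW fun h => hne (by rw [h])

theorem LocFin.of_smul {T : Set (Set (OnePoint ℝ))} {γ : PSL(2, ℤ)} {z : ℍ}
    (h : LocFin (γ • T) (γ • z)) : LocFin T z := by
  obtain ⟨U, hU, hf⟩ := h
  refine ⟨γ⁻¹ • U, ?_, ?_⟩
  · rw [← Set.preimage_smul]
    exact (continuous_const_smul γ).continuousAt.preimage_mem_nhds hU
  · refine Set.Finite.of_finite_image (hf.subset ?_) (MulAction.injective γ).injOn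
    rintro _ ⟨V, ⟨hV, w, hwV, hwU⟩, rfl⟩
    refine ⟨Set.smul_mem_smul_set hV, γ • w, ?_, Set.mem_inv_smul_set_iff.mp hwU⟩
    exact (psl_smul_mem_closedTriangle γ).mpr hwV

theorem LocFin.smul {Φ : Subgroup PSL(2, ℤ)} {T : Set (Set (OnePoint ℝ))} (hinv : IsInvariant Φ T)
    {g : PSL(2, ℤ)} (hg : g ∈ Φ) {z : ℍ} (h : LocFin T z) : LocFin T (g • z) := by
  have : g⁻¹ • T = T := by
    refine Set.Subset.antisymm ?_ fun V hV => ?_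
    · rintro _ ⟨V, hV, rfl⟩
      exact hinv.smul_mem (inv_mem hg) hV
    · rw [Set.mem_inv_smul_set_iff]
      exact hinv.smul_mem hg hV
  refine LocFin.of_smul (γ := g⁻¹) ?_
  rwa [this, inv_smul_smul]

section Cofinite

variable {Φ : Subgroup PSL(2, ℤ)} {T : Set (Set (OnePoint ℝ))} (hT : IsIdealTriangulation T)
  (hfin : Φ.FiniteIndex) (hinv : IsInvariant Φ T)
include hT hfin hinv

/-- High up in a cusp, the triangulation is a locally finite fan. -/
theorem exists_fan (γ : PSL(2, ℤ)) : ∃ Y : ℝ, ∀ z : ℍ, Y < (γ • z).im → LocFin T z ∧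
    ∀ V ∈ T, z ∈ closedTriangle V → γ⁻¹ • OnePoint.infty ∈ V := by
  obtain ⟨N, hN, hpow⟩ := exists_pow_mem Φ hfin
  obtain ⟨F, hF, hFT, hrep⟩ := exists_finite_orbit_reps hT hfin hinv
  have htr : ∀ V ∈ γ • T, translation ^ (N : ℤ) • V ∈ γ • T := by
    rintro _ ⟨V, hV, rfl⟩
    have hp : γ⁻¹ * translation ^ (N : ℤ) * γ ∈ Φ := by
      have := hpow (γ⁻¹ * translation * γ)
      have h2 : (γ⁻¹ * translation * γ) ^ N = γ⁻¹ * translation ^ N * γ := by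
        have := conj_pow (i := N) (a := γ⁻¹) (b := translation)
        simpa using this
      rw [zpow_natCast, ← h2]
      exact this
    refine ⟨_, hinv.smul_mem hp hV, ?_⟩
    simp only [← mul_smul]
    congr 1
    group
  have hrep' : ∀ V ∈ γ • T, ∃ g : PSL(2, ℤ), g • V ∈ F := by
    rintro _ ⟨V, hV, rfl⟩
    obtain ⟨φ, -, h⟩ := hrep V hV
    exact ⟨φ * γ⁻¹, by simpa [mul_smul] using h⟩
  refine ⟨N / 2, fun z hz => ⟨?_, fun V hV hzV => ?_⟩⟩
  · exact (locFin_of_high (hT.smul γ) hF (fun W hW => hT.three_vertices W (hFT hW)) hrep' hN htr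
      hz).of_smul
  · rw [← Set.mem_smul_set_iff_inv_smul_mem]
    exact infty_mem_of_high (hT.smul γ) hN htr hz (Set.smul_mem_smul_set hV)
      ((psl_smul_mem_closedTriangle γ).mpr hzV)

end Cofinite

/-! ### Recurrence of lines with an irrational end -/

theorem exists_irrational {x : OnePoint ℝ} (hx : ¬IsRationalEnd x) :
    ∃ ξ : ℝ, x = ξ ∧ Irrational ξ := by
  obtain ⟨ξ, rfl⟩ := OnePoint.ne_infty_iff_exists.mp
    (fun h : x = OnePoint.infty => hx ⟨1, by rw [one_smul, h]⟩)
  refine ⟨ξ, rfl, ?_⟩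
  rintro ⟨q, rfl⟩
  exact hx (isRationalEnd_of_rat q)

/-- A vertical line attains every height, and a semicircle of diameter at least `δ` attains the
height `δ / 2`. -/
theorem exists_mem_line_im {u δ : ℝ} (hδ : 0 < δ) {y : OnePoint ℝ}
    (hy : y = OnePoint.infty ∨ ∃ v : ℝ, y = v ∧ δ ≤ |u - v|) :
    ∃ z ∈ geodesicLine (u : OnePoint ℝ) y, z.im = δ / 2 := by
  rcases hy with rfl | ⟨v, rfl, hv⟩
  · refine ⟨⟨⟨u, δ / 2⟩, half_pos hδ⟩, ?_, rfl⟩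
    rw [geodesicLine_comm, mem_line_infty_coe]
    rfl
  · have h1 : δ ^ 2 ≤ (u - v) ^ 2 := by
      rw [← sq_abs (u - v)]; gcongr
    refine ⟨⟨⟨(u + v) / 2 + Real.sqrt ((u - v) ^ 2 - δ ^ 2) / 2, δ / 2⟩, half_pos hδ⟩, ?_, rfl⟩
    change sideFun _ _ _ = 0
    rw [sideFun_coe]
    change ((u + v) / 2 + Real.sqrt ((u - v) ^ 2 - δ ^ 2) / 2 - u) *
      ((u + v) / 2 + Real.sqrt ((u - v) ^ 2 - δ ^ 2) / 2 - v) + (δ / 2) ^ 2 = 0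
    have h2 := Real.sq_sqrt (sub_nonneg.mpr h1)
    linear_combination h2 / 4

/-- If `q` approximates `ξ` well, the element that moves `q` to `∞` opens the line from `ξ` to `y`
to a definite Euclidean size. For real `y = η` the images differ by `|ξ - η| / (|c ξ + d| |c η +
d|)` with bottom row `(c, d)`, and `|c ξ + d| c < 1` is exactly the quality of the approximation. -/
theorem exists_smul_far {ξ : ℝ} (hξ : Irrational ξ) {y : OnePoint ℝ} (hy : (ξ : OnePoint ℝ) ≠ y) :
    ∃ δ > 0, ∀ q : ℚ, |ξ - q| < 1 / (q.den : ℝ) ^ 2 → ∃ γ : PSL(2, ℤ),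
      γ • ((q : ℝ) : OnePoint ℝ) = OnePoint.infty ∧ ∃ u : ℝ, γ • (ξ : OnePoint ℝ) = u ∧
      (γ • y = OnePoint.infty ∨ ∃ v : ℝ, γ • y = v ∧ δ ≤ |u - v|) := by
  -- Bottom row `(q.den, -q.num)`: the denominator of the transformation vanishes at `q`.
  have key : ∀ q : ℚ, ∃ A : SL(2, ℤ), A 1 0 = q.den ∧ A 1 1 = -q.num := by
    intro q
    have hc : IsCoprime (q.den : ℤ) (-q.num) := by
      rw [IsCoprime.neg_right_iff, Int.isCoprime_iff_gcd_eq_one, Int.gcd_comm]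
      exact q.reduced
    obtain ⟨A, -, hA⟩ := ModularGroup.bottom_row_surj (R := ℤ)
      (show ![(q.den : ℤ), -q.num] ∈ {cd : Fin 2 → ℤ | IsCoprime (cd 0) (cd 1)} from hc)
    exact ⟨A, congrFun hA 0, congrFun hA 1⟩
  have hsmul : ∀ (A : SL(2, ℤ)) (t : ℝ), (A 1 0 : ℝ) * t + A 1 1 ≠ 0 → toPSL A • (t : OnePoint ℝ) =
      (((A 0 0 * t + A 0 1) / (A 1 0 * t + A 1 1) : ℝ) : OnePoint ℝ) := by
    intro A t ht
    rw [toPSL_smul_boundary, OnePoint.smul_some_eq_ite]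
    simp only [mapGL_apply_entry]
    rw [if_neg ht]
  have hsmul0 : ∀ (A : SL(2, ℤ)) (t : ℝ), (A 1 0 : ℝ) * t + A 1 1 = 0 →
      toPSL A • (t : OnePoint ℝ) = OnePoint.infty := by
    intro A t ht
    rw [toPSL_smul_boundary, OnePoint.smul_some_eq_ite]
    simp only [mapGL_apply_entry]
    rw [if_pos ht]
  have hden : ∀ q : ℚ, (0 : ℝ) < q.den := fun q => by exact_mod_cast q.den_pos
  have hdet : ∀ A : SL(2, ℤ), (A 0 0 : ℝ) * A 1 1 - A 0 1 * A 1 0 = 1 := by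
    intro A
    have := A.det_coe
    rw [Matrix.det_fin_two] at this
    exact_mod_cast this
  have hq0 : ∀ q : ℚ, (q.den : ℝ) * ξ + -q.num ≠ 0 := by
    intro q h
    refine hξ ⟨q, ?_⟩
    rw [Rat.cast_def, div_eq_iff (hden q).ne']
    linarith
  have hqe : ∀ q : ℚ, (q.num : ℝ) = q * q.den := fun q => by
    exact_mod_cast (Rat.mul_den_eq_num q).symm
  have hsmall : ∀ q : ℚ, |ξ - q| < 1 / (q.den : ℝ) ^ 2 → |(q.den : ℝ) * ξ + -q.num| * q.den < 1 := by
    intro q h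
    rw [lt_div_iff₀ (by have := hden q; positivity)] at h
    have : (q.den : ℝ) * ξ + -q.num = q.den * (ξ - q) := by rw [hqe]; ring
    rw [this, abs_mul, abs_of_pos (hden q)]
    linarith
  induction y using OnePoint.rec with
  | infty =>
    refine ⟨1, one_pos, fun q hq => ?_⟩
    obtain ⟨A, h0, h1⟩ := key q
    have e0 : (A 1 0 : ℝ) = q.den := by rw [h0]; simp
    have e1 : (A 1 1 : ℝ) = -q.num := by rw [h1]; simp
    have hd := hden q
    refine ⟨toPSL A, hsmul0 A q ?_, _, hsmul A ξ ?_, Or.inr ⟨A 0 0 / A 1 0, ?_, ?_⟩⟩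
    · rw [e0, e1, hqe]; ring
    · rw [e0, e1]; exact hq0 q
    · rw [toPSL_smul_boundary, OnePoint.smul_infty_eq_ite]
      simp only [mapGL_apply_entry]
      rw [if_neg]
      rw [e0]; exact hd.ne'
    · have hne := hq0 q
      have hs := hsmall q hq
      have hD := hdet A
      have : ((A 0 0 : ℝ) * ξ + A 0 1) / (A 1 0 * ξ + A 1 1) - A 0 0 / A 1 0 =
          -1 / ((A 1 0 * ξ + A 1 1) * A 1 0) := by
        rw [e0, e1] at hD ⊢
        rw [div_sub_div _ _ hne hd.ne']
        congr 1
        linear_combination -hD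
      rw [this, abs_div, abs_neg, abs_one, le_div_iff₀, one_mul, abs_mul, e0, e1, abs_of_pos hd]
      · exact hs.le
      · rw [e0, e1]; exact abs_pos.mpr (mul_ne_zero hne hd.ne')
  | coe η =>
    have hne : ξ ≠ η := fun h => hy (by rw [h])
    have hpos : 0 < |ξ - η| := abs_pos.mpr (sub_ne_zero.mpr hne)
    -- The triangle inequality bounds `|c η + d|` by `c |ξ - η| + |c ξ + d|`, so the product of both
    -- denominators is at most `|ξ - η| + 1`.
    refine ⟨|ξ - η| / (|ξ - η| + 1), by positivity, fun q hq => ?_⟩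
    obtain ⟨A, h0, h1⟩ := key q
    have e0 : (A 1 0 : ℝ) = q.den := by rw [h0]; simp
    have e1 : (A 1 1 : ℝ) = -q.num := by rw [h1]; simp
    have hd := hden q
    have hne := hq0 q
    refine ⟨toPSL A, hsmul0 A q ?_, _, hsmul A ξ ?_, ?_⟩
    · rw [e0, e1, hqe]; ring
    · rw [e0, e1]; exact hq0 q
    · by_cases hη : (A 1 0 : ℝ) * η + A 1 1 = 0
      · exact Or.inl (hsmul0 A η hη)
      · refine Or.inr ⟨_, hsmul A η hη, ?_⟩
        have hD := hdet A
        have hs := hsmall q hq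
        have : ((A 0 0 : ℝ) * ξ + A 0 1) / (A 1 0 * ξ + A 1 1) -
            (A 0 0 * η + A 0 1) / (A 1 0 * η + A 1 1) =
            (ξ - η) / ((A 1 0 * ξ + A 1 1) * (A 1 0 * η + A 1 1)) := by
          rw [e0, e1] at hD hη ⊢
          rw [div_sub_div _ _ hne hη]
          congr 1
          linear_combination (ξ - η) * hD
        rw [this, abs_div]
        have h2 : |((A 1 0 : ℝ) * ξ + A 1 1) * (A 1 0 * η + A 1 1)| ≤ |ξ - η| + 1 := by
          rw [e0, e1, abs_mul]
          have h3 : |(q.den : ℝ) * η + -q.num| ≤ q.den * |ξ - η| + |(q.den : ℝ) * ξ + -q.num| := by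
            have : (q.den : ℝ) * η + -q.num = -(q.den * (ξ - η)) + (q.den * ξ + -q.num) := by ring
            rw [this]
            refine (abs_add_le _ _).trans ?_
            rw [abs_neg, abs_mul, abs_of_pos hd]
          have hd1 : (1 : ℝ) ≤ q.den := by exact_mod_cast q.den_pos
          have h4 : |(q.den : ℝ) * ξ + -q.num| ≤ 1 := by
            have := abs_nonneg ((q.den : ℝ) * ξ + -q.num)
            nlinarith
          calc _ ≤ |(q.den : ℝ) * ξ + -q.num| * (q.den * |ξ - η| + |(q.den : ℝ) * ξ + -q.num|) := by
                gcongr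
            _ = |(q.den : ℝ) * ξ + -q.num| * q.den * |ξ - η| +
                |(q.den : ℝ) * ξ + -q.num| * |(q.den : ℝ) * ξ + -q.num| := by ring
            _ ≤ 1 * |ξ - η| + 1 * 1 := by gcongr
            _ = _ := by ring
        have h5 : 0 < |((A 1 0 : ℝ) * ξ + A 1 1) * (A 1 0 * η + A 1 1)| := by
          refine abs_pos.mpr (mul_ne_zero ?_ hη)
          rw [e0, e1]; exact hne
        gcongr

/-- A line with an irrational end returns to a compact set in the quotient infinitely often. -/
theorem exists_recurrence (Φ : Subgroup PSL(2, ℤ)) (hfin : Φ.FiniteIndex) {x y : OnePoint ℝ}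
    (hx : ¬IsRationalEnd x) (hxy : x ≠ y) : ∃ K : Set ℍ, IsCompact K ∧
      {φ | φ ∈ Φ ∧ (geodesicLine (φ • x) (φ • y) ∩ K).Nonempty}.Infinite := by
  obtain ⟨ξ, rfl, hξ⟩ := exists_irrational hx
  obtain ⟨δ, hδ, hfar⟩ := exists_smul_far hξ hxy
  obtain ⟨S, hS, hrep⟩ := exists_finite_reps Φ hfin
  set K₀ : Set ℍ := (fun t : ℝ => (⟨⟨t, δ / 2⟩, half_pos hδ⟩ : ℍ)) '' Set.Icc 0 1 with hK₀
  have hK₀c : IsCompact K₀ := by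
    refine isCompact_Icc.image ?_
    rw [UpperHalfPlane.isEmbedding_coe.continuous_iff]
    have : (UpperHalfPlane.coe ∘ fun t : ℝ => (⟨⟨t, δ / 2⟩, half_pos hδ⟩ : ℍ)) =
        fun t : ℝ => (t : ℂ) + (δ / 2 : ℝ) * Complex.I := by
      ext t
      apply Complex.ext <;> simp
    rw [this]
    fun_prop
  have hret : ∀ q : ℚ, |ξ - q| < 1 / (q.den : ℝ) ^ 2 → ∃ s ∈ S, ∃ φ ∈ Φ,
      (s * φ) • ((q : ℝ) : OnePoint ℝ) = OnePoint.infty ∧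
      (geodesicLine (φ • (ξ : OnePoint ℝ)) (φ • y) ∩ s⁻¹ • K₀).Nonempty := by
    intro q hq
    obtain ⟨γ, hγ, u, hu, hv⟩ := hfar q hq
    obtain ⟨z, hz, him⟩ := exists_mem_line_im hδ hv
    rw [← hu] at hz
    -- The integer translation brings the point of height `δ / 2` into the compact segment over `[0,
    -- 1]`.
    obtain ⟨s, hs, φ, hφ, h⟩ := hrep (translation ^ (-⌊z.re⌋) * γ)
    refine ⟨s, hs, φ, hφ, ?_, s⁻¹ • translation ^ (-⌊z.re⌋) • z, ?_, Set.smul_mem_smul_set ?_⟩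
    · rw [← h, mul_smul, hγ, translation_zpow_infty]
    · rw [← psl_smul_mem_geodesicLine s, smul_inv_smul, ← mul_smul, ← mul_smul, ← h, mul_smul,
        mul_smul, psl_smul_mem_geodesicLine]
      exact hz
    · obtain ⟨h1, h2⟩ := translation_zpow_upper (-⌊z.re⌋) z
      refine ⟨Int.fract z.re, ⟨Int.fract_nonneg _, (Int.fract_lt_one _).le⟩, ?_⟩
      apply UpperHalfPlane.ext
      apply Complex.ext
      · change Int.fract z.re = (translation ^ (-⌊z.re⌋) • z).re
        rw [h1, Int.fract]; push_cast; ring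
      · change δ / 2 = (translation ^ (-⌊z.re⌋) • z).im
        rw [h2, him]
  choose! s hs φ hφ hinf hmeet using hret
  refine ⟨⋃ s ∈ S, s⁻¹ • K₀, hS.isCompact_biUnion fun s _ =>
    hK₀c.image (continuous_const_smul s⁻¹), fun hf => ?_⟩
  -- There are infinitely many good approximations, but `q` is recovered from `s` and `φ` as the
  -- preimage of `∞`, so finitely many `φ` would give finitely many `q`.
  refine Real.infinite_rat_abs_sub_lt_one_div_den_sq_of_irrational hξ ?_
  have hf2 := (hS.prod hf).image fun p : PSL(2, ℤ) × PSL(2, ℤ) =>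
    (p.1 * p.2)⁻¹ • (OnePoint.infty : OnePoint ℝ)
  refine Set.Finite.of_finite_image (f := fun q : ℚ => ((q : ℝ) : OnePoint ℝ)) (hf2.subset ?_) ?_
  · rintro _ ⟨q, hq, rfl⟩
    refine ⟨(s q, φ q), ⟨hs q hq, hφ q hq, (hmeet q hq).mono ?_⟩, ?_⟩
    · exact Set.inter_subset_inter_right _ (Set.subset_biUnion_of_mem (u := fun s => s⁻¹ • K₀) (hs q hq))
    · simp only
      rw [inv_smul_eq_iff, hinf q hq]
  · intro q _ q' _ h
    exact_mod_cast OnePoint.coe_injective h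

/-! ### Local finiteness -/

theorem exists_high_on_line {γ : PSL(2, ℤ)} {a b : OnePoint ℝ} (hab : a ≠ b)
    (ha : γ • a = OnePoint.infty) (Y : ℝ) : ∃ z ∈ geodesicLine a b, Y < (γ • z).im := by
  obtain ⟨x, hx⟩ := OnePoint.ne_infty_iff_exists.mp
    (fun h : γ • b = OnePoint.infty => hab (MulAction.injective γ (ha.trans h.symm)))
  refine ⟨γ⁻¹ • ⟨⟨x, max Y 0 + 1⟩, by positivity⟩, ?_, ?_⟩
  · rw [← psl_smul_mem_geodesicLine γ, smul_inv_smul, ha, ← hx, mem_line_infty_coe]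
    rfl
  · rw [smul_inv_smul]
    exact lt_of_le_of_lt (le_max_left Y 0) (lt_add_one _)

theorem IsEdge.smul {Φ : Subgroup PSL(2, ℤ)} {T : Set (Set (OnePoint ℝ))} (hinv : IsInvariant Φ T)
    {a b : OnePoint ℝ} (h : IsEdge T a b) {g : PSL(2, ℤ)} (hg : g ∈ Φ) :
    IsEdge T (g • a) (g • b) := by
  obtain ⟨V, hV, c, h⟩ := h
  exact ⟨g • V, hinv.smul_mem hg hV, g • c, h.smul g⟩

/-- An element of the group which fixes the ends of an edge is trivial. -/
theorem IsEdge.eq_one_of_fixes {Φ : Subgroup PSL(2, ℤ)} {T : Set (Set (OnePoint ℝ))}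
    (hT : IsIdealTriangulation T) (hinv : IsInvariant Φ T)
    {a b : OnePoint ℝ} (h : IsEdge T a b) {g : PSL(2, ℤ)} (hg : g ∈ Φ) (ha : g • a = a)
    (hb : g • b = b) : g = 1 := by
  obtain ⟨V, hV, c, h⟩ := h
  have h' := h.smul g
  rw [ha, hb] at h'
  -- Since `g` preserves orientation, both triangles lie on the same side of the edge, whose ends
  -- are fixed.
  have : g • V = V := by
    symm
    refine eq_of_same_side hT hV (hinv.smul_mem hg hV) h h' ?_
    obtain ⟨k, hk, ho⟩ := orient_psl_smul g a b c
    rw [ha, hb] at ho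
    have h1 : bracket a b ^ 2 * (boundarySideFun a b c * boundarySideFun a b (g • c)) =
        orient a b (g • c) * orient a b c := by
      simp only [boundarySideFun_eq, orient, bracket]; ring
    refine pos_of_mul_pos_right (a := bracket a b ^ 2) ?_ (sq_nonneg _)
    rw [h1, ho, mul_assoc]
    exact mul_pos hk (mul_self_pos.mpr (orient_ne_zero h.1 h.2.1 h.2.2.1))
  rcases h.stabilizer_cases this with h1 | ⟨h1, -⟩ | ⟨h1, -⟩
  · exact h1
  · exact absurd (ha.symm.trans h1) h.1
  · exact absurd (ha.symm.trans h1) h.2.2.1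

/-! ### Limits of families of geodesic lines -/

/-- Coefficients of `sideFun a b` as a quadratic form. -/
def form (p : OnePoint ℝ × OnePoint ℝ) : ℝ × ℝ × ℝ :=
  (den p.1 * den p.2, -(den p.1 * num p.2 + num p.1 * den p.2), num p.1 * num p.2)

/-- The function on the upper half plane with the coefficients `v`. -/
def evalForm (v : ℝ × ℝ × ℝ) (z : ℍ) : ℝ := v.1 * (z.re ^ 2 + z.im ^ 2) + v.2.1 * z.re + v.2.2

theorem evalForm_form (p : OnePoint ℝ × OnePoint ℝ) (z : ℍ) :
    evalForm (form p) z = sideFun p.1 p.2 z := by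
  rw [sideFun_eq]; simp only [evalForm, form]; ring

theorem evalForm_smul (k : ℝ) (v : ℝ × ℝ × ℝ) (z : ℍ) : evalForm (k • v) z = k * evalForm v z := by
  simp only [evalForm, Prod.smul_fst, Prod.smul_snd, smul_eq_mul]; ring

theorem continuous_evalForm : Continuous fun p : (ℝ × ℝ × ℝ) × ℍ => evalForm p.1 p.2 := by
  have h1 := UpperHalfPlane.continuous_re
  have h2 := UpperHalfPlane.continuous_im
  unfold evalForm
  fun_prop

theorem form_ne_zero (p : OnePoint ℝ × OnePoint ℝ) : form p ≠ 0 := by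
  obtain ⟨a, b⟩ := p
  intro h
  simp only [form, Prod.mk_eq_zero] at h
  obtain ⟨h1, h2, h3⟩ := h
  induction a using OnePoint.rec <;> induction b using OnePoint.rec <;> simp_all

/-- A zero in the upper half plane makes the discriminant nonnegative, so the form has real roots;
they are the ends of the line. For vanishing leading coefficient one end is `∞`. -/
theorem exists_line_of_form {v : ℝ × ℝ × ℝ} (hv : v ≠ 0) {p : ℍ} (hp : evalForm v p = 0) :
    ∃ k ≠ 0, ∃ a b : OnePoint ℝ, ∀ z, evalForm v z = k * sideFun a b z := by
  obtain ⟨A, B, C⟩ := v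
  simp only [evalForm] at hp ⊢
  by_cases hA : A = 0
  · subst hA
    have hB : B ≠ 0 := by
      rintro rfl
      apply hv
      have : C = 0 := by linarith
      rw [this]; rfl
    refine ⟨-B, neg_ne_zero.mpr hB, OnePoint.infty, ((-C / B : ℝ) : OnePoint ℝ), fun z => ?_⟩
    rw [sideFun_infty]
    field_simp
    ring
  · have hD : 0 ≤ (B ^ 2 - 4 * A * C) / (4 * A ^ 2) := by
      have : (B ^ 2 - 4 * A * C) / (4 * A ^ 2) = (p.re + B / (2 * A)) ^ 2 + p.im ^ 2 := by
        field_simp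
        linear_combination -16 * A * hp
      rw [this]; positivity
    have hs := Real.sq_sqrt hD
    refine ⟨A, hA, ((-B / (2 * A) + Real.sqrt ((B ^ 2 - 4 * A * C) / (4 * A ^ 2)) : ℝ) : OnePoint ℝ),
      ((-B / (2 * A) - Real.sqrt ((B ^ 2 - 4 * A * C) / (4 * A ^ 2)) : ℝ) : OnePoint ℝ),
      fun z => ?_⟩
    rw [sideFun_coe]
    set s := Real.sqrt ((B ^ 2 - 4 * A * C) / (4 * A ^ 2))
    have h2 : A * s ^ 2 = B ^ 2 / (4 * A) - C := by rw [hs]; field_simp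
    have h3 : A * (B / (2 * A)) = B / 2 := by field_simp
    have h4 : A * (B / (2 * A)) ^ 2 = B ^ 2 / (4 * A) := by field_simp; ring
    rw [neg_div]
    linear_combination (-2 * z.re) * h3 - h4 + h2

/-- The union of the lines with ends in `P`. -/
def linesUnion (P : Set (OnePoint ℝ × OnePoint ℝ)) : Set ℍ := ⋃ p ∈ P, geodesicLine p.1 p.2

/-- The set is a projection along a compact factor of a closed set. -/
theorem isClosed_zeros {N : Set (ℝ × ℝ × ℝ)} (hN : IsCompact N) :
    IsClosed {z : ℍ | ∃ v ∈ N, evalForm v z = 0} := by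
  have : CompactSpace N := isCompact_iff_compactSpace.mp hN
  have h1 : IsClosed {p : N × ℍ | evalForm p.1 p.2 = 0} := by
    have h0 : Continuous fun p : N × ℍ => (p.1.1, p.2) := by fun_prop
    exact isClosed_eq (continuous_evalForm.comp h0) continuous_const
  convert isClosedMap_snd_of_compactSpace _ h1
  ext z
  constructor
  · rintro ⟨v, hv, h⟩
    exact ⟨(⟨v, hv⟩, z), h, rfl⟩
  · rintro ⟨⟨v, z⟩, h, rfl⟩
    exact ⟨v.1, v.2, h⟩

/-- A limit point of lines outside of the open triangles which lies on an edge: the whole edge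
consists of limit points. -/
theorem IsEdge.line_subset_closure {T : Set (Set (OnePoint ℝ))} (hT : IsIdealTriangulation T)
    {a b : OnePoint ℝ} (h : IsEdge T a b) {P : Set (OnePoint ℝ × OnePoint ℝ)}
    (hP : ∀ W ∈ T, ∀ z ∈ linesUnion P, z ∉ openTriangle W) {p : ℍ} (hp : p ∈ geodesicLine a b)
    (hp' : p ∈ closure (linesUnion P)) : geodesicLine a b ⊆ closure (linesUnion P) := by
  -- Coefficient vectors are normalized to the unit sphere. By compactness a limit point of the
  -- lines is a zero of a nonzero limit form, hence lies on a limit line.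
  set N₀ : Set (ℝ × ℝ × ℝ) := (fun p => ‖form p‖⁻¹ • form p) '' P with hN₀
  have hsph : N₀ ⊆ Metric.sphere 0 1 := by
    rintro _ ⟨p, -, rfl⟩
    rw [mem_sphere_zero_iff_norm, norm_smul, norm_inv, norm_norm]
    exact inv_mul_cancel₀ (norm_ne_zero_iff.mpr (form_ne_zero p))
  have hsph' : closure N₀ ⊆ Metric.sphere 0 1 := closure_minimal hsph Metric.isClosed_sphere
  have hN : IsCompact (closure N₀) :=
    (isCompact_sphere _ _).of_isClosed_subset isClosed_closure hsph'
  obtain ⟨v, hv, hvp⟩ : ∃ v ∈ closure N₀, evalForm v p = 0 := by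
    refine closure_minimal ?_ (isClosed_zeros hN) hp'
    intro z hz
    obtain ⟨q, hq, hzq⟩ := Set.mem_iUnion₂.mp hz
    refine ⟨_, subset_closure ⟨q, hq, rfl⟩, ?_⟩
    rw [evalForm_smul, evalForm_form]
    exact mul_eq_zero_of_right _ hzq
  have hv0 : v ≠ 0 := by
    rintro rfl
    have := hsph' hv
    simp at this
  obtain ⟨k, hk, a', b', hform⟩ := exists_line_of_form hv0 hvp
  -- Every point of the limit line is a limit point: close to it the limit form takes both signs, so
  -- nearby forms of the family do as well and vanish somewhere in a connected neighbourhood.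
  have hline : geodesicLine a' b' ⊆ closure (linesUnion P) := by
    intro z hz
    rw [mem_closure_iff_nhds]
    intro O hO
    obtain ⟨O', hO'O, hO'⟩ : ∃ O' ⊆ O, O' ∈ 𝓝 z ∧ IsPreconnected O' := by
      obtain ⟨O', ⟨h1, h2, h3⟩, h4⟩ := (LocallyConnectedSpace.open_connected_basis z).mem_iff.mp hO
      exact ⟨O', h4, h1.mem_nhds h2, h3.isPreconnected⟩
    obtain ⟨z₁, h1, h1'⟩ := ((frequently_side hz hk).and_eventually hO'.1).exists
    obtain ⟨z₂, h2, h2'⟩ := ((frequently_side hz (neg_ne_zero.mpr hk)).and_eventually hO'.1).exists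
    have hc : ∀ z, Continuous fun v => evalForm v z := fun z =>
      continuous_evalForm.comp (Continuous.prodMk_left z)
    have hnhds : {w | 0 < evalForm w z₁ ∧ evalForm w z₂ < 0} ∈ 𝓝 v := by
      refine IsOpen.mem_nhds ((isOpen_lt continuous_const (hc z₁)).inter
        (isOpen_lt (hc z₂) continuous_const)) ⟨?_, ?_⟩
      · rw [hform]; linarith
      · rw [hform]; linarith
    obtain ⟨_, ⟨hw1, hw2⟩, q, hq, rfl⟩ := mem_closure_iff_nhds.mp hv _ hnhds
    obtain ⟨x, hx, hx0⟩ := hO'.2.intermediate_value h2' h1'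
      (f := fun z => evalForm (‖form q‖⁻¹ • form q) z)
      (continuous_evalForm.comp (Continuous.prodMk_right _)).continuousOn ⟨hw2.le, hw1.le⟩
    refine ⟨x, hO'O hx, Set.mem_iUnion₂.mpr ⟨q, hq, ?_⟩⟩
    simp only [evalForm_smul, evalForm_form] at hx0
    exact (mul_eq_zero.mp hx0).resolve_left
      (inv_ne_zero (norm_ne_zero_iff.mpr (form_ne_zero q)))
  have hpl : p ∈ geodesicLine a' b' := by
    rw [hform] at hvp
    exact (mul_eq_zero.mp hvp).resolve_left hk
  -- Open triangles miss the lines of the family, hence also their closure. The limit line meets the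
  -- edge and avoids the open triangles, so it is the edge.
  have hout : ∀ W ∈ T, ∀ z ∈ geodesicLine a' b', z ∉ openTriangle W := by
    intro W hW z hz hzW
    obtain ⟨w, hw1, hw2⟩ := mem_closure_iff_nhds.mp (hline hz) _
      ((isOpen_openTriangle hT hW).mem_nhds hzW)
    exact hP W hW w hw2 hw1
  rcases h.eq_of_line hout hp hpl with ⟨rfl, rfl⟩ | ⟨rfl, rfl⟩
  · exact hline
  · rwa [geodesicLine_comm]

theorem smul_closure (g : PSL(2, ℤ)) (S : Set ℍ) : g • closure S = closure (g • S) :=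
  (Homeomorph.smul g).image_closure S

/-! ### Excluding points without local finiteness -/

section Cofinite

variable {Φ : Subgroup PSL(2, ℤ)} {T : Set (Set (OnePoint ℝ))} (hT : IsIdealTriangulation T)
  (hfin : Φ.FiniteIndex) (hinv : IsInvariant Φ T)
include hT hfin hinv

theorem exists_vertex_of_rational {x : OnePoint ℝ} (hx : IsRationalEnd x) : ∃ V ∈ T, x ∈ V := by
  obtain ⟨g, rfl⟩ := hx
  obtain ⟨Y, hY⟩ := exists_fan hT hfin hinv g⁻¹
  set z : ℍ := ⟨⟨0, max Y 0 + 1⟩, by positivity⟩ with hz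
  have him : Y < z.im := lt_of_le_of_lt (le_max_left Y 0) (lt_add_one (max Y 0))
  obtain ⟨V, hV, h⟩ := exists_mem_closedTriangle hT (g • z)
  refine ⟨V, hV, ?_⟩
  have := (hY (g • z) (by rwa [inv_smul_smul])).2 V hV h
  rwa [inv_inv] at this

/-- The edge climbs into the cusp at `a`, where the triangles form a locally finite fan, and local
finiteness propagates back along it. -/
theorem locFin_of_rational_edge {a b : OnePoint ℝ} (h : IsEdge T a b) (ha : IsRationalEnd a) {z : ℍ}
    (hz : z ∈ geodesicLine a b) : LocFin T z := by
  obtain ⟨g, rfl⟩ := ha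
  obtain ⟨Y, hY⟩ := exists_fan hT hfin hinv g⁻¹
  obtain ⟨w, hw, hw'⟩ := exists_high_on_line (γ := g⁻¹) h.ne (inv_smul_smul _ _) Y
  exact locFin_of_locFin_edge hT h hw hz (hY w hw').1

omit hfin in
theorem IsEdge.smul_pair_injOn {a b : OnePoint ℝ} (h : IsEdge T a b) :
    Set.InjOn (fun g : PSL(2, ℤ) => (g • a, g • b)) Φ := by
  intro g hg g' hg' heq
  simp only [Prod.mk.injEq] at heq
  have := h.eq_one_of_fixes hT hinv (g := g'⁻¹ * g) (mul_mem (inv_mem hg') hg)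
    (by rw [mul_smul, heq.1, inv_smul_smul]) (by rw [mul_smul, heq.2, inv_smul_smul])
  rw [inv_mul_eq_one] at this
  exact this.symm

/-- If an edge has an irrational end, then its translates accumulate at one of them. -/
theorem exists_accumulation {a b : OnePoint ℝ} (h : IsEdge T a b) (ha : ¬IsRationalEnd a)
    (hclosed : IsClosed (linesUnion {p | ∃ φ ∈ Φ, p = (φ • a, φ • b)}))
    {O : Set ℍ} (hO : IsOpen O) {p : ℍ} (hpO : p ∈ O) (hp : p ∈ geodesicLine a b)
    (hOe : O ∩ linesUnion {p | ∃ φ ∈ Φ, p = (φ • a, φ • b)} ⊆ geodesicLine a b) : False := by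
  set M := linesUnion {p | ∃ φ ∈ Φ, p = (φ • a, φ • b)} with hM
  have hmemM : ∀ φ ∈ Φ, geodesicLine (φ • a) (φ • b) ⊆ M := fun φ hφ z hz =>
    Set.mem_iUnion₂.mpr ⟨_, ⟨φ, hφ, rfl⟩, hz⟩
  obtain ⟨K, hK, hinf⟩ := exists_recurrence Φ hfin ha h.ne
  -- A closed union of translates in which one, hence by homogeneity each, is isolated forms a
  -- locally finite family. This contradicts the infinitely many returns to `K`.
  have hloc : ∀ z : ℍ, ∃ U ∈ 𝓝 z,
      {φ | φ ∈ Φ ∧ (geodesicLine (φ • a) (φ • b) ∩ U).Nonempty}.Finite := by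
    intro z
    by_cases hz : z ∈ M
    · obtain ⟨_, ⟨g, hg, rfl⟩, hzg⟩ := Set.mem_iUnion₂.mp hz
      simp only at hzg
      set P : Set (OnePoint ℝ × OnePoint ℝ) := {p | ∃ φ ∈ Φ, p = (φ • a, φ • b) ∧
        geodesicLine (φ • a) (φ • b) ≠ geodesicLine (g • a) (g • b)} with hP
      have hPM : linesUnion P ⊆ M := by
        intro w hw
        obtain ⟨_, ⟨φ, hφ, rfl, -⟩, hw⟩ := Set.mem_iUnion₂.mp hw
        exact hmemM φ hφ hw
      -- If other translates accumulated at one point of the translate by `g`, they would accumulate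
      -- along all of it, in particular at `g • p`, which `g • O` isolates.
      have hzP : z ∉ closure (linesUnion P) := by
        intro hcl
        have hsub := (h.smul hinv hg).line_subset_closure hT (P := P) ?_ hzg hcl
        · obtain ⟨w, hwO, hwP⟩ := mem_closure_iff_nhds.mp
            (hsub ((psl_smul_mem_geodesicLine g).mpr hp)) (g • O)
            ((hO.smul g).mem_nhds (Set.smul_mem_smul_set hpO))
          have hwg : g⁻¹ • w ∈ geodesicLine a b := by
            refine hOe ⟨Set.mem_smul_set_iff_inv_smul_mem.mp hwO, ?_⟩
            obtain ⟨_, ⟨φ, hφ, rfl, -⟩, hw⟩ := Set.mem_iUnion₂.mp hwP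
            refine hmemM (g⁻¹ * φ) (mul_mem (inv_mem hg) hφ) ?_
            rw [mul_smul, mul_smul, psl_smul_mem_geodesicLine]
            exact hw
          rw [← psl_smul_mem_geodesicLine g, smul_inv_smul] at hwg
          obtain ⟨_, ⟨φ, hφ, rfl, hne⟩, hw⟩ := Set.mem_iUnion₂.mp hwP
          exact hne ((h.smul hinv hφ).line_eq_of_mem hT (h.smul hinv hg) hw hwg)
        · intro W hW w hw
          obtain ⟨_, ⟨φ, hφ, rfl, -⟩, hw⟩ := Set.mem_iUnion₂.mp hw
          exact (h.smul hinv hφ).notMem_openTriangle hT hw hW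
      refine ⟨_, isClosed_closure.isOpen_compl.mem_nhds hzP, ?_⟩
      -- Elements are counted by the ordered pairs of ends of the translated edge; one line admits
      -- only two orders.
      refine Set.Finite.of_finite_image (f := fun g : PSL(2, ℤ) => (g • a, g • b))
        ((Set.toFinite {(g • a, g • b), (g • b, g • a)}).subset ?_)
        ((h.smul_pair_injOn hT hinv).mono fun φ hφ => hφ.1)
      rintro _ ⟨φ, ⟨hφ, w, hw, hwP⟩, rfl⟩
      have heq : geodesicLine (φ • a) (φ • b) = geodesicLine (g • a) (g • b) := by
        by_contra hne
        exact hwP (subset_closure (Set.mem_iUnion₂.mpr ⟨_, ⟨φ, hφ, rfl, hne⟩, hw⟩))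
      rcases (h.smul hinv hφ).eq_of_mem hT (h.smul hinv hg) hw (heq ▸ hw) with ⟨h1, h2⟩ | ⟨h1, h2⟩
      · left; simp only [h1, h2]
      · right; simp only [h1, h2]; rfl
    · refine ⟨Mᶜ, hclosed.isOpen_compl.mem_nhds hz, ?_⟩
      convert Set.finite_empty
      rw [Set.eq_empty_iff_forall_notMem]
      rintro φ ⟨hφ, w, hw, hwM⟩
      exact hwM (hmemM φ hφ hw)
  choose U hU hUf using hloc
  obtain ⟨t, -, ht⟩ := hK.elim_nhds_subcover U fun z _ => hU z
  refine hinf ((t.finite_toSet.biUnion fun z _ => hUf z).subset ?_)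
  rintro φ ⟨hφ, w, hw, hwK⟩
  obtain ⟨z, hz, hwz⟩ := Set.mem_iUnion₂.mp (ht hwK)
  exact Set.mem_iUnion₂.mpr ⟨z, hz, hφ, w, hw, hwz⟩

omit hfin hinv in
-- The open triangles are disjoint, nonempty and open in a separable space, so there are countably
-- many triangles, each with finitely many vertices.
theorem countable_edges : {p : OnePoint ℝ × OnePoint ℝ | IsEdge T p.1 p.2}.Countable := by
  have hTc : T.Countable := hT.disjoint.countable_of_isOpen
    (fun V hV => isOpen_openTriangle hT hV) fun V hV => openTriangle_nonempty (hT.three_vertices V hV)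
  refine (hTc.biUnion (t := fun V _ => V ×ˢ V) fun V hV => ?_).mono ?_
  · have : V.Finite := Set.finite_of_ncard_ne_zero (by rw [hT.three_vertices V hV]; norm_num)
    exact (this.prod this).countable
  · rintro ⟨a, b⟩ ⟨V, hV, c, h⟩
    exact Set.mem_iUnion₂.mpr ⟨V, hV, h.mem.1, h.mem.2.1⟩

omit hfin hinv in
/-- Baire: a nonempty closed set of points on edges contains a relatively open part of an edge. -/
theorem exists_isolated {M : Set ℍ} (hM : IsClosed M) (hne : M.Nonempty)
    (hedge : ∀ z ∈ M, ∃ a b, IsEdge T a b ∧ z ∈ geodesicLine a b) :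
    ∃ a b, IsEdge T a b ∧ ∃ O : Set ℍ, IsOpen O ∧ (O ∩ M).Nonempty ∧ O ∩ M ⊆ geodesicLine a b := by
  have : LocallyCompactSpace M := hM.locallyCompactSpace
  have : Nonempty M := hne.to_subtype
  have : Countable {p : OnePoint ℝ × OnePoint ℝ | IsEdge T p.1 p.2} := (countable_edges hT).to_subtype
  obtain ⟨⟨⟨a, b⟩, hab⟩, w, hw⟩ := nonempty_interior_of_iUnion_of_closed
    (f := fun p : {p : OnePoint ℝ × OnePoint ℝ | IsEdge T p.1 p.2} =>
      {z : M | (z : ℍ) ∈ geodesicLine p.1.1 p.1.2})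
    (fun p => (isClosed_geodesicLine _ _).preimage continuous_subtype_val) (by
      refine Set.eq_univ_of_forall fun z => ?_
      obtain ⟨a, b, h, hz⟩ := hedge z z.2
      exact Set.mem_iUnion.mpr ⟨⟨(a, b), h⟩, hz⟩)
  obtain ⟨O', hO's, hO', hwO'⟩ := mem_interior.mp hw
  obtain ⟨O, hO, rfl⟩ := isOpen_induced_iff.mp hO'
  exact ⟨a, b, hab, O, hO, ⟨w, hwO', w.2⟩, fun z hz => hO's (a := ⟨z, hz.2⟩) hz.1⟩

/-- Applied to the set of all points without local finiteness. The induction is on the number of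
representative edges contained in `M`: an edge with an isolated part is found by Baire's theorem,
and its orbit `E` is split off. -/
theorem eq_empty_of_saturated {F : Set (OnePoint ℝ × OnePoint ℝ)} (hF : F.Finite)
    (hrep : ∀ a b, IsEdge T a b → ∃ φ ∈ Φ, (φ • a, φ • b) ∈ F) (n : ℕ) : ∀ M : Set ℍ,
    {p ∈ F | geodesicLine p.1 p.2 ⊆ M}.ncard = n → IsClosed M →
    (∀ z ∈ M, ¬LocFin T z) → (∀ g ∈ Φ, ∀ z ∈ M, g • z ∈ M) →
    (∀ a b, IsEdge T a b → ∀ z ∈ M, z ∈ geodesicLine a b → geodesicLine a b ⊆ M) → M = ∅ := by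
  induction n using Nat.strong_induction_on with
  | _ n ih =>
  intro M hn hM hloc hinvM hsat
  by_contra hne
  have hedge : ∀ z ∈ M, ∃ a b, IsEdge T a b ∧ z ∈ geodesicLine a b := by
    intro z hz
    rcases mem_openTriangle_or_mem_edge hT z with ⟨V, hV, h⟩ | ⟨V, hV, a, b, c, h, hl⟩
    · exact absurd (locFin_of_mem_openTriangle hT hV h) (hloc z hz)
    · exact ⟨a, b, ⟨V, hV, c, h⟩, hl⟩
  obtain ⟨a, b, hab, O, hO, ⟨p, hpO, hpM⟩, hOM⟩ :=
    exists_isolated hT hM (Set.nonempty_iff_ne_empty.mpr hne) hedge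
  have hp := hOM ⟨hpO, hpM⟩
  set E := linesUnion {p | ∃ φ ∈ Φ, p = (φ • a, φ • b)} with hE
  have heM := hsat a b hab p hpM hp
  have hEM : E ⊆ M := by
    intro z hz
    obtain ⟨_, ⟨φ, hφ, rfl⟩, hz⟩ := Set.mem_iUnion₂.mp hz
    have := hinvM φ hφ (φ⁻¹ • z) (heM ?_)
    · rwa [smul_inv_smul] at this
    · rwa [← psl_smul_mem_geodesicLine φ, smul_inv_smul]
  have hEinv : ∀ g ∈ Φ, ∀ z, g • z ∈ E → z ∈ E := by
    intro g hg z hz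
    obtain ⟨_, ⟨φ, hφ, rfl⟩, hz⟩ := Set.mem_iUnion₂.mp hz
    refine Set.mem_iUnion₂.mpr ⟨_, ⟨g⁻¹ * φ, mul_mem (inv_mem hg) hφ, rfl⟩, ?_⟩
    simp only at hz ⊢
    rwa [← psl_smul_mem_geodesicLine g, mul_smul, mul_smul, smul_inv_smul, smul_inv_smul]
  have heE : geodesicLine a b ⊆ E := fun z hz =>
    Set.mem_iUnion₂.mpr ⟨(a, b), ⟨1, one_mem _, by simp⟩, hz⟩
  -- As `M` is a union of edges and edges do not cross, the rest `M \ E` is itself a union of edges,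
  -- so limits of edges control its closure.
  set P : Set (OnePoint ℝ × OnePoint ℝ) :=
    {q | IsEdge T q.1 q.2 ∧ (geodesicLine q.1 q.2 ∩ (M \ E)).Nonempty} with hP
  have hPME : linesUnion P = M \ E := by
    ext z
    constructor
    · intro hz
      obtain ⟨⟨x, y⟩, ⟨hxy, w, hw, hwM, hwE⟩, hz⟩ := Set.mem_iUnion₂.mp hz
      simp only at hxy hw hz
      refine ⟨hsat x y hxy w hwM hw hz, fun hzE => hwE ?_⟩
      obtain ⟨_, ⟨φ, hφ, rfl⟩, hz'⟩ := Set.mem_iUnion₂.mp hzE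
      simp only at hz'
      rw [hxy.line_eq_of_mem hT (hab.smul hinv hφ) hz hz'] at hw
      exact Set.mem_iUnion₂.mpr ⟨_, ⟨φ, hφ, rfl⟩, hw⟩
    · rintro ⟨hz, hzE⟩
      obtain ⟨x, y, hxy, hzxy⟩ := hedge z hz
      exact Set.mem_iUnion₂.mpr ⟨(x, y), ⟨hxy, z, hzxy, hz, hzE⟩, hzxy⟩
  have hpM' : p ∉ closure (M \ E) := by
    intro hcl
    obtain ⟨w, hwO, hwM, hwE⟩ := mem_closure_iff_nhds.mp hcl O (hO.mem_nhds hpO)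
    exact hwE (heE (hOM ⟨hwO, hwM⟩))
  have hsub : closure (M \ E) ⊆ M := closure_minimal Set.sdiff_subset hM
  -- The closure has the same closure properties as `M`, but misses `p` and so has lost the
  -- representative of the edge `a b`: the count drops.
  have hempty : closure (M \ E) = ∅ := by
    refine ih _ ?_ (closure (M \ E)) rfl isClosed_closure (fun z hz => hloc z (hsub hz)) ?_ ?_
    · rw [← hn]
      refine Set.ncard_lt_ncard ⟨fun q hq => ⟨hq.1, hq.2.trans hsub⟩, fun hcon => ?_⟩
        (hF.subset (Set.sep_subset _ _))
      obtain ⟨φ, hφ, hφF⟩ := hrep a b hab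
      have h1 : geodesicLine (φ • a) (φ • b) ⊆ M := fun z hz =>
        hEM (Set.mem_iUnion₂.mpr ⟨_, ⟨φ, hφ, rfl⟩, hz⟩)
      obtain ⟨-, h2⟩ := hcon ⟨hφF, h1⟩
      have h3 := h2 ((psl_smul_mem_geodesicLine φ).mpr hp)
      apply hpM'
      have h4 : φ⁻¹ • (φ • p) ∈ closure (φ⁻¹ • (M \ E)) := by
        rw [← smul_closure]
        exact Set.smul_mem_smul_set h3
      rw [inv_smul_smul] at h4
      refine closure_mono ?_ h4
      rintro _ ⟨w, ⟨hwM, hwE⟩, rfl⟩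
      exact ⟨hinvM _ (inv_mem hφ) w hwM, fun h => hwE (hEinv _ (inv_mem hφ) w h)⟩
    · intro g hg z hz
      have h4 : g • z ∈ closure (g • (M \ E)) := by
        rw [← smul_closure]
        exact Set.smul_mem_smul_set hz
      refine closure_mono ?_ h4
      rintro _ ⟨w, ⟨hwM, hwE⟩, rfl⟩
      exact ⟨hinvM _ hg w hwM, fun h => hwE (hEinv _ hg w h)⟩
    · intro x y hxy z hz hzl
      rw [← hPME] at hz ⊢
      refine hxy.line_subset_closure hT ?_ hzl hz
      intro W hW w hw hwW
      obtain ⟨⟨x', y'⟩, ⟨hxy', -⟩, hw⟩ := Set.mem_iUnion₂.mp hw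
      exact hxy'.notMem_openTriangle hT hw hW hwW
  have hME : M = E := by
    refine Set.Subset.antisymm (fun z hz => ?_) hEM
    by_contra hzE
    have : z ∈ closure (M \ E) := subset_closure ⟨hz, hzE⟩
    rw [hempty] at this
    exact this
  -- Now `M` is the single orbit `E`. Its edges have no rational end, since they would be locally
  -- finite otherwise.
  refine exists_accumulation hT hfin hinv hab (fun ha => ?_) (hE ▸ hME ▸ hM) hO hpO hp ?_
  · exact hloc p hpM (locFin_of_rational_edge hT hfin hinv hab ha hp)
  · rw [← hE, ← hME]; exact hOM

theorem exists_finite_edge_reps : ∃ F : Set (OnePoint ℝ × OnePoint ℝ), F.Finite ∧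
    ∀ a b, IsEdge T a b → ∃ φ ∈ Φ, (φ • a, φ • b) ∈ F := by
  obtain ⟨F, hF, hFT, hrep⟩ := exists_finite_orbit_reps hT hfin hinv
  refine ⟨⋃ V ∈ F, V ×ˢ V, hF.biUnion fun V hV => ?_, ?_⟩
  · have : V.Finite := Set.finite_of_ncard_ne_zero (by rw [hT.three_vertices V (hFT hV)]; norm_num)
    exact this.prod this
  · rintro a b ⟨V, hV, c, h⟩
    obtain ⟨φ, hφ, hφV⟩ := hrep V hV
    exact ⟨φ, hφ, Set.mem_iUnion₂.mpr ⟨_, hφV, Set.smul_mem_smul_set h.mem.1,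
      Set.smul_mem_smul_set h.mem.2.1⟩⟩

/-- An ideal triangulation which is invariant under a group of finite index is locally finite. -/
theorem locFin (z : ℍ) : LocFin T z := by
  obtain ⟨F, hF, hrep⟩ := exists_finite_edge_reps hT hfin hinv
  have := eq_empty_of_saturated hT hfin hinv hF hrep _ {z | ¬LocFin T z} rfl isClosed_not_locFin
    (fun z hz => hz) ?_ ?_
  · by_contra h
    exact Set.eq_empty_iff_forall_notMem.mp this z h
  · intro g hg z hz h
    refine hz ?_
    have := h.smul hinv (inv_mem hg)
    rwa [inv_smul_smul] at this
  · intro a b h z hz hzl w hw hfin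
    exact hz (locFin_of_locFin_edge hT h hw hzl hfin)

/-- An irrational end would make infinitely many different translates of the edge meet a compact
set, but by local finiteness only finitely many triangles meet it. -/
theorem isRationalEnd_of_isEdge {a b : OnePoint ℝ} (h : IsEdge T a b) : IsRationalEnd a := by
  by_contra ha
  obtain ⟨K, hK, hinf⟩ := exists_recurrence Φ hfin ha h.ne
  choose U hU hUf using locFin hT hfin hinv
  obtain ⟨t, -, ht⟩ := hK.elim_nhds_subcover U fun z _ => hU z
  have hf := t.finite_toSet.biUnion fun z _ => hUf z
  have hf2 : (⋃ V ∈ ⋃ z ∈ (t : Set ℍ), {V ∈ T | (closedTriangle V ∩ U z).Nonempty},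
      V ×ˢ V).Finite := by
    refine hf.biUnion fun V hV => ?_
    obtain ⟨z, hz, hVT, -⟩ := Set.mem_iUnion₂.mp hV
    have : V.Finite := Set.finite_of_ncard_ne_zero (by rw [hT.three_vertices V hVT]; norm_num)
    exact this.prod this
  refine hinf (Set.Finite.of_finite_image (f := fun g : PSL(2, ℤ) => (g • a, g • b))
    (hf2.subset ?_) ((h.smul_pair_injOn hT hinv).mono fun φ hφ => hφ.1))
  rintro _ ⟨φ, ⟨hφ, w, hw, hwK⟩, rfl⟩
  obtain ⟨z, hz, hwz⟩ := Set.mem_iUnion₂.mp (ht hwK)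
  obtain ⟨V, hV, c, hVc⟩ := h.smul hinv hφ
  refine Set.mem_iUnion₂.mpr ⟨V, Set.mem_iUnion₂.mpr ⟨z, hz, hV, w, ?_, hwz⟩, hVc.mem.1, hVc.mem.2.1⟩
  exact hVc.line_subset_closedTriangle hw

theorem isRationalEnd_of_mem {V : Set (OnePoint ℝ)} (hV : V ∈ T) {a : OnePoint ℝ} (ha : a ∈ V) :
    IsRationalEnd a := by
  obtain ⟨b, c, h⟩ := exists_hasVertices_of_mem (hT.three_vertices V hV) ha
  exact isRationalEnd_of_isEdge hT hfin hinv ⟨V, hV, c, h⟩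

end Cofinite

/-! ### Subgroups of the modular group -/

/-- The rotation `z ↦ -1/z`. -/
def inversion : PSL(2, ℤ) := toPSL ModularGroup.S

theorem inversion_mul_self : inversion * inversion = 1 := toPSL_mul_self_of_trace (by simp)

theorem inversion_inv : inversion⁻¹ = inversion := inv_eq_of_mul_eq_one_left inversion_mul_self

theorem closure_inversion_translation : Subgroup.closure {inversion, translation} = ⊤ := by
  have h := congrArg (Subgroup.map (QuotientGroup.mk' (Subgroup.center SL(2, ℤ))))
    SpecialLinearGroup.SL2Z_generators
  rw [MonoidHom.map_closure, Set.image_pair,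
    Subgroup.map_top_of_surjective _ (QuotientGroup.mk'_surjective _)] at h
  exact h

theorem eq_top_of_conj {Φ : Subgroup PSL(2, ℤ)} {γ : PSL(2, ℤ)} (h1 : γ * inversion * γ⁻¹ ∈ Φ)
    (h2 : γ * translation * γ⁻¹ ∈ Φ) : Φ = ⊤ := by
  have h : Φ.comap (MulAut.conj γ).toMonoidHom = ⊤ := by
    rw [← top_le_iff, ← closure_inversion_translation, Subgroup.closure_le]
    rintro _ (rfl | rfl)
    · exact h1
    · exact h2
  rw [eq_top_iff]
  intro g _
  have : γ⁻¹ * g * γ ∈ Φ.comap (MulAut.conj γ).toMonoidHom := by rw [h]; trivial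
  have h3 : γ * (γ⁻¹ * g * γ) * γ⁻¹ ∈ Φ := this
  simpa [mul_assoc] using h3

/-- A rotation of order 3. -/
def rotationThree : PSL(2, ℤ) := translation * inversion

theorem rotationThree_pow : rotationThree ^ 3 = 1 := by
  change toPSL ((ModularGroup.T * ModularGroup.S) ^ 3) = 1
  rw [toPSL_eq_one_iff]
  simp [pow_succ, Matrix.SpecialLinearGroup.coe_mul, ModularGroup.coe_T, ModularGroup.coe_S,
    Matrix.mul_apply, Fin.sum_univ_two]

theorem rotationThree_fixes : ∃ z : ℍ, rotationThree • z = z := by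
  refine ⟨translation • UpperHalfPlane.ρ, ?_⟩
  have h : toPSL (ModularGroup.S * ModularGroup.T) • UpperHalfPlane.ρ = UpperHalfPlane.ρ :=
    ModularGroup.stabilizer_ρ.mpr (by simp)
  rw [toPSL_mul] at h
  have h' : (inversion * translation) • UpperHalfPlane.ρ = UpperHalfPlane.ρ := h
  rw [rotationThree, mul_smul, ← mul_smul inversion, h']

theorem translation_eq : translation = rotationThree * inversion := by
  rw [rotationThree, mul_assoc, inversion_mul_self, mul_one]

theorem closure_rotations : Subgroup.closure {inversion, rotationThree} = ⊤ := by
  rw [← top_le_iff, ← closure_inversion_translation, Subgroup.closure_le]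
  have h1 : inversion ∈ Subgroup.closure {inversion, rotationThree} :=
    Subgroup.subset_closure (by simp)
  have h2 : rotationThree ∈ Subgroup.closure {inversion, rotationThree} :=
    Subgroup.subset_closure (by simp)
  rintro _ (rfl | rfl)
  · exact h1
  · rw [translation_eq]; exact mul_mem h2 h1

/-- The union of the three cosets is stable under left multiplication by `inversion` and
`rotationThree`, which generate the whole group. The needed relations come from `rotationThree *
inversion * rotationThree = translation ^ 2 * inversion`. -/
theorem exists_mul_pow_mem {Φ : Subgroup PSL(2, ℤ)} (h1 : inversion ∈ Φ)
    (h2 : translation ^ 2 ∈ Φ) (g : PSL(2, ℤ)) : ∃ i : ℕ, i < 3 ∧ ∃ φ ∈ Φ, g = rotationThree ^ i * φ := by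
  have hu := rotationThree_pow
  have hs := inversion_mul_self
  set u := rotationThree with hu'
  have hx : translation ^ 2 * inversion ∈ Φ := mul_mem h2 h1
  have hxe : u * inversion * u = translation ^ 2 * inversion := by
    rw [pow_two, hu', rotationThree]
    have := inversion_mul_self
    calc _ = translation * (inversion * inversion) * translation * inversion := by group
      _ = _ := by rw [this]; group
  have hsu : inversion * u = u ^ 2 * (translation ^ 2 * inversion) := by
    rw [← hxe]
    calc _ = u ^ 3 * (inversion * u) := by rw [hu, one_mul]
      _ = _ := by group
  have hsu2 : inversion * u ^ 2 = u * (translation ^ 2 * inversion)⁻¹ := by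
    rw [eq_mul_inv_iff_mul_eq, mul_assoc, ← hsu, ← mul_assoc, hs, one_mul]
  have hmul_u : ∀ g : PSL(2, ℤ), (∃ i : ℕ, i < 3 ∧ ∃ φ ∈ Φ, g = u ^ i * φ) →
      ∃ i : ℕ, i < 3 ∧ ∃ φ ∈ Φ, u * g = u ^ i * φ := by
    rintro _ ⟨i, hi, φ, hφ, rfl⟩
    by_cases h : i = 2
    · exact ⟨0, by norm_num, φ, hφ, by rw [h, ← mul_assoc, ← pow_succ', hu, pow_zero]⟩
    · exact ⟨i + 1, by omega, φ, hφ, by rw [← mul_assoc, ← pow_succ']⟩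
  have hmul_s : ∀ g : PSL(2, ℤ), (∃ i : ℕ, i < 3 ∧ ∃ φ ∈ Φ, g = u ^ i * φ) →
      ∃ i : ℕ, i < 3 ∧ ∃ φ ∈ Φ, inversion * g = u ^ i * φ := by
    rintro _ ⟨i, hi, φ, hφ, rfl⟩
    interval_cases i
    · exact ⟨0, by norm_num, _, mul_mem h1 hφ, by simp⟩
    · exact ⟨2, by norm_num, _, mul_mem hx hφ, by rw [pow_one, ← mul_assoc, hsu, mul_assoc]⟩
    · exact ⟨1, by norm_num, _, mul_mem (inv_mem hx) hφ, by rw [← mul_assoc, hsu2, mul_assoc, pow_one]⟩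
  have hg : g ∈ Subgroup.closure {inversion, u} := by rw [closure_rotations]; trivial
  induction hg using Subgroup.closure_induction_left with
  | one => exact ⟨0, by norm_num, 1, one_mem _, by simp⟩
  | mul_left x hx y hy ih =>
    rcases hx with rfl | rfl
    · exact hmul_s _ ih
    · exact hmul_u _ ih
  | inv_mul_cancel x hx y hy ih =>
    rcases hx with rfl | rfl
    · rw [inversion_inv]; exact hmul_s _ ih
    · have : u⁻¹ = u * u := inv_eq_of_mul_eq_one_left (by rw [← hu, pow_succ, pow_two])
      rw [this, mul_assoc]
      exact hmul_u _ (hmul_u _ ih)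

/-- The powers of the conjugated rotation represent all cosets by `exists_mul_pow_mem`. They are
inequivalent because neither the rotation nor its square lies in `Φ`. -/
theorem index_eq_three {Φ : Subgroup PSL(2, ℤ)} {γ : PSL(2, ℤ)} (h1 : γ * inversion * γ⁻¹ ∈ Φ)
    (h2 : γ * translation ^ 2 * γ⁻¹ ∈ Φ) (h3 : γ * rotationThree * γ⁻¹ ∉ Φ) : Φ.index = 3 := by
  set Φ' := Φ.comap (MulAut.conj γ).toMonoidHom with hΦ'
  set w := γ * rotationThree * γ⁻¹ with hw
  have hw3 : w ^ 3 = 1 := by rw [hw, conj_pow, rotationThree_pow]; simp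
  have hw2 : w ^ 2 ∉ Φ := by
    intro h
    apply h3
    have : w = (w ^ 2) ^ 2 := by
      calc w = w ^ 3 * w := by rw [hw3, one_mul]
        _ = _ := by group
    rw [this]
    exact pow_mem h 2
  have hsurj : ∀ g : PSL(2, ℤ), ∃ i : ℕ, i < 3 ∧ ∃ φ ∈ Φ, g = w ^ i * φ := by
    intro g
    obtain ⟨i, hi, φ, hφ, h⟩ := exists_mul_pow_mem (Φ := Φ') h1 h2 (γ⁻¹ * g * γ)
    refine ⟨i, hi, γ * φ * γ⁻¹, hφ, ?_⟩
    rw [hw, conj_pow]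
    calc g = γ * (γ⁻¹ * g * γ) * γ⁻¹ := by group
      _ = _ := by rw [h]; group
  have hbij : Function.Bijective fun i : Fin 3 => ((w ^ (i : ℕ) : PSL(2, ℤ)) : PSL(2, ℤ) ⧸ Φ) := by
    constructor
    · have key : ∀ i j : Fin 3, i < j →
          ((w ^ (i : ℕ) : PSL(2, ℤ)) : PSL(2, ℤ) ⧸ Φ) ≠ ((w ^ (j : ℕ) : PSL(2, ℤ)) : PSL(2, ℤ) ⧸ Φ) := by
        intro i j hij h
        rw [QuotientGroup.eq] at h
        fin_cases i <;> fin_cases j <;> simp at hij h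
        · exact h3 h
        · exact hw2 h
        · rw [pow_two, inv_mul_cancel_left] at h
          exact h3 h
      intro i j h
      by_contra hne
      rcases lt_or_gt_of_ne hne with h' | h'
      · exact key i j h' h
      · exact key j i h' h.symm
    · intro q
      induction q using QuotientGroup.induction_on with
      | H g =>
        obtain ⟨i, hi, φ, hφ, rfl⟩ := hsurj g
        refine ⟨⟨i, hi⟩, ?_⟩
        rw [QuotientGroup.eq]
        simpa using hφ
  rw [Subgroup.index, ← Nat.card_congr (Equiv.ofBijective _ hbij), Nat.card_fin]

/-! ### Gluings that force the full group or index three -/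

theorem trace_sq_of_pow_three {G : SL(2, ℤ)} (h3 : toPSL G ^ 3 = 1) (h1 : toPSL G ≠ 1) :
    (G 0 0 + G 1 1) ^ 2 = 1 := by
  have hdet := G.det_coe
  rw [Matrix.det_fin_two] at hdet
  have h : toPSL (G * G * G) = 1 := by
    rw [← h3, pow_succ, pow_two]; rfl
  rw [toPSL_eq_one_iff] at h
  simp only [Matrix.SpecialLinearGroup.coe_mul, Matrix.mul_apply, Fin.sum_univ_two] at h
  obtain ⟨e1, e2, e3⟩ := h
  -- As above, `G ^ 3 = (t ^ 2 - 1) G - t` for the trace `t`; if `t ^ 2 ≠ 1`, then `G` is scalar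
  -- together with its cube.
  by_contra hne
  have hne' : (G 0 0 + G 1 1) ^ 2 - 1 ≠ 0 := sub_ne_zero.mpr hne
  apply h1
  rw [toPSL_eq_one_iff]
  refine ⟨?_, ?_, ?_⟩
  · refine (mul_eq_zero (a := (G 0 0 + G 1 1) ^ 2 - 1).mp ?_).resolve_left hne'
    linear_combination e1 + G 0 1 * hdet
  · refine (mul_eq_zero (a := (G 0 0 + G 1 1) ^ 2 - 1).mp ?_).resolve_left hne'
    linear_combination e2 + G 1 0 * hdet
  · refine sub_eq_zero.mp ((mul_eq_zero (a := (G 0 0 + G 1 1) ^ 2 - 1).mp ?_).resolve_left hne')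
    linear_combination e3 + (G 0 0 - G 1 1) * hdet

theorem entries_mul_T_zpow (G : SL(2, ℤ)) (n : ℤ) :
    (G * ModularGroup.T ^ n) 0 0 = G 0 0 ∧ (G * ModularGroup.T ^ n) 1 0 = G 1 0 ∧
    (G * ModularGroup.T ^ n) 1 1 = G 1 0 * n + G 1 1 := by
  simp [Matrix.SpecialLinearGroup.coe_mul, ModularGroup.coe_T_zpow, Matrix.mul_apply,
    Fin.sum_univ_two]

theorem inversion_conj_of_lower_left {H : SL(2, ℤ)} (ht : H 0 0 + H 1 1 = 0)
    (hr : H 1 0 = 1 ∨ H 1 0 = -1) :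
    ∃ k : ℤ, toPSL H = translation ^ k * inversion * (translation ^ k)⁻¹ := by
  have key : ∀ H : SL(2, ℤ), H 0 0 + H 1 1 = 0 → H 1 0 = 1 →
      ∃ k : ℤ, toPSL H = translation ^ k * inversion * (translation ^ k)⁻¹ := by
    intro H ht hr
    refine ⟨H 0 0, ?_⟩
    have h1 : H 1 1 = -H 0 0 := by linarith
    rw [ModularGroup.g_eq_of_c_eq_one hr]
    have h2 := congrArg toPSL (ModularGroup.g_eq_of_c_eq_one hr)
    rw [← ModularGroup.g_eq_of_c_eq_one hr, h2, h1, ← zpow_neg]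
    rfl
  rcases hr with hr | hr
  · exact key H ht hr
  · obtain ⟨k, hk⟩ := key (-H) (by simp; linarith) (by simp [hr])
    exact ⟨k, by rw [← hk, toPSL_eq_iff]; right; simp⟩

/-- Move `a` to `∞`. There `g⁻¹ * h` becomes a translation by `n`. If `G` represents `g`, with lower
left entry `r`, then the swap has trace `tr G + r n = 0`, while `tr G = ±1` for a rotation of order
three. Hence `r` and `n` are `±1`, and `Φ` contains a conjugate of both standard generators. -/
theorem eq_top_of_cycle_of_swap {Φ : Subgroup PSL(2, ℤ)} {g h : PSL(2, ℤ)} (hg : g ∈ Φ)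
    (hh : h ∈ Φ) {a b : OnePoint ℝ} (hab : a ≠ b) (ha : IsRationalEnd a) (h3 : g ^ 3 = 1)
    (hga : g • a = b) (hha : h • a = b) (hhb : h • b = a) : Φ = ⊤ := by
  obtain ⟨γ, rfl⟩ := ha
  obtain ⟨G, hG⟩ := exists_mk (γ⁻¹ * g * γ)
  obtain ⟨H, hH⟩ := exists_mk (γ⁻¹ * h * γ)
  obtain ⟨n, hn⟩ := eq_translation_of_fixes_infty (g := γ⁻¹ * (g⁻¹ * h) * γ) (by
    rw [mul_smul, mul_smul, mul_smul, hha, ← hga, inv_smul_smul, inv_smul_smul])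
  have hHG : toPSL H = toPSL (G * ModularGroup.T ^ n) := by
    rw [toPSL_mul, ← translation_zpow, ← hn, hG, hH]; group
  have htr : H 0 0 + H 1 1 = 0 := by
    refine trace_of_swaps (a := OnePoint.infty) (b := γ⁻¹ • b) (fun h => hab ?_) ?_ ?_
    · rw [h, smul_inv_smul]
    · rw [hH, mul_smul, mul_smul, hha]
    · rw [hH, mul_smul, mul_smul, smul_inv_smul, hhb, inv_smul_smul]
  have htr' : (G * ModularGroup.T ^ n) 0 0 + (G * ModularGroup.T ^ n) 1 1 = 0 ∧
      ((G * ModularGroup.T ^ n) 1 0 = H 1 0 ∨ (G * ModularGroup.T ^ n) 1 0 = -H 1 0) := by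
    rcases toPSL_eq_iff.mp hHG with h | h
    · rw [← h]; exact ⟨htr, Or.inl rfl⟩
    · have h' : G * ModularGroup.T ^ n = -H := by rw [h, neg_neg]
      rw [h']; simp; linarith
  obtain ⟨e0, e1, e2⟩ := entries_mul_T_zpow G n
  rw [e0, e1, e2] at htr'
  have hG3 : (G 0 0 + G 1 1) ^ 2 = 1 := by
    refine trace_sq_of_pow_three ?_ ?_
    · rw [hG]
      have := conj_pow (i := 3) (a := γ⁻¹) (b := g)
      rw [inv_inv] at this
      rw [this, h3]; simp
    · rw [hG]
      intro h
      apply hab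
      have : g = γ * (γ⁻¹ * g * γ) * γ⁻¹ := by group
      rw [← hga, this, h]; simp
  have hu : (G 1 0 * n) * (G 1 0 * n) = 1 := by
    have : G 1 0 * n = -(G 0 0 + G 1 1) := by linarith [htr'.1]
    rw [this]; linear_combination hG3
  have hr := Int.isUnit_iff.mp (IsUnit.of_mul_eq_one (a := G 1 0) (n * (G 1 0 * n)) (by linarith))
  have hn' := Int.isUnit_iff.mp (IsUnit.of_mul_eq_one (a := n) (G 1 0 * (G 1 0 * n)) (by linarith))
  obtain ⟨k, hk⟩ := inversion_conj_of_lower_left htr (by omega)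
  have hT : γ * translation ^ n * γ⁻¹ ∈ Φ := by
    rw [← hn]
    have := mul_mem (inv_mem hg) hh
    simpa [mul_assoc] using this
  refine eq_top_of_conj (γ := γ * translation ^ k) ?_ ?_
  · have : γ * translation ^ k * inversion * (γ * translation ^ k)⁻¹ = h := by
      have : γ * translation ^ k * inversion * (γ * translation ^ k)⁻¹ =
        γ * (translation ^ k * inversion * (translation ^ k)⁻¹) * γ⁻¹ := by group
      rw [this, ← hk, hH]; group
    rw [this]; exact hh
  · have : γ * translation ^ k * translation * (γ * translation ^ k)⁻¹ =
        γ * translation * γ⁻¹ := by group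
    rw [this]
    rcases hn' with rfl | rfl
    · simpa using hT
    · have := inv_mem hT
      simpa [mul_assoc] using this

theorem conj_translation_inv_two :
    inversion * translation⁻¹ * inversion * translation * inversion * translation =
      inversion * translation⁻¹ * translation⁻¹ * inversion := by
  have h := rotationThree_pow
  have hs := inversion_mul_self
  have h2 : inversion * translation * inversion * translation = translation⁻¹ * inversion := by
    rw [eq_inv_mul_iff_mul_eq, ← mul_inv_eq_one, inversion_inv, ← h, rotationThree, pow_succ, pow_two]
    group
  calc _ = inversion * translation⁻¹ * (inversion * translation * inversion * translation) := by group
    _ = _ := by rw [h2]; group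

theorem toPSL_eq_of_entries {A B : SL(2, ℤ)} (h00 : A 0 0 = B 0 0) (h01 : A 0 1 = B 0 1)
    (h10 : A 1 0 = B 1 0) (h11 : A 1 1 = B 1 1) : toPSL A = toPSL B := by
  congr 1
  ext i j
  fin_cases i <;> fin_cases j <;> assumption

theorem toPSL_eq_of_entries_neg {A B : SL(2, ℤ)} (h00 : A 0 0 = -B 0 0) (h01 : A 0 1 = -B 0 1)
    (h10 : A 1 0 = -B 1 0) (h11 : A 1 1 = -B 1 1) : toPSL A = toPSL B := by
  rw [toPSL_eq_iff]
  right
  ext i j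
  fin_cases i <;> fin_cases j <;> simpa

theorem toPSL_two_eq {A : SL(2, ℤ)} (h00 : A 0 0 = 1) (h01 : A 0 1 = -1) (h10 : A 1 0 = 2)
    (h11 : A 1 1 = -1) :
    toPSL A = inversion * translation⁻¹ * inversion * translation * inversion := by
  change _ = toPSL (ModularGroup.S * ModularGroup.T⁻¹ * ModularGroup.S * ModularGroup.T *
    ModularGroup.S)
  apply toPSL_eq_of_entries_neg <;>
    simp [Matrix.SpecialLinearGroup.coe_mul, ModularGroup.coe_T, ModularGroup.coe_S,
      Matrix.mul_apply, Fin.sum_univ_two, h00, h01, h10, h11]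

/-- Modulo conjugation by translations there is only one such involution: the determinant makes the
upper left entry odd, say `2 j + 1`, and `j` is the translation that normalizes it. -/
theorem two_conj_of_lower_left {H : SL(2, ℤ)} (ht : H 0 0 + H 1 1 = 0)
    (hr : H 1 0 = 2 ∨ H 1 0 = -2) :
    ∃ k : ℤ, toPSL H = translation ^ k * (inversion * translation⁻¹ * inversion * translation *
      inversion) * (translation ^ k)⁻¹ := by
  have key : ∀ H : SL(2, ℤ), H 0 0 + H 1 1 = 0 → H 1 0 = 2 → ∃ k : ℤ, toPSL H = translation ^ k *
      (inversion * translation⁻¹ * inversion * translation * inversion) * (translation ^ k)⁻¹ := by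
    intro H ht hr
    have hdet := H.det_coe
    rw [Matrix.det_fin_two, hr] at hdet
    have h1 : H 1 1 = -H 0 0 := by linarith
    rw [h1] at hdet
    obtain ⟨j, hj⟩ : ∃ j, H 0 0 = 2 * j + 1 := by
      rcases Int.even_or_odd' (H 0 0) with ⟨j, hj | hj⟩
      · rw [hj] at hdet
        have : 2 * (-2 * j * j - H 0 1) = 1 := by linarith
        omega
      · exact ⟨j, hj⟩
    refine ⟨j, ?_⟩
    rw [← zpow_neg]
    change _ = toPSL (ModularGroup.T ^ j * (ModularGroup.S * ModularGroup.T⁻¹ * ModularGroup.S *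
      ModularGroup.T * ModularGroup.S) * ModularGroup.T ^ (-j))
    have h01 : H 0 1 = -(2 * j * j + 2 * j + 1) := by
      rw [hj] at hdet
      linarith
    apply toPSL_eq_of_entries_neg <;>
      simp [Matrix.SpecialLinearGroup.coe_mul, ModularGroup.coe_T_zpow, ModularGroup.coe_T,
        ModularGroup.coe_S, Matrix.mul_apply, Fin.sum_univ_two, h1, hr, hj,
        h01] <;> ring
  rcases hr with hr | hr
  · exact key H ht hr
  · obtain ⟨k, hk⟩ := key (-H) (by simp; linarith) (by simp [hr])
    exact ⟨k, by rw [← hk, toPSL_eq_iff]; right; simp⟩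

/-- Conjugated to `∞`, such an element is a translation up to sign. -/
theorem trace_of_fixes_rational {A : SL(2, ℤ)} {a : OnePoint ℝ} (ha : IsRationalEnd a)
    (h : toPSL A • a = a) : A 0 0 + A 1 1 = 2 ∨ A 0 0 + A 1 1 = -2 := by
  obtain ⟨δ, rfl⟩ := ha
  obtain ⟨D, rfl⟩ := exists_mk δ
  obtain ⟨k, hk⟩ := eq_translation_of_fixes_infty (g := (toPSL D)⁻¹ * toPSL A * toPSL D) (by
    rw [mul_smul, mul_smul, h, inv_smul_smul])
  have hA : toPSL (A * D) = toPSL (D * ModularGroup.T ^ k) := by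
    change toPSL A * toPSL D = toPSL D * translation ^ k
    rw [← hk]; group
  have hdet := D.det_coe
  rw [Matrix.det_fin_two] at hdet
  have hent : ∀ σ : ℤ, (∀ i j, (A * D) i j = σ * (D * ModularGroup.T ^ k) i j) →
      A 0 0 + A 1 1 = 2 * σ := by
    intro σ h
    have e1 := h 0 0
    have e2 := h 0 1
    have e3 := h 1 0
    have e4 := h 1 1
    simp [Matrix.SpecialLinearGroup.coe_mul, ModularGroup.coe_T_zpow, Matrix.mul_apply,
      Fin.sum_univ_two] at e1 e2 e3 e4
    linear_combination -(A 0 0 + A 1 1 - 2 * σ) * hdet + e1 * D 1 1 - e2 * D 1 0 + e4 * D 0 0 -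
      e3 * D 0 1
  rcases toPSL_eq_iff.mp hA with h1 | h1
  · exact Or.inl (by simpa using hent 1 fun i j => by rw [h1, one_mul])
  · exact Or.inr (by simpa using hent (-1) fun i j => by rw [h1]; simp)

/-- Move `c` to `∞`, so that `g` becomes a translation by `n` and `h` a matrix of trace 0 with lower
left entry `r`. The product `h * g` fixes the cusp `a`, so its trace `r n` is `±2`. Either
factorization gives a conjugate of the group generated by `inversion` and `translation ^ 2`; the
absence of rotations of order three excludes the full group. -/
theorem index_eq_three_of_glued {Φ : Subgroup PSL(2, ℤ)} {g h : PSL(2, ℤ)} (hg : g ∈ Φ) (hh : h ∈ Φ)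
    {a b c : OnePoint ℝ} (hab : a ≠ b) (ha : IsRationalEnd a) (hc : IsRationalEnd c)
    (hgc : g • c = c) (hga : g • a = b) (hha : h • a = b) (hhb : h • b = a)
    (h3 : ∀ k ∈ Φ, k ^ 3 = 1 → (∃ z : ℍ, k • z = z) → k = 1) : Φ.index = 3 := by
  obtain ⟨γ, rfl⟩ := hc
  obtain ⟨n, hn⟩ := eq_translation_of_fixes_infty (g := γ⁻¹ * g * γ) (by
    rw [mul_smul, mul_smul, hgc, inv_smul_smul])
  obtain ⟨H, hH⟩ := exists_mk (γ⁻¹ * h * γ)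
  have htr : H 0 0 + H 1 1 = 0 := by
    refine trace_of_swaps (a := γ⁻¹ • a) (b := γ⁻¹ • b)
      (fun h => hab (MulAction.injective γ⁻¹ h)) ?_ ?_
    · rw [hH, mul_smul, mul_smul, smul_inv_smul, hha]
    · rw [hH, mul_smul, mul_smul, smul_inv_smul, hhb]
  have ha' : IsRationalEnd (γ⁻¹ • a) := by
    obtain ⟨δ, rfl⟩ := ha
    exact ⟨γ⁻¹ * δ, mul_smul _ _ _⟩
  have htr2 := trace_of_fixes_rational (A := H * ModularGroup.T ^ n) ha' (by
    rw [toPSL_mul, ← translation_zpow, ← hn, hH]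
    rw [← mul_smul, show γ⁻¹ * h * γ * (γ⁻¹ * g * γ) * γ⁻¹ = γ⁻¹ * (h * g) by group, mul_smul,
      mul_smul, hga, hhb])
  obtain ⟨e0, e1, e2⟩ := entries_mul_T_zpow H n
  rw [e0, e2] at htr2
  have hrn : H 1 0 * n = 2 ∨ H 1 0 * n = -2 := by
    rcases htr2 with h | h
    · left; linarith
    · right; linarith
  have hnot : ∀ δ : PSL(2, ℤ), δ * rotationThree * δ⁻¹ ∉ Φ := by
    intro δ hmem
    have h1 := h3 _ hmem (by rw [conj_pow, rotationThree_pow]; simp) (by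
      obtain ⟨z, hz⟩ := rotationThree_fixes
      exact ⟨δ • z, by rw [mul_smul, mul_smul, inv_smul_smul, hz]⟩)
    rw [mul_inv_eq_one, mul_eq_left] at h1
    have h2 : toPSL (ModularGroup.T * ModularGroup.S) = 1 := h1
    rw [toPSL_eq_one_iff] at h2
    simp [Matrix.SpecialLinearGroup.coe_mul, ModularGroup.coe_T, ModularGroup.coe_S,
      Matrix.mul_apply, Fin.sum_univ_two] at h2
  have hΦT : ∀ m : ℤ, (m = n ∨ m = -n) → γ * translation ^ m * γ⁻¹ ∈ Φ := by
    have h1 : γ * translation ^ n * γ⁻¹ ∈ Φ := by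
      rw [← hn]
      simpa [mul_assoc] using hg
    rintro m (rfl | rfl)
    · exact h1
    · have := inv_mem h1
      simpa [mul_assoc] using this
  have hhH : h = γ * toPSL H * γ⁻¹ := by rw [hH]; group
  have hdvd : H 1 0 ∣ 2 := by
    rcases hrn with h | h
    · exact ⟨n, h.symm⟩
    · exact ⟨-n, by linarith⟩
  have hle := Int.le_of_dvd two_pos hdvd
  have hle' := Int.le_of_dvd two_pos (neg_dvd.mpr hdvd)
  have hne : H 1 0 ≠ 0 := by
    intro h
    rw [h] at hrn
    omega
  have hcases : (H 1 0 = 1 ∨ H 1 0 = -1) ∧ (2 = n ∨ 2 = -n) ∨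
      (H 1 0 = 2 ∨ H 1 0 = -2) ∧ (1 = n ∨ 1 = -n) := by
    generalize H 1 0 = r at *
    have : r = -2 ∨ r = -1 ∨ r = 1 ∨ r = 2 := by omega
    rcases this with rfl | rfl | rfl | rfl <;> omega
  rcases hcases with ⟨hr, hn2⟩ | ⟨hr, hn1⟩
  · obtain ⟨k, hk⟩ := inversion_conj_of_lower_left htr hr
    refine index_eq_three (γ := γ * translation ^ k) ?_ ?_ (hnot _)
    · have : γ * translation ^ k * inversion * (γ * translation ^ k)⁻¹ = h := by
        rw [hhH, hk]; group
      rw [this]; exact hh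
    · have : γ * translation ^ k * translation ^ 2 * (γ * translation ^ k)⁻¹ =
          γ * translation ^ (2 : ℤ) * γ⁻¹ := by group
      rw [this]
      exact hΦT 2 (by omega)
  -- Here `n = ±1`, and the cusp of width two is not `c` but another one, to which `inversion *
  -- translation⁻¹` moves; `conj_translation_inv_two` exhibits its generator as a product of `h` and
  -- the translation at `c`.
  · obtain ⟨k, hk⟩ := two_conj_of_lower_left htr hr
    refine index_eq_three (γ := γ * translation ^ k * (inversion * translation⁻¹)) ?_ ?_ (hnot _)
    · have : γ * translation ^ k * (inversion * translation⁻¹) * inversion *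
          (γ * translation ^ k * (inversion * translation⁻¹))⁻¹ = h := by
        rw [hhH, hk, mul_inv_rev, mul_inv_rev, inversion_inv]; group
      rw [this]; exact hh
    · have : (γ * translation ^ k * (inversion * translation⁻¹) * translation ^ 2 *
          (γ * translation ^ k * (inversion * translation⁻¹))⁻¹)⁻¹ =
          h * (γ * translation ^ (1 : ℤ) * γ⁻¹) := by
        have e := conj_translation_inv_two
        calc _ = γ * translation ^ k * (inversion * translation⁻¹ * translation⁻¹ * inversion⁻¹) *
              (translation ^ k)⁻¹ * γ⁻¹ := by group
          _ = _ := by rw [inversion_inv, ← e, hhH, hk]; group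
      rw [← inv_mem_iff, this]
      exact mul_mem hh (hΦT 1 (by omega))

/-! ### The group `Γ₃` -/

/-- The generators are the conjugates of `inversion` by the powers of a rotation of order three.
This form makes normality visible. -/
theorem Gamma3_eq : Gamma3 = Subgroup.closure {inversion, rotationThree * inversion * rotationThree⁻¹,
    rotationThree⁻¹ * inversion * rotationThree} := by
  have h1 : ∀ A : SL(2, ℤ), A 0 0 = 1 → A 0 1 = -2 → A 1 0 = 1 → A 1 1 = -1 → toPSL A =
      rotationThree * inversion * rotationThree⁻¹ := by
    intro A h00 h01 h10 h11
    have h : rotationThree * inversion * rotationThree⁻¹ = translation * inversion * translation⁻¹ := by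
      rw [rotationThree, mul_inv_rev]; group
    rw [h]
    change _ = toPSL (ModularGroup.T * ModularGroup.S * ModularGroup.T⁻¹)
    apply toPSL_eq_of_entries <;>
      simp [Matrix.SpecialLinearGroup.coe_mul, ModularGroup.coe_T, ModularGroup.coe_S,
        Matrix.mul_apply, Fin.sum_univ_two, h00, h01, h10, h11]
  have h2 : rotationThree⁻¹ * inversion * rotationThree =
      inversion * translation⁻¹ * inversion * translation * inversion := by
    rw [rotationThree, mul_inv_rev, inversion_inv]; group
  rw [h2, ← h1 ⟨!![1, -2; 1, -1], by simp [Matrix.det_fin_two]⟩ rfl rfl rfl rfl,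
    ← toPSL_two_eq (A := ⟨!![1, -1; 2, -1], by simp [Matrix.det_fin_two]⟩) rfl rfl rfl rfl]
  rfl

theorem inversion_mem_Gamma3 : inversion ∈ Gamma3 := by
  rw [Gamma3_eq]; exact Subgroup.subset_closure (by simp)

/-- It suffices to conjugate by the generators of the modular group: `rotationThree` permutes the
three generators of `Γ₃` cyclically, and `inversion` lies in `Γ₃`. -/
theorem Gamma3_normal : Gamma3.Normal := by
  have hu := rotationThree_pow
  set u := rotationThree with hu'
  have hs := inversion_mem_Gamma3
  have e1 : u * inversion * u⁻¹ ∈ Gamma3 := by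
    rw [Gamma3_eq]; exact Subgroup.subset_closure (by simp [hu'])
  have e2 : u⁻¹ * inversion * u ∈ Gamma3 := by
    rw [Gamma3_eq]; exact Subgroup.subset_closure (by simp [hu'])
  have hsq : u * u = u⁻¹ := eq_inv_of_mul_eq_one_left (by rw [← hu, pow_succ, pow_two])
  have hconj : ∀ g ∈ Gamma3, u * g * u⁻¹ ∈ Gamma3 := by
    intro g hg
    have : Gamma3 ≤ Gamma3.comap (MulAut.conj u).toMonoidHom := by
      conv_lhs => rw [Gamma3_eq]
      rw [Subgroup.closure_le]
      rintro _ (rfl | rfl | rfl)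
      · exact e1
      · change u * (u * inversion * u⁻¹) * u⁻¹ ∈ Gamma3
        have : u * (u * inversion * u⁻¹) * u⁻¹ = (u * u) * inversion * (u * u)⁻¹ := by group
        rw [this, hsq, inv_inv]
        exact e2
      · change u * (u⁻¹ * inversion * u) * u⁻¹ ∈ Gamma3
        have : u * (u⁻¹ * inversion * u) * u⁻¹ = inversion := by group
        rw [this]; exact hs
    exact this hg
  have hall : ∀ γ : PSL(2, ℤ), ∀ g ∈ Gamma3, γ * g * γ⁻¹ ∈ Gamma3 := by
    intro γ
    have hγ : γ ∈ Subgroup.closure {inversion, u} := by rw [closure_rotations]; trivial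
    have hmul : ∀ x y : PSL(2, ℤ), (∀ g ∈ Gamma3, x * g * x⁻¹ ∈ Gamma3) →
        (∀ g ∈ Gamma3, y * g * y⁻¹ ∈ Gamma3) → ∀ g ∈ Gamma3, x * y * g * (x * y)⁻¹ ∈ Gamma3 := by
      intro x y hx hy g hg
      have : x * y * g * (x * y)⁻¹ = x * (y * g * y⁻¹) * x⁻¹ := by group
      rw [this]
      exact hx _ (hy _ hg)
    have hS : ∀ g ∈ Gamma3, inversion * g * inversion⁻¹ ∈ Gamma3 := fun g hg =>
      mul_mem (mul_mem hs hg) (inv_mem hs)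
    induction hγ using Subgroup.closure_induction_left with
    | one => intro g hg; simpa using hg
    | mul_left x hx y hy ih =>
      rcases hx with rfl | rfl
      · exact hmul _ _ hS ih
      · exact hmul _ _ hconj ih
    | inv_mul_cancel x hx y hy ih =>
      rcases hx with rfl | rfl
      · rw [inversion_inv]; exact hmul _ _ hS ih
      · rw [← hsq]; exact hmul _ _ (hmul _ _ hconj hconj) ih
  exact ⟨fun g hg γ => hall γ g hg⟩

/-- All rotations of order two are conjugate. -/
theorem exists_conj_inversion {h : PSL(2, ℤ)} (hh : h * h = 1) (h1 : h ≠ 1) {m : ℍ}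
    (hm : h • m = m) : ∃ δ : PSL(2, ℤ), h = δ * inversion * δ⁻¹ := by
  obtain ⟨A, hA⟩ := ModularGroup.exists_smul_mem_fd m
  have key : ∀ δ : PSL(2, ℤ), ∃ H : SL(2, ℤ), toPSL H = δ * h * δ⁻¹ ∧ toPSL H ≠ 1 ∧
      toPSL (H * H) = 1 ∧ H • (δ • m) = δ • m := by
    intro δ
    obtain ⟨H, hH⟩ := exists_mk (δ * h * δ⁻¹)
    refine ⟨H, hH, ?_, ?_, ?_⟩
    · rw [hH]; intro h'
      apply h1
      rw [mul_inv_eq_one, mul_eq_left] at h'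
      exact h'
    · rw [toPSL_mul, hH]
      calc δ * h * δ⁻¹ * (δ * h * δ⁻¹) = δ * (h * h) * δ⁻¹ := by group
        _ = 1 := by rw [hh]; simp
    · change toPSL H • δ • m = δ • m
      rw [hH, mul_smul, mul_smul, inv_smul_smul, hm]
  -- In the fundamental domain only `i`, `ρ` and `ρ + 1` have nontrivial stabilizers in the
  -- projective group. The stabilizer of `ρ` has order three there, so an involution fixes no
  -- translate of `ρ`, and `m` is equivalent to `i`.
  have hρ : ∀ δ : PSL(2, ℤ), δ • m ≠ UpperHalfPlane.ρ := by
    intro δ hδ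
    obtain ⟨H, -, hne, hsq, hfix⟩ := key δ
    rw [hδ, ModularGroup.stabilizer_ρ] at hfix
    simp only [Finset.mem_insert, Finset.mem_singleton] at hfix
    rcases hfix with rfl | rfl | rfl | rfl | rfl | rfl <;>
      simp [toPSL_eq_one_iff, Matrix.SpecialLinearGroup.coe_mul, ModularGroup.coe_T,
        ModularGroup.coe_S, Matrix.mul_apply, Fin.sum_univ_two] at hne hsq
  obtain ⟨H, hH, hne, hsq, hfix⟩ := key (toPSL A)
  by_cases hI : toPSL A • m = UpperHalfPlane.I
  · rw [hI, ModularGroup.stabilizer_I] at hfix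
    simp only [Finset.mem_insert, Finset.mem_singleton] at hfix
    refine ⟨(toPSL A)⁻¹, ?_⟩
    have : toPSL H = inversion := by
      rw [inversion, toPSL_eq_iff]
      rcases hfix with rfl | rfl | rfl | rfl
      · exact absurd (toPSL_eq_one_iff.mpr (by simp)) hne
      · exact absurd (toPSL_eq_one_iff.mpr (by simp)) hne
      · exact Or.inl rfl
      · exact Or.inr rfl
    rw [← this, hH]; group
  · exfalso
    have hρ' : A • m ≠ (1 : ℝ) +ᵥ UpperHalfPlane.ρ := by
      intro h'
      apply hρ (translation⁻¹ * toPSL A)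
      rw [mul_smul, inv_smul_eq_iff]
      change A • m = ModularGroup.T • UpperHalfPlane.ρ
      rw [UpperHalfPlane.modular_T_smul, ← h']
    rcases ModularGroup.stabilizer_of_ne hA hfix hI (hρ (toPSL A)) hρ' with rfl | rfl
    · exact hne (toPSL_eq_one_iff.mpr (by simp))
    · exact hne (toPSL_eq_one_iff.mpr (by simp))

theorem swap_mem_Gamma3 {h : PSL(2, ℤ)} {a b : OnePoint ℝ} (hab : a ≠ b) (ha : h • a = b)
    (hb : h • b = a) : h ∈ Gamma3 := by
  obtain ⟨h1, h2, m, -, hm⟩ := rotation_of_swaps hab ha hb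
  obtain ⟨δ, rfl⟩ := exists_conj_inversion h1 h2 hm
  exact Gamma3_normal.conj_mem _ inversion_mem_Gamma3 δ

/-- The quaternion group, in the matrices over the field with three elements. -/
def quaternionMod3 : Finset (ZMod 3 × ZMod 3 × ZMod 3 × ZMod 3) :=
  {(1, 0, 0, 1), (2, 0, 0, 2), (0, 2, 1, 0), (0, 1, 2, 0), (1, 1, 1, 2), (2, 2, 2, 1),
    (1, 2, 2, 2), (2, 1, 1, 1)}

theorem quaternionMod3_mul : ∀ x ∈ quaternionMod3, ∀ y ∈ quaternionMod3,
    (x.1 * y.1 + x.2.1 * y.2.2.1, x.1 * y.2.1 + x.2.1 * y.2.2.2,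
      x.2.2.1 * y.1 + x.2.2.2 * y.2.2.1, x.2.2.1 * y.2.1 + x.2.2.2 * y.2.2.2) ∈ quaternionMod3 := by
  decide

theorem quaternionMod3_inv : ∀ x ∈ quaternionMod3,
    (x.2.2.2, -x.2.1, -x.2.2.1, x.1) ∈ quaternionMod3 := by decide

theorem quaternionMod3_neg : ∀ x ∈ quaternionMod3,
    (-x.1, -x.2.1, -x.2.2.1, -x.2.2.2) ∈ quaternionMod3 := by decide

/-- The entries of an integral matrix modulo 3. -/
def entriesMod3 (A : SL(2, ℤ)) : ZMod 3 × ZMod 3 × ZMod 3 × ZMod 3 := (A 0 0, A 0 1, A 1 0, A 1 1)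

theorem mem_quaternionMod3_of_mem_Gamma3 {A : SL(2, ℤ)} (h : toPSL A ∈ Gamma3) :
    entriesMod3 A ∈ quaternionMod3 := by
  suffices h' : ∀ g ∈ Gamma3, ∃ A, toPSL A = g ∧ entriesMod3 A ∈ quaternionMod3 by
    obtain ⟨B, hB, hmem⟩ := h' _ h
    rcases toPSL_eq_iff.mp hB with rfl | rfl
    · exact hmem
    · have := quaternionMod3_neg _ hmem
      simpa [entriesMod3] using this
  intro g hg
  induction hg using Subgroup.closure_induction with
  | mem x hx =>
    rcases hx with rfl | rfl | rfl
    · exact ⟨_, rfl, by decide⟩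
    · exact ⟨_, rfl, by decide⟩
    · exact ⟨_, rfl, by decide⟩
  | one => exact ⟨1, rfl, by decide⟩
  | mul x y _ _ hx hy =>
    obtain ⟨A, rfl, hA⟩ := hx
    obtain ⟨B, rfl, hB⟩ := hy
    refine ⟨A * B, rfl, ?_⟩
    have := quaternionMod3_mul _ hA _ hB
    simpa [entriesMod3, Matrix.SpecialLinearGroup.coe_mul, Matrix.mul_apply, Fin.sum_univ_two]
      using this
  | inv x _ hx =>
    obtain ⟨A, rfl, hA⟩ := hx
    refine ⟨A⁻¹, rfl, ?_⟩
    have := quaternionMod3_inv _ hA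
    simpa [entriesMod3, Matrix.SpecialLinearGroup.coe_inv, Matrix.adjugate_fin_two] using this

theorem three_dvd_iff (n : ℤ) : (3 : ℤ) ∣ n ↔ (n : ZMod 3) = 0 :=
  (ZMod.intCast_zmod_eq_zero_iff_dvd n 3).symm

/-- Modulo 3 the group `Γ₃` lands in the quaternion group, which contains no nontrivial unipotent
matrix. -/
theorem three_dvd_of_translation_mem {k : ℤ} (h : translation ^ k ∈ Gamma3) : (3 : ℤ) ∣ k := by
  have h1 := mem_quaternionMod3_of_mem_Gamma3 (A := ModularGroup.T ^ k) h
  have h2 : entriesMod3 (ModularGroup.T ^ k) = (1, (k : ZMod 3), 0, 1) := by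
    simp [entriesMod3, ModularGroup.coe_T_zpow]
  rw [h2] at h1
  have h3 : ∀ x : ZMod 3, (1, x, 0, 1) ∈ quaternionMod3 → x = 0 := by decide
  exact (three_dvd_iff k).mpr (h3 _ h1)

/-! ### The Markov equation and cusps of width three -/

/-- Vieta jumping for the generalized Markov equation. -/
theorem markov_le_three {m : ℤ} : ∀ (s : ℕ) (x y z : ℤ), 0 < x → 0 < y → 0 < z →
    x + y + z = s → x ^ 2 + y ^ 2 + z ^ 2 = m * x * y * z → m ≤ 3 := by
  intro s
  induction s using Nat.strong_induction_on with
  | _ s ih =>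
  have key : ∀ x y z : ℤ, 0 < x → 0 < y → 0 < z → x ≤ y → y ≤ z → x + y + z = s →
      x ^ 2 + y ^ 2 + z ^ 2 = m * x * y * z → m ≤ 3 := by
    intro x y z hx hy hz hxy hyz hs h
    by_contra! hm
    have h1 : 4 ≤ m * x := by nlinarith
    -- `m * x * y - z` is the second root of the equation in `z`. For `m ≥ 4` the quadratic is
    -- negative at `y`, so `y` lies strictly between the roots; replacing the largest entry by the
    -- other root, which is positive, decreases the sum.
    have h2 : 0 < y - (m * x * y - z) := by
      have : (y - z) * (y - (m * x * y - z)) < 0 := by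
        have e : (y - z) * (y - (m * x * y - z)) = 2 * y ^ 2 + x ^ 2 - m * x * y ^ 2 := by
          linear_combination -h
        rw [e]
        nlinarith [mul_pos hy hy, mul_le_mul_of_nonneg_right h1 (mul_pos hy hy).le]
      by_contra! hcon
      exact absurd this (not_lt.mpr (mul_nonneg_of_nonpos_of_nonpos (by linarith) hcon))
    have h3 : 0 < m * x * y - z := by
      have : 0 < z * (m * x * y - z) := by
        have e : z * (m * x * y - z) = x ^ 2 + y ^ 2 := by linear_combination -h
        rw [e]; positivity
      exact pos_of_mul_pos_right this hz.le
    have := ih (x + y + (m * x * y - z)).toNat (by omega) x y (m * x * y - z) hx hy h3 (by omega)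
      (by linear_combination h)
    omega
  intro x y z hx hy hz hs h
  rcases le_total x y with h1 | h1 <;> rcases le_total y z with h2 | h2 <;>
    rcases le_total x z with h3 | h3
  · exact key x y z hx hy hz h1 h2 hs h
  · exact key x y z hx hy hz h1 h2 hs h
  · exact key x z y hx hz hy h3 h2 (by linarith) (by linear_combination h)
  · exact key z x y hz hx hy h3 h1 (by linarith) (by linear_combination h)
  · exact key y x z hy hx hz h1 h3 (by linarith) (by linear_combination h)
  · exact key y z x hy hz hx h2 h3 (by linarith) (by linear_combination h)
  · exact key z y x hz hy hx h2 h1 (by linarith) (by linear_combination h)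
  · exact key z y x hz hy hx h2 h1 (by linarith) (by linear_combination h)

/-- Modulo 3 the equation has no solution with `r`, `r'` and `n` all nonzero, so 3 divides `n`.
Clearly `n ≠ 0`, and Vieta jumping for the absolute values gives `|n| ≤ 3`. -/
theorem eq_three_of_markov {D r r' n : ℤ} (hr : r ≠ 0) (hr' : r' ≠ 0) (hr3 : ¬(3 : ℤ) ∣ r)
    (hr3' : ¬(3 : ℤ) ∣ r') (h : D ^ 2 + r ^ 2 + r' ^ 2 + n * D * r * r' = 0) : n = 3 ∨ n = -3 := by
  have hpos : 0 < r ^ 2 := by positivity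
  have hD : D ≠ 0 := by
    rintro rfl
    have : 0 < r' ^ 2 := by positivity
    linarith
  have h3 : (3 : ℤ) ∣ n := by
    have key : ∀ D r r' n : ZMod 3, r ≠ 0 → r' ≠ 0 → D ^ 2 + r ^ 2 + r' ^ 2 + n * D * r * r' = 0 →
        n = 0 := by decide
    rw [three_dvd_iff]
    refine key D r r' n ?_ ?_ ?_
    · rwa [ne_eq, ← three_dvd_iff]
    · rwa [ne_eq, ← three_dvd_iff]
    · exact_mod_cast congrArg (Int.cast : ℤ → ZMod 3) h
  have hn : n ≠ 0 := by
    rintro rfl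
    nlinarith [sq_nonneg D, sq_nonneg r']
  have habs : |D| ^ 2 + |r| ^ 2 + |r'| ^ 2 = |n| * |D| * |r| * |r'| := by
    rw [sq_abs, sq_abs, sq_abs, ← abs_mul, ← abs_mul, ← abs_mul]
    rw [abs_of_nonpos (by nlinarith [sq_nonneg D, sq_nonneg r'])]
    linarith
  have hle := markov_le_three (|D| + |r| + |r'|).toNat |D| |r| |r'| (abs_pos.mpr hD)
    (abs_pos.mpr hr) (abs_pos.mpr hr') (by rw [Int.toNat_of_nonneg (by positivity)]) habs
  rw [abs_le] at hle
  omega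

/-- Otherwise the determinant would make `-1` a square modulo 3. -/
theorem not_three_dvd_of_trace {A : SL(2, ℤ)} (h : A 0 0 + A 1 1 = 0) : ¬(3 : ℤ) ∣ A 1 0 := by
  have hdet := A.det_coe
  rw [Matrix.det_fin_two] at hdet
  rw [three_dvd_iff]
  have key : ∀ a b c d : ZMod 3, a * d - b * c = 1 → a + d = 0 → c ≠ 0 := by decide
  refine key (A 0 0) (A 0 1) (A 1 0) (A 1 1) ?_ ?_
  · exact_mod_cast congrArg (Int.cast : ℤ → ZMod 3) hdet
  · exact_mod_cast congrArg (Int.cast : ℤ → ZMod 3) h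

theorem lower_left_ne_zero {A : SL(2, ℤ)}
    (h : toPSL A • (OnePoint.infty : OnePoint ℝ) ≠ OnePoint.infty) : A 1 0 ≠ 0 := by
  intro h0
  apply h
  rw [toPSL_smul_boundary, OnePoint.smul_infty_eq_self_iff, mapGL_apply_entry, h0]
  simp

/-- If the sides of a triangle with rational vertices are swapped by elements of `Φ`, then
the vertices are cusps of width three. -/
theorem translation_three_mem {Φ : Subgroup PSL(2, ℤ)} {γ h₁ h₂ h₃ : PSL(2, ℤ)} (m₁ : h₁ ∈ Φ)
    (m₂ : h₂ ∈ Φ) (m₃ : h₃ ∈ Φ) {b c : OnePoint ℝ} (hab : γ • OnePoint.infty ≠ b) (hbc : b ≠ c)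
    (hac : γ • OnePoint.infty ≠ c) (h1 : h₁ • γ • OnePoint.infty = b)
    (h1' : h₁ • b = γ • OnePoint.infty) (h2 : h₂ • γ • OnePoint.infty = c)
    (h2' : h₂ • c = γ • OnePoint.infty) (h3 : h₃ • b = c) (h3' : h₃ • c = b) :
    γ * translation ^ (3 : ℤ) * γ⁻¹ ∈ Φ := by
  -- Going once around the triangle by the three swaps returns to the initial vertex, so the product
  -- is a translation there.
  obtain ⟨n, hn⟩ := eq_translation_of_fixes_infty (g := γ⁻¹ * (h₂ * h₃ * h₁) * γ) (by
    rw [mul_smul, mul_smul, mul_smul, mul_smul, h1, h3, h2', inv_smul_smul])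
  obtain ⟨A, hA⟩ := exists_mk (γ⁻¹ * h₁ * γ)
  obtain ⟨B, hB⟩ := exists_mk (γ⁻¹ * h₂ * γ)
  obtain ⟨C, hC⟩ := exists_mk (γ⁻¹ * h₃ * γ)
  have tA : A 0 0 + A 1 1 = 0 := by
    refine trace_of_swaps (a := OnePoint.infty) (b := γ⁻¹ • b) (fun h => hab ?_) ?_ ?_
    · rw [h, smul_inv_smul]
    · rw [hA, mul_smul, mul_smul, h1]
    · rw [hA, mul_smul, mul_smul, smul_inv_smul, h1', inv_smul_smul]
  have tB : B 0 0 + B 1 1 = 0 := by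
    refine trace_of_swaps (a := OnePoint.infty) (b := γ⁻¹ • c) (fun h => hac ?_) ?_ ?_
    · rw [h, smul_inv_smul]
    · rw [hB, mul_smul, mul_smul, h2]
    · rw [hB, mul_smul, mul_smul, smul_inv_smul, h2', inv_smul_smul]
  have tC : C 0 0 + C 1 1 = 0 := by
    refine trace_of_swaps (a := γ⁻¹ • b) (b := γ⁻¹ • c)
      (fun h => hbc (MulAction.injective γ⁻¹ h)) ?_ ?_
    · rw [hC, mul_smul, mul_smul, smul_inv_smul, h3]
    · rw [hC, mul_smul, mul_smul, smul_inv_smul, h3']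
  have rA : A 1 0 ≠ 0 := lower_left_ne_zero (by
    rw [hA, mul_smul, mul_smul, h1, ne_eq, inv_smul_eq_iff]; exact hab.symm)
  have rB : B 1 0 ≠ 0 := lower_left_ne_zero (by
    rw [hB, mul_smul, mul_smul, h2, ne_eq, inv_smul_eq_iff]; exact hac.symm)
  have hCe : toPSL C = toPSL (B * ModularGroup.T ^ n * A) := by
    have e1 := toPSL_mul_self_of_trace tA
    have e2 := toPSL_mul_self_of_trace tB
    change _ = toPSL B * translation ^ n * toPSL A
    have : translation ^ n = toPSL B * toPSL C * toPSL A := by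
      rw [← hn, hA, hB, hC]; group
    rw [this]
    calc toPSL C = (1 : PSL(2, ℤ)) * toPSL C * 1 := by simp
      _ = (toPSL B * toPSL B) * toPSL C * (toPSL A * toPSL A) := by rw [e1, e2]
      _ = _ := by group
  have htr : (B * ModularGroup.T ^ n * A) 0 0 + (B * ModularGroup.T ^ n * A) 1 1 = 0 := by
    rcases toPSL_eq_iff.mp hCe with h | h
    · rw [← h]; exact tC
    · have h' : B * ModularGroup.T ^ n * A = -C := by rw [h, neg_neg]
      rw [h']; simp; linarith
  simp [Matrix.SpecialLinearGroup.coe_mul, ModularGroup.coe_T_zpow, Matrix.mul_apply,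
      Fin.sum_univ_two] at htr
  have dA := A.det_coe
  have dB := B.det_coe
  rw [Matrix.det_fin_two] at dA dB
  -- The third swap `B T ^ n A` has trace zero. Multiplying this relation by `-A 1 0 * B 1 0` and
  -- inserting the determinants yields the Markov equation for the two lower left entries and `D`.
  have hn3 : n = 3 ∨ n = -3 := by
    refine eq_three_of_markov (D := A 0 0 * B 1 0 - B 0 0 * A 1 0) rA rB
      (not_three_dvd_of_trace tA) (not_three_dvd_of_trace tB) ?_
    have sA : A 1 1 = -A 0 0 := by linarith
    have sB : B 1 1 = -B 0 0 := by linarith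
    rw [sA] at dA htr
    rw [sB] at dB htr
    linear_combination (-A 1 0 * B 1 0) * htr - B 1 0 ^ 2 * dA - A 1 0 ^ 2 * dB
  have hmem : γ * translation ^ n * γ⁻¹ ∈ Φ := by
    rw [← hn]
    have := mul_mem (mul_mem m₂ m₃) m₁
    simpa [mul_assoc] using this
  rcases hn3 with rfl | rfl
  · exact hmem
  · have := inv_mem hmem
    simpa [mul_assoc] using this

/-- An element of `Γ₃` can be corrected by `Φ` so as to fix the chosen cusp, where it is a
translation. By normality this translation lies in `Γ₃`, so its length is divisible by three and it
already belongs to `Φ`. -/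
theorem eq_Gamma3 {Φ : Subgroup PSL(2, ℤ)} (hle : Φ ≤ Gamma3) {γ : PSL(2, ℤ)}
    (h3 : γ * translation ^ (3 : ℤ) * γ⁻¹ ∈ Φ)
    (hcusp : ∀ x, IsRationalEnd x → ∃ φ ∈ Φ, φ • x = γ • OnePoint.infty) : Φ = Gamma3 := by
  refine le_antisymm hle fun g hg => ?_
  obtain ⟨φ, hφ, h⟩ := hcusp (g • γ • OnePoint.infty) ⟨g * γ, mul_smul _ _ _⟩
  obtain ⟨k, hk⟩ := eq_translation_of_fixes_infty (g := γ⁻¹ * (φ * g) * γ) (by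
    rw [mul_smul, mul_smul, mul_smul, h, inv_smul_smul])
  have hmem : translation ^ k ∈ Gamma3 := by
    rw [← hk]
    have := Gamma3_normal.conj_mem _ (mul_mem (hle hφ) hg) γ⁻¹
    rwa [inv_inv] at this
  obtain ⟨j, rfl⟩ := three_dvd_of_translation_mem hmem
  have e : φ * g = (γ * translation ^ (3 : ℤ) * γ⁻¹) ^ j := by
    rw [conj_zpow, ← zpow_mul, ← hk]; group
  have : g = φ⁻¹ * (φ * g) := by group
  rw [this, e]
  exact mul_mem (inv_mem hφ) (zpow_mem h3 j)

/-! ### Stabilizers and gluings -/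

theorem proj_eq_iff {Φ : Subgroup PSL(2, ℤ)} {z w : ℍ} :
    proj Φ z = proj Φ w ↔ ∃ g ∈ Φ, g • z = w := by
  rw [eq_comm, proj, proj, Quotient.eq'', MulAction.orbitRel_apply]
  constructor
  · rintro ⟨g, h⟩; exact ⟨g, g.2, h⟩
  · rintro ⟨g, hg, h⟩; exact ⟨⟨g, hg⟩, h⟩

theorem isRegularPoint_iff {Φ : Subgroup PSL(2, ℤ)} {z : ℍ} :
    IsRegularPoint Φ z ↔ ∀ g ∈ Φ, g • z = z → g = 1 := by
  rw [IsRegularPoint, Subgroup.eq_bot_iff_forall]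
  constructor
  · intro h g hg hz
    exact congrArg Subtype.val (h ⟨g, hg⟩ hz)
  · intro h g hz
    exact Subtype.ext (h g g.2 hz)

theorem isConePoint_of_zpowers {Φ : Subgroup PSL(2, ℤ)} {p : ℕ} [hp : Fact p.Prime] {g : PSL(2, ℤ)}
    (hg : g ∈ Φ) (hgp : g ^ p = 1) (hg1 : g ≠ 1) {q : ℍ} (hq : g • q = q)
    (h : ∀ k ∈ Φ, k • q = q → ∃ n : ℤ, k = g ^ n) : IsConePoint Φ p q := by
  refine ⟨hp.out.two_le, ?_⟩
  have : MulAction.stabilizer Φ q = Subgroup.zpowers (⟨g, hg⟩ : Φ) := by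
    refine le_antisymm ?_ ?_
    · intro k hk
      obtain ⟨n, hn⟩ := h k k.2 hk
      exact ⟨n, Subtype.ext (by simp [hn])⟩
    · rw [Subgroup.zpowers_le]
      exact hq
  rw [this, Nat.card_zpowers]
  exact orderOf_eq_prime (Subtype.ext (by simpa using hgp)) fun h => hg1 (congrArg Subtype.val h)

/-- Some element of the group swaps `a` and `b`. -/
def Folded (Φ : Subgroup PSL(2, ℤ)) (a b : OnePoint ℝ) : Prop := ∃ g ∈ Φ, g • a = b ∧ g • b = a

theorem Folded.symm {Φ : Subgroup PSL(2, ℤ)} {a b : OnePoint ℝ} (h : Folded Φ a b) :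
    Folded Φ b a := by
  obtain ⟨g, hg, h1, h2⟩ := h
  exact ⟨g, hg, h2, h1⟩

theorem HasVertices.closed_cases {V : Set (OnePoint ℝ)} {a b c : OnePoint ℝ}
    (h : HasVertices V a b c) {z : ℍ} (hz : z ∈ closedTriangle V) : z ∈ openTriangle V ∨
      z ∈ geodesicLine a b ∨ z ∈ geodesicLine b c ∨ z ∈ geodesicLine a c := by
  obtain ⟨h1, h2, h3⟩ := h.mem_closedTriangle.mp hz
  rw [geodesicLine_comm c a]
  by_contra! hcon
  obtain ⟨c0, c1, c2, c3⟩ := hcon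
  refine c0 (h.mem_openTriangle.mpr ⟨h1.lt_of_ne' ?_, h2.lt_of_ne' ?_, h3.lt_of_ne' ?_⟩)
  · exact mul_ne_zero c1 h.boundarySideFun_ne_zero
  · exact mul_ne_zero c2 h.rotate.boundarySideFun_ne_zero
  · exact mul_ne_zero c3 h.rotate.rotate.boundarySideFun_ne_zero

section Invariant

variable {Φ : Subgroup PSL(2, ℤ)} {T : Set (Set (OnePoint ℝ))} (hT : IsIdealTriangulation T)
  (hinv : IsInvariant Φ T)
include hT

theorem eq_of_orient {V W : Set (OnePoint ℝ)} (hV : V ∈ T) (hW : W ∈ T) {a b c c' : OnePoint ℝ}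
    (h : HasVertices V a b c) (h' : HasVertices W a b c')
    (ho : 0 < orient a b c * orient a b c') : V = W := by
  refine eq_of_same_side hT hV hW h h' (pos_of_mul_pos_right (a := bracket a b ^ 2) ?_ (sq_nonneg _))
  have : bracket a b ^ 2 * (boundarySideFun a b c * boundarySideFun a b c') =
      orient a b c * orient a b c' := by
    simp only [boundarySideFun_eq, orient, bracket]; ring
  rwa [this]

include hinv

/-- If `g` carries one oriented side to the next one in cyclic order, then `V` and `g • V` lie on
the same side of that edge, because orientation is preserved. So for a trivial stabilizer two sides
can only be glued by fixing their common vertex. -/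
theorem smul_eq_of_map_edge {V : Set (OnePoint ℝ)} (hV : V ∈ T) {a b c : OnePoint ℝ}
    (h : HasVertices V a b c) {g : PSL(2, ℤ)} (hg : g ∈ Φ) (ha : g • a = b) (hb : g • b = c) :
    g • V = V := by
  have h' := h.smul g
  rw [ha, hb] at h'
  refine (eq_of_orient hT hV (hinv.smul_mem hg hV) h.rotate h' ?_).symm
  obtain ⟨k, hk, ho⟩ := orient_psl_smul g a b c
  rw [ha, hb] at ho
  rw [ho, orient_rotate, mul_left_comm]
  exact mul_pos hk (mul_self_pos.mpr (orient_ne_zero h.1 h.2.1 h.2.2.1))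

theorem smul_eq_of_mem_openTriangle {V : Set (OnePoint ℝ)} (hV : V ∈ T) {g : PSL(2, ℤ)}
    (hg : g ∈ Φ) {z : ℍ} (hz : z ∈ openTriangle V) (hgz : g • z ∈ openTriangle V) : g • V = V :=
  eq_of_mem_openTriangle hT (hinv.smul_mem hg hV) hV ((psl_smul_mem_openTriangle g).mpr hz) hgz

theorem IsEdge.smul_cases {a b a' b' : OnePoint ℝ} (h : IsEdge T a b) (h' : IsEdge T a' b')
    {g : PSL(2, ℤ)} (hg : g ∈ Φ) {z : ℍ} (hz : z ∈ geodesicLine a b)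
    (hgz : g • z ∈ geodesicLine a' b') : (g • a = a' ∧ g • b = b') ∨ (g • a = b' ∧ g • b = a') :=
  (h.smul hinv hg).eq_of_mem hT h' ((psl_smul_mem_geodesicLine g).mpr hz) hgz

theorem IsEdge.proj_line_eq {a b a' b' : OnePoint ℝ} (h : IsEdge T a b) (h' : IsEdge T a' b')
    (hne : (proj Φ '' geodesicLine a b ∩ proj Φ '' geodesicLine a' b').Nonempty) :
    ∃ g ∈ Φ, (g • a = a' ∧ g • b = b') ∨ (g • a = b' ∧ g • b = a') := by
  obtain ⟨_, ⟨z, hz, rfl⟩, w, hw, hzw⟩ := hne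
  obtain ⟨g, hg, rfl⟩ := proj_eq_iff.mp hzw.symm
  exact ⟨g, hg, h.smul_cases hT hinv h' hg hz hw⟩

theorem IsEdge.fixes_cases {a b : OnePoint ℝ} (h : IsEdge T a b) {g : PSL(2, ℤ)} (hg : g ∈ Φ) {z : ℍ}
    (hz : z ∈ geodesicLine a b) (hgz : g • z = z) : g = 1 ∨ (g • a = b ∧ g • b = a) := by
  rcases h.smul_cases hT hinv h hg hz (by rwa [hgz]) with ⟨h1, h2⟩ | h'
  · exact Or.inl (h.eq_one_of_fixes hT hinv hg h1 h2)
  · exact Or.inr h'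

theorem IsEdge.isRegularPoint {a b : OnePoint ℝ} (h : IsEdge T a b) (hf : ¬Folded Φ a b) {z : ℍ}
    (hz : z ∈ geodesicLine a b) : IsRegularPoint Φ z :=
  isRegularPoint_iff.mpr fun g hg hgz => (h.fixes_cases hT hinv hg hz hgz).resolve_right
    fun h' => hf ⟨g, hg, h'⟩

theorem IsEdge.exists_conePoint {a b : OnePoint ℝ} (h : IsEdge T a b) (hf : Folded Φ a b) :
    ∃ m ∈ geodesicLine a b, IsConePoint Φ 2 m ∧ (∃ g : Φ, g • m = m ∧ g • a = b ∧ g • b = a) ∧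
      ∀ z ∈ geodesicLine a b, z ≠ m → IsRegularPoint Φ z := by
  obtain ⟨g, hg, ha, hb⟩ := hf
  obtain ⟨h1, h2, m, hm, hgm⟩ := rotation_of_swaps h.ne ha hb
  have huniq : ∀ k ∈ Φ, ∀ z ∈ geodesicLine a b, k • z = z → k = 1 ∨ k = g := by
    intro k hk z hz hkz
    refine (h.fixes_cases hT hinv hk hz hkz).imp id fun h' => ?_
    have := h.eq_one_of_fixes hT hinv (mul_mem (inv_mem hg) hk)
      (by rw [mul_smul, h'.1, ← ha, inv_smul_smul]) (by rw [mul_smul, h'.2, ← hb, inv_smul_smul])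
    rw [inv_mul_eq_one] at this
    exact this.symm
  refine ⟨m, hm, ?_, ⟨⟨g, hg⟩, hgm, ha, hb⟩, fun z hz hzm => isRegularPoint_iff.mpr fun k hk hkz => ?_⟩
  · refine isConePoint_of_zpowers hg (by rw [pow_two, h1]) h2 hgm fun k hk hkm => ?_
    rcases huniq k hk m hm hkm with rfl | rfl
    · exact ⟨0, by simp⟩
    · exact ⟨1, by simp⟩
  · refine (huniq k hk z hz hkz).resolve_right ?_
    rintro rfl
    exact h2 (eq_one_of_fixes_two_points hzm hkz hgm)

theorem isMonogon_of_cycle (hfin : Φ.FiniteIndex) {V : Set (OnePoint ℝ)} (hV : V ∈ T)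
    {a b c : OnePoint ℝ}
    (h : HasVertices V a b c) {g : PSL(2, ℤ)} (hg : g ∈ Φ) (ha : g • a = b) (hb : g • b = c)
    (hc : g • c = a) : IsMonogon Φ V := by
  obtain ⟨h3, q, hq, hgq⟩ := rotation_of_cycle h ha hb hc
  have hg1 : g ≠ 1 := by
    rintro rfl
    rw [one_smul] at ha
    exact h.1 ha
  have hstab : ∀ k ∈ Φ, k • V = V → ∃ n : ℕ, k = g ^ n := by
    intro k hk hkV
    have key : ∀ x : PSL(2, ℤ), k • a = x • a → k • b = x • b → k • c = x • c → k = x := by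
      intro x h1 h2 h3
      have := eq_one_of_fixes_three_ends (g := x⁻¹ * k) h.1 h.2.1 h.2.2.1
        (by rw [mul_smul, h1, inv_smul_smul]) (by rw [mul_smul, h2, inv_smul_smul])
        (by rw [mul_smul, h3, inv_smul_smul])
      rw [inv_mul_eq_one] at this
      exact this.symm
    rcases h.stabilizer_cases hkV with h1 | ⟨h1, h2, h3⟩ | ⟨h1, h2, h3⟩
    · exact ⟨0, by rw [h1, pow_zero]⟩
    · exact ⟨1, by rw [pow_one]; exact key g (by rw [h1, ha]) (by rw [h2, hb]) (by rw [h3, hc])⟩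
    · refine ⟨2, key _ ?_ ?_ ?_⟩ <;> rw [pow_two, mul_smul]
      · rw [h1, ha, hb]
      · rw [h2, hb, hc]
      · rw [h3, hc, ha]
  have hgV : g • V = V := smul_eq_of_map_edge hT hinv hV h hg ha hb
  have hpowq : ∀ n : ℕ, g ^ n • q = q := by
    intro n
    induction n with
    | zero => simp
    | succ n ih => rw [pow_succ, mul_smul, hgq, ih]
  have hE : IsEdge T a b := ⟨V, hV, c, h⟩
  refine ⟨a, b, c, h, q, hq, ?_, fun z hz hzq => isRegularPoint_iff.mpr fun k hk hkz => ?_,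
    ⟨⟨g, hg⟩, hgq, ha, hb, hc, fun z hz w hw => ?_⟩, ?_⟩
  · have : Fact (Nat.Prime 3) := ⟨Nat.prime_three⟩
    refine isConePoint_of_zpowers hg h3 hg1 hgq fun k hk hkq => ?_
    obtain ⟨n, hn⟩ := hstab k hk (smul_eq_of_mem_openTriangle hT hinv hV hk hq (by rwa [hkq]))
    exact ⟨n, by rw [hn, zpow_natCast]⟩
  · obtain ⟨n, rfl⟩ := hstab k hk (smul_eq_of_mem_openTriangle hT hinv hV hk hz (by rwa [hkz]))
    exact eq_one_of_fixes_two_points hzq hkz (hpowq n)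
  · rw [proj_eq_iff]
    constructor
    · rintro ⟨k, hk, rfl⟩
      obtain ⟨n, rfl⟩ := hstab k hk (smul_eq_of_mem_openTriangle hT hinv hV hk hz hw)
      exact ⟨n, rfl⟩
    · rintro ⟨n, rfl⟩
      exact ⟨g ^ n, pow_mem hg n, rfl⟩
  -- On a folded boundary `Φ` contains both a rotation of order three taking `a` to `b` and a swap
  -- of `a` and `b`, which leaves only the full group.
  · by_cases hf : Folded Φ a b
    · obtain ⟨m, hm, hm2, -, hreg⟩ := hE.exists_conePoint hT hinv hf
      obtain ⟨k, hk, hka, hkb⟩ := hf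
      exact Or.inr ⟨eq_top_of_cycle_of_swap hg hk h.1
        (isRationalEnd_of_mem hT hfin hinv hV h.mem.1) h3 ha hka hkb, m, hm, hm2, hreg⟩
    · exact Or.inl fun z hz => hE.isRegularPoint hT hinv hf hz

theorem isMonogon_of_stabilizer (hfin : Φ.FiniteIndex) {V : Set (OnePoint ℝ)} (hV : V ∈ T)
    {g : PSL(2, ℤ)} (hg : g ∈ Φ) (hg1 : g ≠ 1) (hgV : g • V = V) : IsMonogon Φ V := by
  obtain ⟨a, b, c, h⟩ := exists_hasVertices (hT.three_vertices V hV)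
  rcases h.stabilizer_cases hgV with h1 | ⟨h1, h2, h3⟩ | ⟨h1, h2, h3⟩
  · exact absurd h1 hg1
  · exact isMonogon_of_cycle hT hinv hfin hV h hg h1 h2 h3
  · exact isMonogon_of_cycle hT hinv hfin hV h.swap hg h2 h1 h3

end Invariant

/-! ### Triangles with trivial stabilizer -/

theorem injOn_openTriangle {Φ : Subgroup PSL(2, ℤ)} {T : Set (Set (OnePoint ℝ))}
    (hT : IsIdealTriangulation T) (hinv : IsInvariant Φ T) {V : Set (OnePoint ℝ)} (hV : V ∈ T)
    (htriv : ∀ g ∈ Φ, g • V = V → g = 1) : Set.InjOn (proj Φ) (openTriangle V) := by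
  intro z hz w hw h
  obtain ⟨g, hg, rfl⟩ := proj_eq_iff.mp h
  rw [htriv g hg (smul_eq_of_mem_openTriangle hT hinv hV hg hz hw), one_smul]

section Trivial

variable {Φ : Subgroup PSL(2, ℤ)} {T : Set (Set (OnePoint ℝ))} (hT : IsIdealTriangulation T)
  (hinv : IsInvariant Φ T) {V : Set (OnePoint ℝ)} (hV : V ∈ T)
  (htriv : ∀ g ∈ Φ, g • V = V → g = 1)
include hT hinv hV htriv

theorem isRegularPoint_of_mem_openTriangle {z : ℍ} (hz : z ∈ openTriangle V) :
    IsRegularPoint Φ z :=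
  isRegularPoint_iff.mpr fun g hg hgz =>
    htriv g hg (smul_eq_of_mem_openTriangle hT hinv hV hg hz (by rwa [hgz]))

/-- Points of two edges of an ideal triangle with trivial stabilizer are identified at most by an
element that fixes the common vertex. -/
theorem exists_fix_of_smul {a b c : OnePoint ℝ} (h : HasVertices V a b c) {g : PSL(2, ℤ)}
    (hg : g ∈ Φ) {z : ℍ} (hz : z ∈ geodesicLine a c) (hgz : g • z ∈ geodesicLine b c) :
    g • c = c ∧ g • a = b := by
  rcases IsEdge.smul_cases hT hinv ⟨V, hV, b, h.swap.rotate⟩ ⟨V, hV, a, h.rotate⟩ hg hz hgz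
    with ⟨h1, h2⟩ | ⟨h1, h2⟩
  · exact ⟨h2, h1⟩
  · have := htriv g hg (smul_eq_of_map_edge hT hinv hV h.swap.rotate hg h1 h2)
    rw [this, one_smul] at h1
    exact absurd h1 h.2.2.1

theorem exists_glue {a b c : OnePoint ℝ} (h : HasVertices V a b c)
    (heq : proj Φ '' geodesicLine a c = proj Φ '' geodesicLine b c) :
    ∃ g ∈ Φ, g • c = c ∧ g • a = b := by
  obtain ⟨z, hz, -⟩ := exists_two_points h.2.2.1
  have : proj Φ z ∈ proj Φ '' geodesicLine b c := by rw [← heq]; exact ⟨z, hz, rfl⟩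
  obtain ⟨w, hw, hwz⟩ := this
  obtain ⟨g, hg, rfl⟩ := proj_eq_iff.mp hwz.symm
  exact ⟨g, hg, exists_fix_of_smul hT hinv hV htriv h hg hz hw⟩

/-- The folded sides are not identified with other sides. -/
theorem not_folded_of_glue {a b c : OnePoint ℝ} (h : HasVertices V a b c) {g : PSL(2, ℤ)}
    (hg : g ∈ Φ) (hc : g • c = c) (ha : g • a = b) : ¬Folded Φ a c := by
  rintro ⟨k, hk, hka, hkc⟩
  -- The fold followed by the gluing would carry the oriented side `a, c` to `c, b`, hence stabilize
  -- the triangle.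
  have := htriv (g * k) (mul_mem hg hk) (smul_eq_of_map_edge hT hinv hV h.swap.rotate
    (mul_mem hg hk) (by rw [mul_smul, hka, hc]) (by rw [mul_smul, hkc, ha]))
  have h2 : (g * k) • a = c := by rw [mul_smul, hka, hc]
  rw [this, one_smul] at h2
  exact h.2.2.1 h2

theorem isTypeIIIb {a b c : OnePoint ℝ} (h : HasVertices V a b c) (hac : Folded Φ a c)
    (hbc : Folded Φ b c) (hab : ¬Folded Φ a b) : IsTypeIIIb Φ V := by
  have hEac : IsEdge T a c := ⟨V, hV, b, h.swap.rotate⟩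
  have hEbc : IsEdge T b c := ⟨V, hV, a, h.rotate⟩
  have hEab : IsEdge T a b := ⟨V, hV, c, h⟩
  obtain ⟨m, hm, hm2, hmg, hreg⟩ := hEac.exists_conePoint hT hinv hac
  obtain ⟨m', hm', hm2', hmg', hreg'⟩ := hEbc.exists_conePoint hT hinv hbc
  refine ⟨injOn_openTriangle hT hinv hV htriv, a, b, c, h, m, hm, m', hm', hm2, hmg, hm2', hmg',
    fun heq => ?_, fun z hz hzm hzm' => ?_⟩
  · obtain ⟨g, hg, rfl⟩ := proj_eq_iff.mp heq
    obtain ⟨h1, h2⟩ := exists_fix_of_smul hT hinv hV htriv h hg hm hm'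
    exact not_folded_of_glue hT hinv hV htriv h hg h1 h2 hac
  · rcases h.closed_cases hz with h1 | h1 | h1 | h1
    · exact isRegularPoint_of_mem_openTriangle hT hinv hV htriv h1
    · exact hEab.isRegularPoint hT hinv hab h1
    · exact hreg' z h1 hzm'
    · exact hreg z h1 hzm

omit hT hinv hV in
theorem smul_ne_of_swap {a b : OnePoint ℝ} (hab : a ≠ b) {g : PSL(2, ℤ)} (hg : g ∈ Φ)
    (ha : g • a = b) : V ≠ g • V := by
  intro h
  rw [htriv g hg h.symm, one_smul] at ha
  exact hab ha

omit htriv in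
-- If the neighbours of `V` across all three sides are `H`-translates of `V`, the `H`-orbit of `V`
-- is closed under adjacency and hence is all of `T`.
theorem eq_smul_of_neighbours (hfin : Φ.FiniteIndex) {a b c : OnePoint ℝ} (h : HasVertices V a b c)
    {H : Subgroup PSL(2, ℤ)} (hH : H ≤ Φ) {g₁ g₂ g₃ : PSL(2, ℤ)} (m₁ : g₁ ∈ H) (m₂ : g₂ ∈ H)
    (m₃ : g₃ ∈ H) (n₁ : V ≠ g₁ • V) (n₂ : V ≠ g₂ • V) (n₃ : V ≠ g₃ • V) (h₁ : a ∈ g₁ • V)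
    (h₁' : b ∈ g₁ • V) (h₂ : b ∈ g₂ • V) (h₂' : c ∈ g₂ • V) (h₃ : a ∈ g₃ • V) (h₃' : c ∈ g₃ • V)
    {W : Set (OnePoint ℝ)} (hW : W ∈ T) : ∃ g ∈ H, W = g • V := by
  have hST : {W | ∃ g ∈ H, W = g • V} = T := by
    refine eq_of_closed_under_adjacency hT (locFin hT hfin hinv) ?_ ⟨V, 1, one_mem _, by simp⟩ ?_
    · rintro _ ⟨g, hg, rfl⟩
      exact hinv.smul_mem (hH hg) hV
    · have key : ∀ x ∈ V, ∀ y ∈ V, x ≠ y → ∃ k ∈ H, V ≠ k • V ∧ x ∈ k • V ∧ y ∈ k • V := by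
        intro x hx y hy hxy
        rw [h.2.2.2] at hx hy
        simp only [Set.mem_insert_iff, Set.mem_singleton_iff] at hx hy
        rcases hx with rfl | rfl | rfl <;> rcases hy with rfl | rfl | rfl
        · exact absurd rfl hxy
        · exact ⟨g₁, m₁, n₁, h₁, h₁'⟩
        · exact ⟨g₃, m₃, n₃, h₃, h₃'⟩
        · exact ⟨g₁, m₁, n₁, h₁', h₁⟩
        · exact absurd rfl hxy
        · exact ⟨g₂, m₂, n₂, h₂, h₂'⟩
        · exact ⟨g₃, m₃, n₃, h₃', h₃⟩
        · exact ⟨g₂, m₂, n₂, h₂', h₂⟩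
        · exact absurd rfl hxy
      rintro _ ⟨g, hg, rfl⟩ x y z hxyz
      have hm := hxyz.mem
      rw [Set.mem_smul_set_iff_inv_smul_mem, Set.mem_smul_set_iff_inv_smul_mem] at hm
      obtain ⟨k, hk, hne, hx, hy⟩ := key _ hm.1 _ hm.2.1
        fun h' => hxyz.1 (MulAction.injective g⁻¹ h')
      refine ⟨(g * k) • V, ⟨g * k, mul_mem hg hk, rfl⟩, fun h' => hne ?_, ?_, ?_⟩
      · rw [mul_smul] at h'
        exact MulAction.injective g h'
      · rwa [mul_smul, Set.mem_smul_set_iff_inv_smul_mem]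
      · rwa [mul_smul, Set.mem_smul_set_iff_inv_smul_mem]
  have : W ∈ {W | ∃ g ∈ H, W = g • V} := by rw [hST]; exact hW
  exact this

omit hV in
/-- If `V` represents all triangles, then there are no rotations of order three. -/
theorem eq_one_of_pow_three (hall : ∀ W ∈ T, ∃ g ∈ Φ, W = g • V) {k : PSL(2, ℤ)} (hk : k ∈ Φ)
    (hk3 : k ^ 3 = 1) {z : ℍ} (hz : k • z = z) : k = 1 := by
  obtain ⟨W, hW, hzW⟩ := exists_mem_closedTriangle hT z
  obtain ⟨g, hg, rfl⟩ := hall W hW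
  by_cases hzo : z ∈ openTriangle (g • V)
  · have h1 := smul_eq_of_mem_openTriangle hT hinv hW hk hzo (by rwa [hz])
    have h2 := htriv (g⁻¹ * k * g) (mul_mem (mul_mem (inv_mem hg) hk) hg)
      (by rw [mul_smul, mul_smul, h1, inv_smul_smul])
    calc k = g * (g⁻¹ * k * g) * g⁻¹ := by group
      _ = 1 := by rw [h2]; simp
  · obtain ⟨a, b, c, h, hl⟩ := mem_line_of_mem_closedTriangle (hT.three_vertices _ hW) hzW hzo
    refine (IsEdge.fixes_cases hT hinv ⟨_, hW, c, h⟩ hk hl hz).resolve_right fun ⟨h1, h2⟩ => ?_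
    have h3 : (k ^ 3) • a = a := by rw [hk3, one_smul]
    rw [pow_succ, pow_two, mul_smul, mul_smul, h1, h2, h1] at h3
    exact h.1 h3.symm

theorem isTypeIIIa (hfin : Φ.FiniteIndex) {a b c : OnePoint ℝ} (h : HasVertices V a b c)
    (hab : Folded Φ a b) (hbc : ¬Folded Φ b c) (hac : ¬Folded Φ a c) : IsTypeIIIa Φ V := by
  have hEac : IsEdge T a c := ⟨V, hV, b, h.swap.rotate⟩
  have hEbc : IsEdge T b c := ⟨V, hV, a, h.rotate⟩
  have hEab : IsEdge T a b := ⟨V, hV, c, h⟩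
  obtain ⟨m, hm, hm2, hmg, hreg⟩ := hEab.exists_conePoint hT hinv hab
  refine ⟨injOn_openTriangle hT hinv hV htriv, a, b, c, h, ⟨m, hm, hm2, hmg, fun z hz hzm => ?_⟩, ?_⟩
  · rcases h.closed_cases hz with h1 | h1 | h1 | h1
    · exact isRegularPoint_of_mem_openTriangle hT hinv hV htriv h1
    · exact hreg z h1 hzm
    · exact hEbc.isRegularPoint hT hinv hbc h1
    · exact hEac.isRegularPoint hT hinv hac h1
  · by_cases heq : proj Φ '' geodesicLine a c = proj Φ '' geodesicLine b c
    -- The neighbours of `V` across `a b`, `b c` and `a c` are `k • V`, `g • V` and `g⁻¹ • V`. So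
    -- `V` represents all triangles, and no element of order three has a fixed point.
    · right
      obtain ⟨g, hg, hgc, hga⟩ := exists_glue hT hinv hV htriv h heq
      obtain ⟨k, hk, hka, hkb⟩ := hab
      refine ⟨?_, ⟨g, hg⟩, hgc, hga⟩
      have hm' := h.mem
      have hmem : ∀ x ∈ V, ∀ f : PSL(2, ℤ), f • x ∈ f • V := fun x hx f => Set.smul_mem_smul_set hx
      have hall : ∀ W ∈ T, ∃ g ∈ Φ, W = g • V := fun W hW =>
        eq_smul_of_neighbours hT hinv hV hfin h le_rfl hk hg (inv_mem hg)
          (smul_ne_of_swap htriv h.1 hk hka) (smul_ne_of_swap htriv h.1 hg hga)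
          (smul_ne_of_swap htriv h.1.symm (inv_mem hg) (by rw [← hga, inv_smul_smul]))
          (by rw [← hkb]; exact hmem b hm'.2.1 k) (by rw [← hka]; exact hmem a hm'.1 k)
          (by rw [← hga]; exact hmem a hm'.1 g) (by nth_rewrite 1 [← hgc]; exact hmem c hm'.2.2 g)
          (by rw [Set.mem_inv_smul_set_iff, hga]; exact hm'.2.1)
          (by rw [Set.mem_inv_smul_set_iff, hgc]; exact hm'.2.2) hW
      exact index_eq_three_of_glued hg hk h.1 (isRationalEnd_of_mem hT hfin hinv hV hm'.1)
        (isRationalEnd_of_mem hT hfin hinv hV hm'.2.2) hgc hga hka hkb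
        fun f hf hf3 ⟨z, hz⟩ => eq_one_of_pow_three hT hinv htriv hall hf hf3 hz
    · exact Or.inl heq

theorem isRegularPoint_of_not_folded {a b c : OnePoint ℝ} (h : HasVertices V a b c)
    (hab : ¬Folded Φ a b) (hbc : ¬Folded Φ b c) (hac : ¬Folded Φ a c) :
    ∀ z ∈ closedTriangle V, IsRegularPoint Φ z := by
  intro z hz
  rcases h.closed_cases hz with h1 | h1 | h1 | h1
  · exact isRegularPoint_of_mem_openTriangle hT hinv hV htriv h1
  · exact IsEdge.isRegularPoint hT hinv ⟨V, hV, c, h⟩ hab h1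
  · exact IsEdge.isRegularPoint hT hinv ⟨V, hV, a, h.rotate⟩ hbc h1
  · exact IsEdge.isRegularPoint hT hinv ⟨V, hV, b, h.swap.rotate⟩ hac h1

theorem isTypeII {a b c : OnePoint ℝ} (h : HasVertices V a b c)
    (hab : ¬Folded Φ a b) (hbc : ¬Folded Φ b c) (hac : ¬Folded Φ a c)
    (heq : proj Φ '' geodesicLine a c = proj Φ '' geodesicLine b c) : IsTypeII Φ V := by
  obtain ⟨g, hg, hgc, hga⟩ := exists_glue hT hinv hV htriv h heq
  refine ⟨injOn_openTriangle hT hinv hV htriv,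
    isRegularPoint_of_not_folded hT hinv hV htriv h hab hbc hac, a, b, c, h,
    ⟨⟨g, hg⟩, hgc, hga, ?_⟩, fun heq' => ?_⟩
  · have := smul_geodesicLine g a c
    rw [hga, hgc] at this
    exact this
  -- If all three sides were identified, `g⁻¹ • V` and `k • V` would both be the neighbour of `V`
  -- across `a c`. They agree, so `g * k` is trivial, but it takes `a` to `b`.
  · rw [geodesicLine_comm b a, geodesicLine_comm c a] at heq'
    obtain ⟨k, hk, hka, hkb⟩ := exists_glue hT hinv hV htriv h.rotate heq'
    have hm := h.mem
    have hmem : ∀ x ∈ V, ∀ f : PSL(2, ℤ), f • x ∈ f • V := fun x hx f => Set.smul_mem_smul_set hx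
    rcases eq_or_eq_of_common_edge hT hV (hinv.smul_mem (inv_mem hg) hV) (hinv.smul_mem hk hV)
      h.2.2.1 hm.1 hm.2.2 (by rw [Set.mem_inv_smul_set_iff, hga]; exact hm.2.1)
      (by rw [Set.mem_inv_smul_set_iff, hgc]; exact hm.2.2)
      (by nth_rewrite 1 [← hka]; exact hmem a hm.1 k) (by rw [← hkb]; exact hmem b hm.2.1 k)
      (smul_ne_of_swap htriv h.1.symm (inv_mem hg) (by rw [← hga, inv_smul_smul]))
      with h' | h'
    · rw [htriv k hk h', one_smul] at hkb
      exact h.2.1 hkb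
    · have := htriv (g * k) (mul_mem hg hk) (by rw [mul_smul, h', smul_inv_smul])
      have h2 : (g * k) • a = a := by rw [this, one_smul]
      rw [mul_smul, hka, hga] at h2
      exact h.1 h2.symm

theorem isTypeI_or_isTypeII {a b c : OnePoint ℝ} (h : HasVertices V a b c)
    (hab : ¬Folded Φ a b) (hbc : ¬Folded Φ b c) (hac : ¬Folded Φ a c) :
    IsTypeI Φ V ∨ IsTypeII Φ V := by
  by_cases h1 : proj Φ '' geodesicLine a c = proj Φ '' geodesicLine b c
  · exact Or.inr (isTypeII hT hinv hV htriv h hab hbc hac h1)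
  by_cases h2 : proj Φ '' geodesicLine b a = proj Φ '' geodesicLine c a
  · exact Or.inr (isTypeII hT hinv hV htriv h.rotate hbc (fun h => hac h.symm)
      (fun h => hab h.symm) h2)
  by_cases h3 : proj Φ '' geodesicLine c b = proj Φ '' geodesicLine a b
  · exact Or.inr (isTypeII hT hinv hV htriv h.rotate.rotate (fun h => hac h.symm) hab
      (fun h => hbc h.symm) h3)
  refine Or.inl ⟨injOn_openTriangle hT hinv hV htriv,
    isRegularPoint_of_not_folded hT hinv hV htriv h hab hbc hac, a, b, c, h, ?_, Ne.symm h1, ?_⟩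
  · rw [geodesicLine_comm c b]; exact Ne.symm h3
  · rw [geodesicLine_comm b a, geodesicLine_comm c a]; exact h2

/-- The three swaps give all neighbours of `V`, so the group `H` they generate is transitive on
triangles, and trivial stabilizers give `Φ = H`. As involutions they lie in `Γ₃`. All rational
points are vertices of translates of `V`, and the swaps identify its vertices, so there is one class
of cusps, which has width three. -/
theorem eq_Gamma3_of_folded (hfin : Φ.FiniteIndex) {a b c : OnePoint ℝ} (h : HasVertices V a b c)
    (hab : Folded Φ a b) (hbc : Folded Φ b c) (hac : Folded Φ a c) : Φ = Gamma3 := by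
  obtain ⟨h₁, m₁, e₁, e₁'⟩ := hab
  obtain ⟨h₂, m₂, e₂, e₂'⟩ := hac
  obtain ⟨h₃, m₃, e₃, e₃'⟩ := hbc
  set H := Subgroup.closure {h₁, h₂, h₃} with hH
  have hHΦ : H ≤ Φ := by
    rw [hH, Subgroup.closure_le]
    rintro _ (rfl | rfl | rfl) <;> assumption
  have hHG : H ≤ Gamma3 := by
    rw [hH, Subgroup.closure_le]
    rintro _ (rfl | rfl | rfl)
    · exact swap_mem_Gamma3 h.1 e₁ e₁'
    · exact swap_mem_Gamma3 h.2.2.1 e₂ e₂'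
    · exact swap_mem_Gamma3 h.2.1 e₃ e₃'
  have hm := h.mem
  have hmem : ∀ x ∈ V, ∀ f : PSL(2, ℤ), f • x ∈ f • V := fun x hx f => Set.smul_mem_smul_set hx
  have hall : ∀ W ∈ T, ∃ g ∈ H, W = g • V := fun W hW =>
    eq_smul_of_neighbours hT hinv hV hfin h hHΦ (Subgroup.subset_closure (by simp))
      (Subgroup.subset_closure (by simp)) (Subgroup.subset_closure (by simp))
      (smul_ne_of_swap htriv h.1 m₁ e₁) (smul_ne_of_swap htriv h.2.1 m₃ e₃)
      (smul_ne_of_swap htriv h.2.2.1 m₂ e₂)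
      (by rw [← e₁']; exact hmem b hm.2.1 h₁) (by rw [← e₁]; exact hmem a hm.1 h₁)
      (by rw [← e₃']; exact hmem c hm.2.2 h₃) (by rw [← e₃]; exact hmem b hm.2.1 h₃)
      (by rw [← e₂']; exact hmem c hm.2.2 h₂) (by rw [← e₂]; exact hmem a hm.1 h₂) hW
  have hΦH : Φ ≤ H := by
    intro g hg
    obtain ⟨k, hk, hgk⟩ := hall _ (hinv.smul_mem hg hV)
    have := htriv (k⁻¹ * g) (mul_mem (inv_mem (hHΦ hk)) hg) (by rw [mul_smul, hgk, inv_smul_smul])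
    rw [inv_mul_eq_one] at this
    rwa [← this]
  have ha := isRationalEnd_of_mem hT hfin hinv hV hm.1
  obtain ⟨γ, rfl⟩ := ha
  refine eq_Gamma3 (hΦH.trans hHG)
    (translation_three_mem m₁ m₂ m₃ h.1 h.2.1 h.2.2.1 e₁ e₁' e₂ e₂' e₃ e₃') fun x hx => ?_
  obtain ⟨W, hW, hxW⟩ := exists_vertex_of_rational hT hfin hinv hx
  obtain ⟨g, hg, rfl⟩ := hall W hW
  rw [Set.mem_smul_set_iff_inv_smul_mem, h.2.2.2] at hxW
  have hg' := inv_mem (hHΦ hg)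
  rcases hxW with h1 | h1 | h1
  · exact ⟨g⁻¹, hg', h1⟩
  · exact ⟨h₁ * g⁻¹, mul_mem m₁ hg', by rw [mul_smul, h1, e₁']⟩
  · exact ⟨h₂ * g⁻¹, mul_mem m₂ hg', by rw [mul_smul, h1, e₂']⟩

end Trivial

theorem type_cases {Φ : Subgroup PSL(2, ℤ)} {T : Set (Set (OnePoint ℝ))}
    (hT : IsIdealTriangulation T) (hfin : Φ.FiniteIndex) (hinv : IsInvariant Φ T)
    (hΦ : Φ ≠ Gamma3) {V : Set (OnePoint ℝ)} (hV : V ∈ T) : IsTypeI Φ V ∨ IsTypeII Φ V ∨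
      IsTypeIIIa Φ V ∨ IsTypeIIIb Φ V ∨ IsMonogon Φ V := by
  by_cases htriv : ∀ g ∈ Φ, g • V = V → g = 1
  · obtain ⟨a, b, c, h⟩ := exists_hasVertices (hT.three_vertices V hV)
    by_cases hab : Folded Φ a b <;> by_cases hbc : Folded Φ b c <;> by_cases hac : Folded Φ a c
    · exact absurd (eq_Gamma3_of_folded hT hinv hV htriv hfin h hab hbc hac) hΦ
    · exact Or.inr (Or.inr (Or.inr (Or.inl (isTypeIIIb hT hinv hV htriv h.swap.rotate
        hab hbc.symm hac))))
    · exact Or.inr (Or.inr (Or.inr (Or.inl (isTypeIIIb hT hinv hV htriv h.rotate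
        hab.symm hac.symm hbc))))
    · exact Or.inr (Or.inr (Or.inl (isTypeIIIa hT hinv hV htriv hfin h hab hbc hac)))
    · exact Or.inr (Or.inr (Or.inr (Or.inl (isTypeIIIb hT hinv hV htriv h hac hbc hab))))
    · exact Or.inr (Or.inr (Or.inl (isTypeIIIa hT hinv hV htriv hfin h.rotate hbc
        (fun h => hac h.symm) (fun h => hab h.symm))))
    · exact Or.inr (Or.inr (Or.inl (isTypeIIIa hT hinv hV htriv hfin h.swap.rotate hac
        (fun h => hbc h.symm) hab)))
    · exact (isTypeI_or_isTypeII hT hinv hV htriv h hab hbc hac).elim Or.inl fun h =>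
        Or.inr (Or.inl h)
  · push Not at htriv
    obtain ⟨g, hg, hgV, hg1⟩ := htriv
    exact Or.inr (Or.inr (Or.inr (Or.inr (isMonogon_of_stabilizer hT hinv hfin hV hg hg1 hgV))))

/-! ### The projections of the edges and of the open triangles -/

/-- A power of a parabolic element of the modular group at this point lies in `Φ`. -/
theorem isCuspLift_of_isRationalEnd {Φ : Subgroup PSL(2, ℤ)} (hfin : Φ.FiniteIndex)
    {x : OnePoint ℝ} (h : IsRationalEnd x) : IsCuspLift Φ x := by
  obtain ⟨γ, rfl⟩ := h
  obtain ⟨A, rfl⟩ := exists_mk γ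
  obtain ⟨_, ⟨B, rfl⟩, hp, hc⟩ := isCusp_SL2Z_iff'.mpr ⟨A, rfl⟩
  obtain ⟨N, hN, hpow⟩ := exists_pow_mem Φ hfin
  refine ⟨_, ⟨B ^ N, hpow (toPSL B), rfl⟩, ?_, ?_⟩
  · rw [map_pow]; exact hp.pow hN.ne'
  · rw [map_pow]
    exact pow_mem (S := MulAction.stabilizer (GL (Fin 2) ℝ) _) hc N

theorem proj_image_smul {Φ : Subgroup PSL(2, ℤ)} {g : PSL(2, ℤ)} (hg : g ∈ Φ) (S : Set ℍ) :
    proj Φ '' (g • S) = proj Φ '' S := by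
  rw [← Set.image_smul, Set.image_image]
  exact Set.image_congr fun z _ => (proj_eq_iff.mpr ⟨g, hg, rfl⟩).symm

theorem IsConePoint.exists_rotation {Φ : Subgroup PSL(2, ℤ)} {n : ℕ} {q : ℍ}
    (h : IsConePoint Φ n q) : ∃ k ∈ Φ, k • q = q ∧ k ≠ 1 ∧ k ^ n = 1 := by
  obtain ⟨hn, hcard⟩ := h
  have : Finite (MulAction.stabilizer Φ q) := Nat.finite_of_card_ne_zero (by omega)
  have : Nontrivial (MulAction.stabilizer Φ q) := by
    rw [← Finite.one_lt_card_iff_nontrivial]; omega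
  obtain ⟨k, hk⟩ := exists_ne (1 : MulAction.stabilizer Φ q)
  refine ⟨k, k.1.2, k.2, fun h => hk (Subtype.ext (Subtype.ext h)), ?_⟩
  have := congrArg (fun x : MulAction.stabilizer Φ q => (x : PSL(2, ℤ))) (pow_card_eq_one' (x := k))
  rw [hcard] at this
  exact this

theorem IsConePoint.not_isRegularPoint {Φ : Subgroup PSL(2, ℤ)} {n : ℕ} {q : ℍ}
    (h : IsConePoint Φ n q) : ¬IsRegularPoint Φ q := by
  obtain ⟨k, hk, hq, hk1, -⟩ := h.exists_rotation
  exact fun hr => hk1 (isRegularPoint_iff.mp hr k hk hq)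

theorem IsRegularPoint.smul {Φ : Subgroup PSL(2, ℤ)} {z : ℍ} (h : IsRegularPoint Φ z)
    {g : PSL(2, ℤ)} (hg : g ∈ Φ) : IsRegularPoint Φ (g • z) := by
  rw [isRegularPoint_iff] at h ⊢
  intro k hk hz
  have := h (g⁻¹ * k * g) (mul_mem (mul_mem (inv_mem hg) hk) hg)
    (by rw [mul_smul, mul_smul, hz, inv_smul_smul])
  calc k = g * (g⁻¹ * k * g) * g⁻¹ := by group
    _ = 1 := by rw [this]; simp

section Projections

variable {Φ : Subgroup PSL(2, ℤ)} {T : Set (Set (OnePoint ℝ))} (hT : IsIdealTriangulation T)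

include hT

theorem mem_projEdges_iff {γ : Set (Orbifold Φ)} :
    γ ∈ projEdges Φ T ↔ ∃ a b, IsEdge T a b ∧ γ = proj Φ '' geodesicLine a b := by
  constructor
  · rintro ⟨V, hV, a, ha, b, hb, hab, rfl⟩
    obtain ⟨c, hc⟩ := exists_hasVertices_of_mem_mem (hT.three_vertices V hV) ha hb hab
    exact ⟨a, b, ⟨V, hV, c, hc⟩, rfl⟩
  · rintro ⟨a, b, ⟨V, hV, c, hc⟩, rfl⟩
    exact ⟨V, hV, a, hc.mem.1, b, hc.mem.2.1, hc.1, rfl⟩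

variable (hinv : IsInvariant Φ T)
include hinv

theorem IsEdge.isCuspArc (hfin : Φ.FiniteIndex) {a b : OnePoint ℝ} (h : IsEdge T a b)
    (hf : ¬Folded Φ a b) : IsCuspArc Φ (proj Φ '' geodesicLine a b) := by
  refine ⟨a, b, h.ne, isCuspLift_of_isRationalEnd hfin (isRationalEnd_of_isEdge hT hfin hinv h),
    isCuspLift_of_isRationalEnd hfin (isRationalEnd_of_isEdge hT hfin hinv h.symm),
    fun z hz => h.isRegularPoint hT hinv hf hz, fun z hz w hw hzw => ?_, rfl⟩
  obtain ⟨g, hg, rfl⟩ := proj_eq_iff.mp hzw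
  rcases h.smul_cases hT hinv h hg hz hw with ⟨h1, h2⟩ | h'
  · rw [h.eq_one_of_fixes hT hinv hg h1 h2, one_smul]
  · exact absurd ⟨g, hg, h'⟩ hf

/-- The involution exchanges the two rays from its centre, so the whole edge has the same projection
as one ray. On one ray the projection is injective, because the rays meet only in the centre. -/
theorem IsEdge.isConeArc (hfin : Φ.FiniteIndex) {a b : OnePoint ℝ} (h : IsEdge T a b)
    (hf : Folded Φ a b) : IsConeArc Φ 2 (proj Φ '' geodesicLine a b) := by
  obtain ⟨m, hm, hm2, ⟨⟨g, hg⟩, hgm, hga, hgb⟩, hreg⟩ := h.exists_conePoint hT hinv hf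
  change g • m = m at hgm
  change g • a = b at hga
  change g • b = a at hgb
  obtain ⟨hunion, hinter⟩ := line_eq_union_rays hm
  have hray : g • geodesicRay m a = geodesicRay m b := by rw [smul_geodesicRay, hgm, hga]
  refine ⟨m, a, hm2, isCuspLift_of_isRationalEnd hfin (isRationalEnd_of_isEdge hT hfin hinv h),
    fun z hz hzm => hreg z (ray_subset_line hm hz) hzm, fun z hz w hw hzw => ?_, ?_⟩
  · obtain ⟨k, hk, rfl⟩ := proj_eq_iff.mp hzw
    rcases h.smul_cases hT hinv h hk (ray_subset_line hm hz) (ray_subset_line hm hw) with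
      ⟨h1, h2⟩ | ⟨h1, h2⟩
    · rw [h.eq_one_of_fixes hT hinv hk h1 h2, one_smul]
    · have hkg := h.eq_one_of_fixes hT hinv (mul_mem (inv_mem hg) hk)
        (by rw [mul_smul, h1, ← hga, inv_smul_smul]) (by rw [mul_smul, h2, ← hgb, inv_smul_smul])
      rw [inv_mul_eq_one] at hkg
      subst hkg
      have : g • z = m := hinter ⟨hw, by rw [← hray]; exact Set.smul_mem_smul_set hz⟩
      rw [this]
      exact MulAction.injective g (this.trans hgm.symm)
  · rw [hunion, Set.image_union, ← hray, proj_image_smul hg, Set.union_self]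

theorem IsEdge.isArc (hfin : Φ.FiniteIndex) {a b : OnePoint ℝ} (h : IsEdge T a b) :
    IsArc Φ (proj Φ '' geodesicLine a b) := by
  by_cases hf : Folded Φ a b
  · exact Or.inr (Or.inl (h.isConeArc hT hinv hfin hf))
  · exact Or.inl (h.isCuspArc hT hinv hfin hf)

/-- A rotation with a fixed point on an edge swaps the ends of the edge, so its cube is not trivial.
-/
theorem IsEdge.not_isStructuralArc {a b : OnePoint ℝ} (h : IsEdge T a b) :
    ¬IsStructuralArc Φ (proj Φ '' geodesicLine a b) := by
  rintro ⟨q, x, hq, -, -, -, heq⟩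
  obtain ⟨z, hz, hzq⟩ : proj Φ q ∈ proj Φ '' geodesicLine a b := by
    rw [heq]; exact ⟨q, self_mem_ray q x, rfl⟩
  obtain ⟨g, hg, rfl⟩ := proj_eq_iff.mp hzq
  obtain ⟨k, hk, hkq, hk1, hk3⟩ := hq.exists_rotation
  have hpow : (g⁻¹ * k * g) ^ 3 = 1 := by
    have : g⁻¹ * k * g = g⁻¹ * k * (g⁻¹)⁻¹ := by rw [inv_inv]
    rw [this, conj_pow, hk3, mul_one, mul_inv_cancel]
  rcases h.fixes_cases hT hinv (mul_mem (mul_mem (inv_mem hg) hk) hg) hz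
    (by rw [mul_smul, mul_smul, hkq, inv_smul_smul]) with h1 | ⟨h1, h2⟩
  · refine hk1 ?_
    calc k = g * (g⁻¹ * k * g) * g⁻¹ := by group
      _ = 1 := by rw [h1]; simp
  · have h3 : ((g⁻¹ * k * g) ^ 3) • a = b := by
      rw [pow_succ, pow_two, mul_smul, mul_smul, h1, h2, h1]
    rw [hpow, one_smul] at h3
    exact h.ne h3

theorem projEdges_pairwiseDisjoint : (projEdges Φ T).PairwiseDisjoint id := by
  intro γ hγ γ' hγ' hne
  obtain ⟨a, b, h, rfl⟩ := (mem_projEdges_iff hT).mp hγ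
  obtain ⟨a', b', h', rfl⟩ := (mem_projEdges_iff hT).mp hγ'
  rw [Function.onFun, id, id, Set.disjoint_iff_inter_eq_empty]
  by_contra hcon
  obtain ⟨g, hg, ⟨h1, h2⟩ | ⟨h1, h2⟩⟩ :=
    h.proj_line_eq hT hinv h' (Set.nonempty_iff_ne_empty.mpr hcon)
  · exact hne (by rw [← h1, ← h2, ← smul_geodesicLine, proj_image_smul hg])
  · exact hne (by rw [← h1, ← h2, geodesicLine_comm (g • a), ← smul_geodesicLine,
      proj_image_smul hg])

theorem projPieces_pairwiseDisjoint : (projPieces Φ T).PairwiseDisjoint id := by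
  rintro _ ⟨V, hV, rfl⟩ _ ⟨W, hW, rfl⟩ hne
  rw [Function.onFun, id, id, Set.disjoint_left]
  rintro _ ⟨z, hz, rfl⟩ ⟨w, hw, hwz⟩
  obtain ⟨g, hg, rfl⟩ := proj_eq_iff.mp hwz.symm
  have := eq_of_mem_openTriangle hT (hinv.smul_mem hg hV) hW ((psl_smul_mem_openTriangle g).mpr hz) hw
  exact hne (by rw [← this, ← smul_openTriangle, proj_image_smul hg])

theorem sUnion_projPieces : ⋃₀ projPieces Φ T = (⋃₀ projEdges Φ T)ᶜ := by
  apply Set.Subset.antisymm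
  · rintro _ ⟨_, ⟨V, hV, rfl⟩, z, hz, rfl⟩ ⟨γ, hγ, hzγ⟩
    obtain ⟨a, b, h, rfl⟩ := (mem_projEdges_iff hT).mp hγ
    obtain ⟨w, hw, hwz⟩ := hzγ
    obtain ⟨g, hg, rfl⟩ := proj_eq_iff.mp hwz
    exact (h.smul hinv hg).notMem_openTriangle hT ((psl_smul_mem_geodesicLine g).mpr hw) hV hz
  · intro x hx
    induction x using Quotient.inductionOn' with
    | h z =>
      rcases mem_openTriangle_or_mem_edge hT z with ⟨V, hV, hz⟩ | ⟨V, hV, a, b, c, h, hz⟩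
      · exact ⟨_, ⟨V, hV, rfl⟩, z, hz, rfl⟩
      · exact absurd ⟨_, (mem_projEdges_iff hT).mpr ⟨a, b, ⟨V, hV, c, h⟩, rfl⟩, z, hz, rfl⟩ hx

end Projections

/-! ### The induced quotient triangulation -/

/-- The projections of the rays from the centres of the triangles with a rotation of order 3
to their vertices. -/
def projCentralRays (Φ : Subgroup PSL(2, ℤ)) (T : Set (Set (OnePoint ℝ))) :
    Set (Set (Orbifold Φ)) :=
  {γ | ∃ V ∈ T, ∃ x ∈ V, ∃ q ∈ openTriangle V, IsConePoint Φ 3 q ∧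
    γ = proj Φ '' geodesicRay q x}

theorem eq_of_mem_rays {q z : ℍ} {x y : OnePoint ℝ} (hz : z ∈ geodesicRay q x)
    (hz' : z ∈ geodesicRay q y) (hzq : z ≠ q) : x = y := by
  have ⟨x', h1, h2, _⟩ := hz
  have ⟨y', h3, h4, _⟩ := hz'
  rcases eq_of_two_points hzq h2 h1 h4 h3 with ⟨h, -⟩ | ⟨-, h⟩
  · exact h
  · rw [h] at h1
    exact absurd ((line_eq_union_rays h1).2 ⟨hz, hz'⟩) hzq

section Central

variable {Φ : Subgroup PSL(2, ℤ)} {T : Set (Set (OnePoint ℝ))} (hT : IsIdealTriangulation T)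
  (hfin : Φ.FiniteIndex) (hinv : IsInvariant Φ T)
include hT hfin hinv

/-- A singular point of an open triangle is the centre of a rotation of order 3 that
permutes the vertices. -/
theorem exists_rotation_of_not_isRegularPoint {V : Set (OnePoint ℝ)} (hV : V ∈ T) {q : ℍ}
    (hq : q ∈ openTriangle V) (hsing : ¬IsRegularPoint Φ q) :
    IsConePoint Φ 3 q ∧ (∀ z ∈ openTriangle V, z ≠ q → IsRegularPoint Φ z) ∧
      ∀ x ∈ V, ∀ y ∈ V, ∃ g ∈ Φ, g • q = q ∧ g • x = y := by
  rw [isRegularPoint_iff] at hsing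
  push Not at hsing
  obtain ⟨k, hk, hkq, hk1⟩ := hsing
  obtain ⟨a, b, c, h, p, hp, hp3, hreg, ⟨⟨g, hg⟩, hgp, ha, hb, hc, -⟩, -⟩ :=
    isMonogon_of_stabilizer hT hinv hfin hV hk hk1
      (smul_eq_of_mem_openTriangle hT hinv hV hk hq (by rwa [hkq]))
  obtain rfl : q = p := by
    by_contra hne
    exact hk1 (isRegularPoint_iff.mp (hreg q hq hne) k hk hkq)
  refine ⟨hp3, hreg, ?_⟩
  have hcyc : ∀ x ∈ V, ∃ f ∈ Φ, f • q = q ∧ f • a = x := by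
    intro x hx
    rw [h.2.2.2] at hx
    rcases hx with rfl | rfl | rfl
    · exact ⟨1, one_mem _, one_smul _ _, one_smul _ _⟩
    · exact ⟨g, hg, hgp, ha⟩
    · exact ⟨g⁻¹, inv_mem hg, inv_smul_eq_iff.mpr hgp.symm, inv_smul_eq_iff.mpr hc.symm⟩
  intro x hx y hy
  obtain ⟨f, hf, hfq, rfl⟩ := hcyc x hx
  obtain ⟨f', hf', hfq', rfl⟩ := hcyc y hy
  exact ⟨f' * f⁻¹, mul_mem hf' (inv_mem hf),
    by rw [mul_smul, inv_smul_eq_iff.mpr hfq.symm, hfq'], by rw [mul_smul, inv_smul_smul]⟩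

/-- An element identifying two points of the ray stabilizes the triangle and hence fixes its only
singular point `q`. If the identified points are not `q`, it also fixes the end of the ray, so it is
trivial. -/
theorem isStructuralArc_of_mem_projCentralRays {γ : Set (Orbifold Φ)}
    (hγ : γ ∈ projCentralRays Φ T) : IsStructuralArc Φ γ := by
  obtain ⟨V, hV, x, hx, q, hq, hq3, rfl⟩ := hγ
  obtain ⟨-, hreg, -⟩ :=
    exists_rotation_of_not_isRegularPoint hT hfin hinv hV hq hq3.not_isRegularPoint
  have hsub := ray_subset_openTriangle (hT.three_vertices V hV) hx hq
  refine ⟨q, x, hq3, isCuspLift_of_isRationalEnd hfin (isRationalEnd_of_mem hT hfin hinv hV hx),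
    fun z hz hzq => hreg z (hsub hz) hzq, fun z hz w hw hzw => ?_, rfl⟩
  obtain ⟨f, hf, rfl⟩ := proj_eq_iff.mp hzw
  have hfV := smul_eq_of_mem_openTriangle hT hinv hV hf (hsub hz) (hsub hw)
  have hfq : f • q = q := by
    by_contra hne
    have h1 : f • q ∈ openTriangle V := by
      rw [← hfV]; exact (psl_smul_mem_openTriangle f).mpr hq
    have h2 := (hreg _ h1 hne).smul (inv_mem hf)
    rw [inv_smul_smul] at h2
    exact hq3.not_isRegularPoint h2
  by_cases hzq : f • z = q
  · rw [hzq]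
    exact MulAction.injective f (hzq.trans hfq.symm)
  · have h1 : f • z ∈ geodesicRay q (f • x) := by
      nth_rewrite 1 [← hfq]
      rw [← smul_geodesicRay]
      exact Set.smul_mem_smul_set hz
    rw [eq_one_of_fixes_point_of_fixes_end hfq (eq_of_mem_rays h1 hw hzq), one_smul]

/-- An element that identifies two points of such rays matches the triangles and their centres; the
rotations about the centre are transitive on the vertices, so the rays themselves are equivalent. -/
theorem projCentralRays_eq_of_inter {γ γ' : Set (Orbifold Φ)} (hγ : γ ∈ projCentralRays Φ T)
    (hγ' : γ' ∈ projCentralRays Φ T) (h : (γ ∩ γ').Nonempty) : γ = γ' := by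
  obtain ⟨V, hV, x, hx, q, hq, hq3, rfl⟩ := hγ
  obtain ⟨W, hW, y, hy, p, hp, hp3, rfl⟩ := hγ'
  obtain ⟨_, ⟨z, hz, rfl⟩, w, hw, hwz⟩ := h
  obtain ⟨f, hf, rfl⟩ := proj_eq_iff.mp hwz.symm
  have hfV : f • V = W := eq_of_mem_openTriangle hT (hinv.smul_mem hf hV) hW
    ((psl_smul_mem_openTriangle f).mpr
      (ray_subset_openTriangle (hT.three_vertices V hV) hx hq hz))
    (ray_subset_openTriangle (hT.three_vertices W hW) hy hp hw)
  obtain ⟨-, hreg, htrans⟩ :=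
    exists_rotation_of_not_isRegularPoint hT hfin hinv hW hp hp3.not_isRegularPoint
  have hfq : f • q = p := by
    by_contra hne
    have h2 := (hreg (f • q) (by rw [← hfV]; exact (psl_smul_mem_openTriangle f).mpr hq) hne).smul
      (inv_mem hf)
    rw [inv_smul_smul] at h2
    exact hq3.not_isRegularPoint h2
  obtain ⟨k, hk, hkp, hky⟩ := htrans (f • x) (by rw [← hfV]; exact Set.smul_mem_smul_set hx) y hy
  have : (k * f) • geodesicRay q x = geodesicRay p y := by
    rw [smul_geodesicRay, mul_smul, mul_smul, hfq, hkp, hky]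
  rw [← this, proj_image_smul (mul_mem hk hf)]

omit hfin in
theorem projCentralRays_disjoint_projEdges {γ γ' : Set (Orbifold Φ)}
    (hγ : γ ∈ projCentralRays Φ T) (hγ' : γ' ∈ projEdges Φ T) : Disjoint γ γ' := by
  obtain ⟨V, hV, x, hx, q, hq, hq3, rfl⟩ := hγ
  refine Set.disjoint_left.mpr fun u hu hu' => ?_
  have hmem : u ∈ ⋃₀ projPieces Φ T := ⟨_, ⟨V, hV, rfl⟩,
    Set.image_mono (ray_subset_openTriangle (hT.three_vertices V hV) hx hq) hu⟩
  rw [sUnion_projPieces hT hinv] at hmem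
  exact hmem ⟨γ', hγ', hu'⟩

theorem isCompatible_union : IsCompatible Φ (projEdges Φ T ∪ projCentralRays Φ T) := by
  refine ⟨?_, ?_⟩
  · rintro γ (hγ | hγ)
    · obtain ⟨a, b, h, rfl⟩ := (mem_projEdges_iff hT).mp hγ
      exact h.isArc hT hinv hfin
    · exact Or.inr (Or.inr (isStructuralArc_of_mem_projCentralRays hT hfin hinv hγ))
  · rintro γ (hγ | hγ) γ' (hγ' | hγ') hne
    · exact projEdges_pairwiseDisjoint hT hinv hγ hγ' hne
    · exact (projCentralRays_disjoint_projEdges hT hinv hγ' hγ).symm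
    · exact projCentralRays_disjoint_projEdges hT hinv hγ hγ'
    · rw [Function.onFun, id, id, Set.disjoint_iff_inter_eq_empty]
      by_contra hcon
      exact hne (projCentralRays_eq_of_inter hT hfin hinv hγ hγ' (Set.nonempty_iff_ne_empty.mpr hcon))

omit hfin hinv in
theorem exists_subset_openTriangle_of_disjoint {S : Set ℍ} (hS : IsPreconnected S)
    (hne : S.Nonempty) (h : ∀ γ ∈ projEdges Φ T, Disjoint (proj Φ '' S) γ) :
    ∃ V ∈ T, S ⊆ openTriangle V :=
  exists_subset_openTriangle hT hS hne fun a b hab => Set.disjoint_left.mpr fun z hz hz' =>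
    Set.disjoint_left.mp (h _ ((mem_projEdges_iff hT).mpr ⟨a, b, hab, rfl⟩)) ⟨z, hz, rfl⟩
      ⟨z, hz', rfl⟩

/-- The ray lies in one open triangle. Its singular origin is then a centre of order three, whatever
`n` was, and its end is a vertex. -/
theorem mem_projCentralRays_of_isConeArc {n : ℕ} {γ : Set (Orbifold Φ)} (hγ : IsConeArc Φ n γ)
    (h : ∀ γ' ∈ projEdges Φ T, Disjoint γ γ') : γ ∈ projCentralRays Φ T := by
  obtain ⟨q, x, hq, -, -, -, rfl⟩ := hγ
  obtain ⟨V, hV, hsub⟩ := exists_subset_openTriangle_of_disjoint hT (isPreconnected_ray q x)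
    ⟨q, self_mem_ray q x⟩ h
  have hqV := hsub (self_mem_ray q x)
  exact ⟨V, hV, x, ray_end_mem (hT.three_vertices V hV) hsub, q, hqV,
    (exists_rotation_of_not_isRegularPoint hT hfin hinv hV hqV hq.not_isRegularPoint).1, rfl⟩

omit hfin hinv in
-- A line inside an open triangle would have two vertices as its ends and so be a side of the
-- triangle, which is not contained in the interior.
theorem not_isCuspArc_of_disjoint {γ : Set (Orbifold Φ)}
    (h : ∀ γ' ∈ projEdges Φ T, Disjoint γ γ') : ¬IsCuspArc Φ γ := by
  rintro ⟨a, b, hab, -, -, -, -, rfl⟩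
  obtain ⟨p, hp, -⟩ := exists_two_points hab
  obtain ⟨V, hV, hsub⟩ := exists_subset_openTriangle_of_disjoint hT (isPreconnected_line a b)
    ⟨p, hp⟩ h
  have h3 := hT.three_vertices V hV
  have hunion := (line_eq_union_rays hp).1
  rw [hunion] at hsub
  obtain ⟨c, hc⟩ := exists_hasVertices_of_mem_mem h3
    (ray_end_mem h3 (Set.subset_union_left.trans hsub))
    (ray_end_mem h3 (Set.subset_union_right.trans hsub)) hab
  exact hc.notMem_openTriangle hp (hsub (by rwa [← hunion]))

theorem subset_of_isCompatible {C : Set (Set (Orbifold Φ))} (hC : IsCompatible Φ C)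
    (hEC : projEdges Φ T ⊆ C) : C ⊆ projEdges Φ T ∪ projCentralRays Φ T := by
  intro γ hγ
  by_cases hE : γ ∈ projEdges Φ T
  · exact Or.inl hE
  have h : ∀ γ' ∈ projEdges Φ T, Disjoint γ γ' := fun γ' hγ' =>
    hC.2 hγ (hEC hγ') fun heq => hE (heq ▸ hγ')
  rcases hC.1 γ hγ with h1 | h1 | h1
  · exact absurd h1 (not_isCuspArc_of_disjoint hT h)
  · exact Or.inr (mem_projCentralRays_of_isConeArc hT hfin hinv h1 h)
  · exact Or.inr (mem_projCentralRays_of_isConeArc hT hfin hinv h1 h)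

/-- The edges and central rays are compatible, and every compatible collection containing the edges
lies in this one; so it is the greatest such collection. -/
theorem isQuotientTriangulation_iff {C : Set (Set (Orbifold Φ))} (hEC : projEdges Φ T ⊆ C) :
    IsQuotientTriangulation Φ C ↔ C = projEdges Φ T ∪ projCentralRays Φ T := by
  have hcomp := isCompatible_union hT hfin hinv
  constructor
  · intro h
    exact h.eq_of_subset hcomp (subset_of_isCompatible hT hfin hinv h.1 hEC)
  · rintro rfl
    exact ⟨hcomp, fun D hD hsub =>
      subset_of_isCompatible hT hfin hinv hD (Set.subset_union_left.trans hsub)⟩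

theorem existsUnique_isQuotientTriangulation :
    ∃! C : Set (Set (Orbifold Φ)), IsQuotientTriangulation Φ C ∧ projEdges Φ T ⊆ C :=
  ⟨projEdges Φ T ∪ projCentralRays Φ T,
    ⟨(isQuotientTriangulation_iff hT hfin hinv Set.subset_union_left).mpr rfl,
      Set.subset_union_left⟩,
    fun _ h => (isQuotientTriangulation_iff hT hfin hinv h.2).mp h.1⟩

theorem setOf_not_isStructuralArc {C : Set (Set (Orbifold Φ))} (hC : IsQuotientTriangulation Φ C)
    (hEC : projEdges Φ T ⊆ C) : {γ ∈ C | ¬IsStructuralArc Φ γ} = projEdges Φ T := by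
  ext γ
  constructor
  · rintro ⟨hγ, hs⟩
    rw [(isQuotientTriangulation_iff hT hfin hinv hEC).mp hC] at hγ
    exact hγ.resolve_right fun h =>
      hs (isStructuralArc_of_mem_projCentralRays hT hfin hinv h)
  · intro hγ
    refine ⟨hEC hγ, ?_⟩
    obtain ⟨a, b, h, rfl⟩ := (mem_projEdges_iff hT).mp hγ
    exact h.not_isStructuralArc hT hinv

end Central

end QuotientTriangulation

theorem lemma3p1 (Φ : Subgroup PSL(2, ℤ)) (hfin : Φ.FiniteIndex)
    (hΦ : Φ ≠ QuotientTriangulation.Gamma3)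
    (T : Set (Set (OnePoint ℝ))) (hT : QuotientTriangulation.IsIdealTriangulation T)
    (hinv : QuotientTriangulation.IsInvariant Φ T) :
    -- the edges of `T` project to arcs, which are not structural and pairwise equal or compatible
    ((∀ γ ∈ QuotientTriangulation.projEdges Φ T,
        QuotientTriangulation.IsArc Φ γ ∧ ¬ QuotientTriangulation.IsStructuralArc Φ γ) ∧
      (QuotientTriangulation.projEdges Φ T).PairwiseDisjoint id) ∧
    -- they cut the orbifold into the projections of the open triangles
    ((QuotientTriangulation.projPieces Φ T).PairwiseDisjoint id ∧
      ⋃₀ QuotientTriangulation.projPieces Φ T = (⋃₀ QuotientTriangulation.projEdges Φ T)ᶜ) ∧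
    -- the types of the pieces
    (∀ V ∈ T, QuotientTriangulation.IsTypeI Φ V ∨ QuotientTriangulation.IsTypeII Φ V ∨
      QuotientTriangulation.IsTypeIIIa Φ V ∨ QuotientTriangulation.IsTypeIIIb Φ V ∨
      QuotientTriangulation.IsMonogon Φ V) ∧
    -- the induced quotient triangulation
    (∃! C : Set (Set (QuotientTriangulation.Orbifold Φ)),
      QuotientTriangulation.IsQuotientTriangulation Φ C ∧
      QuotientTriangulation.projEdges Φ T ⊆ C) ∧
    (∀ C : Set (Set (QuotientTriangulation.Orbifold Φ)),
      QuotientTriangulation.IsQuotientTriangulation Φ C →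
      QuotientTriangulation.projEdges Φ T ⊆ C →
      {γ ∈ C | ¬ QuotientTriangulation.IsStructuralArc Φ γ} =
        QuotientTriangulation.projEdges Φ T) := by
  open QuotientTriangulation in
  refine ⟨⟨fun γ hγ => ?_, projEdges_pairwiseDisjoint hT hinv⟩,
    ⟨projPieces_pairwiseDisjoint hT hinv, sUnion_projPieces hT hinv⟩,
    fun V hV => type_cases hT hfin hinv hΦ hV, existsUnique_isQuotientTriangulation hT hfin hinv,
    fun C hC hEC => setOf_not_isStructuralArc hT hfin hinv hC hEC⟩
  obtain ⟨a, b, h, rfl⟩ := (QuotientTriangulation.mem_projEdges_iff hT).mp hγ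
  exact ⟨h.isArc hT hinv hfin, h.not_isStructuralArc hT hinv⟩
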